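/- Let $T>0$, $a<b$, $Q=[0,T]\times[a,b]$. Let $g\in C^5([0,\infty);\mathbb R)$, and let $u\in C^6(Q;\mathbb C)$ satisfy $$u_t=\mathrm i\,u_{xx}+\mathrm i\,g(|u|^2)\,u+f\ \text{ on }Q,\qquad u(t,a)=u(t,b)=0\ \ (0\le t\le T),\qquad u(0,x)=u_0(x)\ \ (a\le x\le b).$$ For positive integers $N,J$ put $\tau=T/N$, $h=(b-a)/(J+1)$, $t_n=n\tau$, $t^{n+1/2}=t_n+\tau/2$, $x_j=a+jh$ $(0\le j\le J+1)$, and $u^n_j=u(t_n,x_j)$, $u^{n+1/2}_j=u(t^{n+1/2},x_j)$. Let $\mathbb C_h$ be the space of complex grid functions $(v_j)_{j=0}^{J+1}$, and $\mathbb C_h^\circ$ its subspace given by $v_0=v_{J+1}=0$. Write $\Delta_hv_j=(v_{j-1}-2v_j+v_{j+1})/h^2$ for $1\le j\le J$, and $$\|v\|_{1,h}^2=h\sum_{j=0}^{J+1}|v_j|^2+h\sum_{j=0}^{J}\Big|\frac{v_{j+1}-v_j}{h}\Big|^2 .$$ For $\delta>0$ let $p_\delta$ be the unique polynomial of degree at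 most $7$ with $p_\delta(\delta)=\delta$, $p_\delta'(\delta)=1$, $p_\delta''(\delta)=p_\delta'''(\delta)=0$, $p_\delta(2\delta)=2\delta$, $p_\delta'(2\delta)=p_\delta''(2\delta)=p_\delta'''(2\delta)=0$. Let $\mathfrak n_\delta:\mathbb R\to\mathbb R$ be the odd function with $\mathfrak n_\delta(x)=x$ on $[0,\delta]$, $\mathfrak n_\delta=p_\delta$ on $(\delta,2\delta]$, $\mathfrak n_\delta(x)=2\delta$ for $x>2\delta$, and let $\gamma_\delta(z)=\mathfrak n_\delta(\operatorname{Re}z)+\mathrm i\,\mathfrak n_\delta(\operatorname{Im}z)$ for $z\in\mathbb C$. The modified scheme (MRFD) with parameter $\delta$ seeks $V^{1/2},V^0,\dots,V^N\in\mathbb C_h^\circ$ and real grid functions $\Phi^{1/2},\dots,\Phi^{N-1/2}$ such that (equations between grid functions are pointwise, the difference equations and the equation for $V^0$ being imposed at the nodes $x_1,\dots,x_J$): - $\Delta_hV^0=u_0''$, and $V^{1/2}-V^0=\mathrm i\frac\tau2\Delta_h\frac{V^{1/2}+V^0}2+\mathrm i\frac\tau2\,g(|u_0|^2)\frac{V^{1/2}+V^0}2+\frac\tau2\,\frac{f(t^{1/2},\cdot)+f(t_0,\cdot)}2$;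 - $\Phi^{1/2}=g(|\gamma_\delta(V^{1/2})|^2)$ and $\Phi^{n+1/2}=2g(|\gamma_\delta(V^n)|^2)-\Phi^{n-1/2}$ for $1\le n\le N-1$; - $V^{n+1}-V^n=\mathrm i\tau\Delta_h\frac{V^{n+1}+V^n}2+\mathrm i\tau\,\mathfrak n_\delta(\Phi^{n+1/2})\,\gamma_\delta\!\big(\frac{V^{n+1}+V^n}2\big)+\tau\,\frac{f(t_{n+1},\cdot)+f(t_n,\cdot)}2$ for $0\le n\le N-1$. **Theorem.** Let $\delta_\star>0$ with $\delta_\star\ge\max\{\max_Q|u|,\max_Q|g(|u|^2)|\}$. There are constants $C^A,C^B,C^C>0$, independent of $N$ and $J$ (that is, of $\tau$ and $h$), such that for all positive integers $N,J$ with $\tau\,C^A\le\frac12$, and with no further relation between $\tau$ and $h$, every solution $(V,\Phi)$ of (MRFD) with $\delta=\delta_\star$ satisfies $$\|u^{1/2}-V^{1/2}\|_{1,h}+\max_{0\le m\le N}\|u^m-V^m\|_{1,h}\le C^B(\tau^2+h^2)$$ and $$\max_{0\le m\le N-1}\big\|g(|u^{m+1/2}|^2)-\Phi^{m+1/2}\big\|_{1,h}\le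 C^C(\tau^2+h^2).$$ -/

import Mathlib

noncomputable section

namespace RelaxNLS

open Set Polynomial

/-! ### The initial and boundary value problem -/

/-- `u` solves `u_t = i u_xx + i g(|u|²) u + f` on `[0,T] × [a,b]` with homogeneous Dirichlet
boundary conditions and initial value `u₀`; the derivatives are one-sided at the endpoints of the
intervals (they are genuine derivatives since `u` will be assumed smooth on the rectangle). -/
structure IsSolution (T a b : ℝ) (g : ℝ → ℝ) (f : ℝ → ℝ → ℂ) (u₀ : ℝ → ℂ)
    (u : ℝ → ℝ → ℂ) : Prop where
  pde : ∀ t ∈ Icc 0 T, ∀ x ∈ Icc a b,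
    derivWithin (fun s => u s x) (Icc 0 T) t =
      Complex.I * iteratedDerivWithin 2 (fun y => u t y) (Icc a b) x
        + Complex.I * (g (‖u t x‖ ^ 2) : ℂ) * u t x + f t x
  boundary : ∀ t ∈ Icc 0 T, u t a = 0 ∧ u t b = 0
  initial : ∀ x ∈ Icc a b, u 0 x = u₀ x

/-! ### Meshes, grid functions and discrete norms -/

/-- The time step `τ = T / N`. -/
def timeStep (T : ℝ) (N : ℕ) : ℝ := T / N

/-- The mesh width `h = (b - a) / (J + 1)`. -/
def meshWidth (a b : ℝ) (J : ℕ) : ℝ := (b - a) / (J + 1)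

/-- The time node `t_n = n τ`. -/
def timeNode (T : ℝ) (N n : ℕ) : ℝ := n * timeStep T N

/-- The intermediate time node `t^{n+1/2} = t_n + τ / 2`. -/
def midNode (T : ℝ) (N n : ℕ) : ℝ := timeNode T N n + timeStep T N / 2

/-- The space nodes `x_j = a + j h`, `j = 0, …, J + 1`. -/
def spaceNode (a b : ℝ) (J : ℕ) (j : Fin (J + 2)) : ℝ := a + (j : ℕ) * meshWidth a b J

/-- Complex grid functions `(v_j)`, `j = 0, …, J + 1`. -/
abbrev Grid (J : ℕ) : Type := Fin (J + 2) → ℂ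

/-- Real grid functions. -/
abbrev RealGrid (J : ℕ) : Type := Fin (J + 2) → ℝ

/-- The grid functions that vanish at both boundary nodes. -/
def VanishesAtBoundary {J : ℕ} (v : Grid J) : Prop := v 0 = 0 ∧ v (Fin.last (J + 1)) = 0

/-- The interior nodes: `i = 0, …, J - 1` stands for the node with index `i + 1`. -/
def interior {J : ℕ} (i : Fin J) : Fin (J + 2) := i.succ.castSucc

/-- The discrete Laplacian `(v_{j-1} - 2 v_j + v_{j+1}) / h²` at the interior node `j = i + 1`. -/
def discreteLaplacian {J : ℕ} (h : ℝ) (v : Grid J) (i : Fin J) : ℂ :=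
  (v i.castSucc.castSucc - 2 * v i.succ.castSucc + v i.succ.succ) / (h : ℂ) ^ 2

/-- The restriction of a function on `[a,b]` to the space nodes. -/
def restrict (a b : ℝ) (J : ℕ) (z : ℝ → ℂ) : Grid J := fun j => z (spaceNode a b J j)

/-- `w` is the discrete elliptic projection of `v` : it vanishes at the boundary nodes and its
discrete Laplacian agrees with `v''` at the interior nodes. -/
def IsEllipticProjection (a b : ℝ) (J : ℕ) (v : ℝ → ℂ) (w : Grid J) : Prop :=
  VanishesAtBoundary w ∧ ∀ i : Fin J, discreteLaplacian (meshWidth a b J) w i =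
    iteratedDerivWithin 2 v (Icc a b) (spaceNode a b J (interior i))

/-- The discrete `L²` norm `(h ∑_{j=0}^{J+1} |v_j|²)^{1/2}`. -/
def normZero {J : ℕ} (h : ℝ) (v : Grid J) : ℝ :=
  Real.sqrt (h * ∑ j : Fin (J + 2), ‖v j‖ ^ 2)

/-- The discrete `H¹` seminorm `(h ∑_{j=0}^{J} |(v_{j+1} - v_j)/h|²)^{1/2}`. -/
def seminormOne {J : ℕ} (h : ℝ) (v : Grid J) : ℝ :=
  Real.sqrt (h * ∑ j : Fin (J + 1), ‖(v j.succ - v j.castSucc) / (h : ℂ)‖ ^ 2)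

/-- The discrete `H¹` norm. -/
def normOne {J : ℕ} (h : ℝ) (v : Grid J) : ℝ :=
  Real.sqrt (normZero h v ^ 2 + seminormOne h v ^ 2)

/-! ### The mollifier -/

/-- The eight Hermite conditions on a polynomial of degree at most seven. -/
structure IsCutoffPoly (δ : ℝ) (p : ℝ[X]) : Prop where
  natDegree_le : p.natDegree ≤ 7
  left_zero : p.eval δ = δ
  left_one : (derivative p).eval δ = 1
  left_two : (derivative (derivative p)).eval δ = 0
  left_three : (derivative (derivative (derivative p))).eval δ = 0
  right_zero : p.eval (2 * δ) = 2 * δ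
  right_one : (derivative p).eval (2 * δ) = 0
  right_two : (derivative (derivative p)).eval (2 * δ) = 0
  right_three : (derivative (derivative (derivative p))).eval (2 * δ) = 0

/-- The normalized profile of `p_δ` in the variable `s = (x - δ) / δ`. -/
def profile : ℝ[X] := 1 + X + 15 * X ^ 4 - 39 * X ^ 5 + 34 * X ^ 6 - 10 * X ^ 7

/-- The polynomial `p_δ`; see `cutoffPoly_spec` and `cutoffPoly_unique`. -/
def cutoffPoly (δ : ℝ) : ℝ[X] := C δ * profile.comp (C δ⁻¹ * X - 1)

theorem cutoffPoly_spec {δ : ℝ} (hδ : 0 < δ) : IsCutoffPoly δ (cutoffPoly δ) := by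
  have h0 : δ ≠ 0 := hδ.ne'
  have e1 : δ⁻¹ * δ - 1 = 0 := by rw [inv_mul_cancel₀ h0, sub_self]
  have e2 : δ⁻¹ * (2 * δ) - 1 = 1 := by
    have : δ⁻¹ * (2 * δ) = 2 * (δ⁻¹ * δ) := by ring
    rw [this, inv_mul_cancel₀ h0]; norm_num
  have d1 : derivative (cutoffPoly δ) = (derivative profile).comp (C δ⁻¹ * X - 1) := by
    simp [cutoffPoly, derivative_comp, ← mul_assoc, ← C_mul, h0]
  have d2 : derivative (derivative (cutoffPoly δ)) =
      C δ⁻¹ * (derivative (derivative profile)).comp (C δ⁻¹ * X - 1) := by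
    rw [d1]; simp [derivative_comp]
  have d3 : derivative (derivative (derivative (cutoffPoly δ))) =
      C δ⁻¹ * (C δ⁻¹ * (derivative (derivative (derivative profile))).comp (C δ⁻¹ * X - 1)) := by
    rw [d2]; simp [derivative_comp]
  refine ⟨?_, ?_, ?_, ?_, ?_, ?_, ?_, ?_, ?_⟩
  · unfold cutoffPoly
    refine (natDegree_C_mul_le _ _).trans ?_
    refine natDegree_comp_le.trans ?_
    have h1 : profile.natDegree ≤ 7 := by unfold profile; compute_degree
    have h2 : (C δ⁻¹ * X - 1 : ℝ[X]).natDegree ≤ 1 := by compute_degree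
    nlinarith
  · simp [cutoffPoly, e1, profile]; field_simp
  · rw [d1]; simp [e1, profile]
  · rw [d2]; simp [e1, profile]
  · rw [d3]; simp [e1, profile]
  · simp [cutoffPoly, e2, profile]; field_simp; ring
  · rw [d1]; simp [e2, profile]; norm_num
  · rw [d2]; simp [e2, profile]; norm_num
  · rw [d3]; simp [e2, profile]; norm_num

theorem cutoffPoly_unique {δ : ℝ} (hδ : 0 < δ) {p : ℝ[X]} (hp : IsCutoffPoly δ p) :
    p = cutoffPoly δ := by
  have hq := cutoffPoly_spec hδ
  by_contra hne
  set q := cutoffPoly δ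
  have hr : p - q ≠ 0 := sub_ne_zero.2 hne
  have hdeg : (p - q).natDegree ≤ 7 :=
    (natDegree_sub_le _ _).trans (max_le hp.natDegree_le hq.natDegree_le)
  have d1 : (X - C δ) ^ 4 ∣ p - q := by
    rw [← le_rootMultiplicity_iff hr]
    refine Nat.succ_le_of_lt ((lt_rootMultiplicity_iff_isRoot_iterate_derivative hr).2 ?_)
    intro m hm
    interval_cases m <;>
      simp [IsRoot, hp.left_zero, hp.left_one, hp.left_two, hp.left_three, hq.left_zero,
        hq.left_one, hq.left_two, hq.left_three]
  have d2 : (X - C (2 * δ)) ^ 4 ∣ p - q := by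
    rw [← le_rootMultiplicity_iff hr]
    refine Nat.succ_le_of_lt ((lt_rootMultiplicity_iff_isRoot_iterate_derivative hr).2 ?_)
    intro m hm
    interval_cases m <;>
      simp only [IsRoot, Function.iterate_succ, Function.iterate_zero, Function.comp, id,
        derivative_sub, eval_sub, hp.right_zero, hp.right_one, hp.right_two, hp.right_three,
        hq.right_zero, hq.right_one, hq.right_two, hq.right_three, sub_self]
  have hcop : IsCoprime ((X - C δ) ^ 4) ((X - C (2 * δ)) ^ 4) :=
    (isCoprime_X_sub_C_of_isUnit_sub (by
      rw [isUnit_iff_ne_zero]; intro h; apply hδ.ne'; linarith)).pow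
  have hd := natDegree_le_of_dvd (hcop.mul_dvd d1 d2) hr
  rw [natDegree_mul (pow_ne_zero _ (X_sub_C_ne_zero _)) (pow_ne_zero _ (X_sub_C_ne_zero _)),
    natDegree_pow, natDegree_pow, natDegree_X_sub_C, natDegree_X_sub_C] at hd
  omega

/-- The cutoff on the half-line `x ≥ 0`. -/
def cutoffNonneg (δ x : ℝ) : ℝ :=
  if x ≤ δ then x else if x ≤ 2 * δ then (cutoffPoly δ).eval x else 2 * δ

/-- The odd cutoff `n_δ`. -/
def cutoff (δ x : ℝ) : ℝ := if 0 ≤ x then cutoffNonneg δ x else -cutoffNonneg δ (-x)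

/-- The complex mollifier `γ_δ(z) = n_δ(Re z) + i n_δ(Im z)`. -/
def mollifier (δ : ℝ) (z : ℂ) : ℂ := (cutoff δ z.re : ℂ) + Complex.I * (cutoff δ z.im : ℂ)

/-! ### The modified relaxation finite difference scheme -/

/-- `Vhalf`, `(V n)` for `n = 0, …, N` and `(Φ n)` for `n = 0, …, N - 1` (standing for `V^{1/2}`,
`V^n` and `Φ^{n+1/2}`) are approximations produced by the modified scheme with parameter `δ`.
Both sides of each difference equation vanish at the boundary nodes, so that the equations are
written at the interior nodes; `V n` and `Φ n` beyond the stated ranges play no role. -/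
structure IsModifiedScheme (T a b : ℝ) (g : ℝ → ℝ) (f : ℝ → ℝ → ℂ) (u₀ : ℝ → ℂ) (δ : ℝ)
    (N J : ℕ) (Vhalf : Grid J) (V : ℕ → Grid J) (Φ : ℕ → RealGrid J) : Prop where
  boundary_half : VanishesAtBoundary Vhalf
  boundary : ∀ n ≤ N, VanishesAtBoundary (V n)
  initial : IsEllipticProjection a b J u₀ (V 0)
  half_step : ∀ i : Fin J,
    Vhalf (interior i) - V 0 (interior i) =
      Complex.I * ((timeStep T N / 2 : ℝ) : ℂ) *
          discreteLaplacian (meshWidth a b J) (fun j => (Vhalf j + V 0 j) / 2) i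
        + Complex.I * ((timeStep T N / 2 : ℝ) : ℂ) *
          ((g (‖u₀ (spaceNode a b J (interior i))‖ ^ 2) : ℂ) *
            ((Vhalf (interior i) + V 0 (interior i)) / 2))
        + ((timeStep T N / 2 : ℝ) : ℂ) *
          ((f (midNode T N 0) (spaceNode a b J (interior i))
            + f (timeNode T N 0) (spaceNode a b J (interior i))) / 2)
  phi_zero : ∀ j, Φ 0 j = g (‖mollifier δ (Vhalf j)‖ ^ 2)
  phi_succ : ∀ n, n + 1 < N → ∀ j,
    Φ (n + 1) j = 2 * g (‖mollifier δ (V (n + 1) j)‖ ^ 2) - Φ n j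
  step : ∀ n < N, ∀ i : Fin J,
    V (n + 1) (interior i) - V n (interior i) =
      Complex.I * (timeStep T N : ℂ) *
          discreteLaplacian (meshWidth a b J) (fun j => (V (n + 1) j + V n j) / 2) i
        + Complex.I * (timeStep T N : ℂ) *
          ((cutoff δ (Φ n (interior i)) : ℂ) *
            mollifier δ ((V (n + 1) (interior i) + V n (interior i)) / 2))
        + (timeStep T N : ℂ) *
          ((f (timeNode T N (n + 1)) (spaceNode a b J (interior i))
            + f (timeNode T N n) (spaceNode a b J (interior i))) / 2)

end RelaxNLS

end

noncomputable section

namespace RelaxNLS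

open Set

/-! ### Edge functions and the discrete `H¹` seminorm -/

/-! The error is measured in the discrete `H¹` seminorm, which on grid functions vanishing at the
left end also controls the maximum norm (`norm_le_seminormOne`). The linear part of a step is
exactly conservative in this seminorm (`energy_inequality`): paired with the discrete Laplacian of
the sum of the two time levels, the Laplacian term is purely imaginary. No quotient of `τ` and `h`
enters, so the two steps need no relation.

The energy inequality admits only residuals that vanish at the boundary and are small in `H¹`, and
the spatial truncation error, extended by zero, need not be. Therefore `u` is replaced by `u + η`,
where `η` solves a discrete Poisson problem and makes the discrete Laplacian equal to `u_xx` at the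
interior nodes. The residual of a step then contains `η` only through its time increments
(`Setting.exists_ellipticCorrection`, `Setting.exists_isCorrection`).

The main difficulty is the relaxation. For the potential error `e` the scheme gives `e (n+1) + e n =
2 (…) + q`, an alternating recursion in which only the two-step increments `e (n+2) - e n` are of
order `τ` (`ErrorSystem.potentialError_add_two_sub`). These increments involve the difference
quotient `X` of the solution error, so `X` has to be estimated as well. The differenced step
equation has the source `B (n+1) - B n`, where `B` is the error of the nonlinear term, and this
one-step difference is not of order `τ`. The remedy is `energy_inequality_split`: half of the source
is moved to each time level. For the modified quotient `X (n+1) - (i/2)(B (n+1) - B n)`,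
neighbouring halves then combine to `(i/2)(B (n+2) - B n)`, a two-step difference.

Two-step differences of `B` in the `H¹` seminorm are mixed differences over a cube whose directions
are a mesh edge, the time, and the passage from exact to approximate data. A Leibniz rule and a
chain rule on cubes (`CubeBound.mul`, `DiffBound.comp`) yield `exists_nonlinear_bound`, provided
that the errors are small. The resulting scalar recursion is closed by Gronwall for `ε + τ ∑ X`,
with `ε = τ² + h²` (`ErrorRecursion.exists_bound`). The smallness is propagated by induction: since
the cutoffs are bounded and Lipschitz, a crude one-step estimate holds without any smallness.

This argument needs `τ` and `h` small separately. If `h` is bounded below, all approximations are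
bounded (`Setting.exists_coarse_bound`), and a bounded error is at most a constant times `h²`. -/

/-- The forward difference of a grid function over an edge. -/
def gridDiff {J : ℕ} (v : Grid J) (j : Fin (J + 1)) : ℂ := v j.succ - v j.castSucc

/-- The discrete `L²` norm of `w / h` for a real function `w` on the edges. -/
def edgeNorm {J : ℕ} (h : ℝ) (w : Fin (J + 1) → ℝ) : ℝ :=
  Real.sqrt (h * ∑ j, (w j / h) ^ 2)

section Seminorm

variable {J : ℕ} {h ℓ : ℝ}

theorem seminormOne_nonneg (v : Grid J) : 0 ≤ seminormOne h v := Real.sqrt_nonneg _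

/-- Up to the factor `1/√h` this is a Euclidean norm, from which the triangle inequality and
homogeneity are inherited. -/
theorem edgeNorm_eq (hh : 0 < h) (w : Fin (J + 1) → ℝ) :
    edgeNorm h w = ‖(WithLp.toLp 2 w : EuclideanSpace ℝ (Fin (J + 1)))‖ / Real.sqrt h := by
  rw [EuclideanSpace.norm_eq, ← Real.sqrt_div (by positivity), edgeNorm]
  congr 1
  simp only [div_pow, Real.norm_eq_abs, sq_abs]
  rw [← Finset.sum_div]
  field_simp

theorem seminormOne_eq_edgeNorm (hh : 0 < h) (v : Grid J) :
    seminormOne h v = edgeNorm h (fun j => ‖gridDiff v j‖) := by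
  unfold seminormOne edgeNorm gridDiff
  simp [abs_of_pos hh]

theorem edgeNorm_add_le (hh : 0 < h) (w w' : Fin (J + 1) → ℝ) :
    edgeNorm h (fun j => w j + w' j) ≤ edgeNorm h w + edgeNorm h w' := by
  rw [edgeNorm_eq hh, edgeNorm_eq hh, edgeNorm_eq hh, ← add_div]
  gcongr
  exact norm_add_le (WithLp.toLp 2 w : EuclideanSpace ℝ (Fin (J + 1))) (WithLp.toLp 2 w')

theorem edgeNorm_const_mul (hh : 0 < h) {c : ℝ} (hc : 0 ≤ c) (w : Fin (J + 1) → ℝ) :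
    edgeNorm h (fun j => c * w j) = c * edgeNorm h w := by
  rw [edgeNorm_eq hh, edgeNorm_eq hh, ← mul_div_assoc]
  congr 1
  have := norm_smul c (WithLp.toLp 2 w : EuclideanSpace ℝ (Fin (J + 1)))
  rw [Real.norm_of_nonneg hc] at this
  exact this

theorem edgeNorm_mono (hh : 0 < h) {w w' : Fin (J + 1) → ℝ} (h0 : ∀ j, 0 ≤ w j)
    (hw : ∀ j, w j ≤ w' j) : edgeNorm h w ≤ edgeNorm h w' := by
  unfold edgeNorm
  refine Real.sqrt_le_sqrt (mul_le_mul_of_nonneg_left (Finset.sum_le_sum fun j _ => ?_) hh.le)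
  have := h0 j
  have := hw j
  gcongr

/-- Each edge contributes `h c²` and the edges have total length `ℓ`. This is how Lipschitz bounds
of smooth functions become seminorm bounds independent of the mesh. -/
theorem edgeNorm_const (hh : 0 < h) (hℓ : h * (J + 1) = ℓ) {c : ℝ} (hc : 0 ≤ c) :
    edgeNorm (J := J) h (fun _ => h * c) = Real.sqrt ℓ * c := by
  unfold edgeNorm
  have : h * ∑ _j : Fin (J + 1), (h * c / h) ^ 2 = ℓ * c ^ 2 := by
    rw [← hℓ, Finset.sum_const, Finset.card_univ, Fintype.card_fin, nsmul_eq_mul]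
    push_cast
    field_simp
  rw [this, Real.sqrt_mul (by rw [← hℓ]; positivity), Real.sqrt_sq hc]

theorem seminormOne_le_of_gridDiff_le (hh : 0 < h) (v : Grid J) {w : Fin (J + 1) → ℝ}
    (hw : ∀ j, ‖gridDiff v j‖ ≤ w j) : seminormOne h v ≤ edgeNorm h w := by
  rw [seminormOne_eq_edgeNorm hh]
  exact edgeNorm_mono hh (fun _ => norm_nonneg _) hw

theorem seminormOne_le_const (hh : 0 < h) (hℓ : h * (J + 1) = ℓ) {v : Grid J} {c : ℝ}
    (hc : 0 ≤ c) (hv : ∀ j, ‖gridDiff v j‖ ≤ h * c) : seminormOne h v ≤ Real.sqrt ℓ * c :=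
  (seminormOne_le_of_gridDiff_le hh v hv).trans (edgeNorm_const hh hℓ hc).le

theorem gridDiff_add (v w : Grid J) (j : Fin (J + 1)) :
    gridDiff (v + w) j = gridDiff v j + gridDiff w j := by
  simp [gridDiff]; ring

theorem gridDiff_sub (v w : Grid J) (j : Fin (J + 1)) :
    gridDiff (v - w) j = gridDiff v j - gridDiff w j := by
  simp [gridDiff]; ring

theorem gridDiff_smul (c : ℂ) (v : Grid J) (j : Fin (J + 1)) :
    gridDiff (c • v) j = c * gridDiff v j := by
  simp [gridDiff]; ring

theorem seminormOne_add_le (hh : 0 < h) (v w : Grid J) :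
    seminormOne h (v + w) ≤ seminormOne h v + seminormOne h w := by
  rw [seminormOne_eq_edgeNorm hh v, seminormOne_eq_edgeNorm hh w]
  refine (seminormOne_le_of_gridDiff_le hh _ fun j => ?_).trans (edgeNorm_add_le hh _ _)
  rw [gridDiff_add]
  exact norm_add_le _ _

theorem seminormOne_smul (hh : 0 < h) (c : ℂ) (v : Grid J) :
    seminormOne h (c • v) = ‖c‖ * seminormOne h v := by
  rw [seminormOne_eq_edgeNorm hh, seminormOne_eq_edgeNorm hh,
    ← edgeNorm_const_mul hh (norm_nonneg c)]
  simp [gridDiff_smul]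

theorem seminormOne_neg (hh : 0 < h) (v : Grid J) : seminormOne h (-v) = seminormOne h v := by
  have := seminormOne_smul hh (-1) v
  simpa using this

theorem seminormOne_sub_le (hh : 0 < h) (v w : Grid J) :
    seminormOne h (v - w) ≤ seminormOne h v + seminormOne h w := by
  rw [sub_eq_add_neg, ← seminormOne_neg hh w]
  exact seminormOne_add_le hh v (-w)

theorem seminormOne_zero : seminormOne (J := J) h 0 = 0 := by
  simp [seminormOne]

theorem seminormOne_sq (hh : 0 < h) (v : Grid J) :
    seminormOne h v ^ 2 = (∑ j, ‖gridDiff v j‖ ^ 2) / h := by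
  unfold seminormOne
  rw [Real.sq_sqrt (by positivity)]
  simp only [norm_div, div_pow, Complex.norm_real, Real.norm_eq_abs, sq_abs]
  rw [← Finset.sum_div]
  simp only [gridDiff]
  field_simp

theorem VanishesAtBoundary.add {v w : Grid J} (hv : VanishesAtBoundary v)
    (hw : VanishesAtBoundary w) : VanishesAtBoundary (v + w) := by
  constructor <;> simp [hv.1, hv.2, hw.1, hw.2]

theorem VanishesAtBoundary.sub {v w : Grid J} (hv : VanishesAtBoundary v)
    (hw : VanishesAtBoundary w) : VanishesAtBoundary (v - w) := by
  constructor <;> simp [hv.1, hv.2, hw.1, hw.2]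

theorem VanishesAtBoundary.smul {v : Grid J} (c : ℂ) (hv : VanishesAtBoundary v) :
    VanishesAtBoundary (c • v) := by
  constructor <;> simp [hv.1, hv.2]

theorem vanishesAtBoundary_zero : VanishesAtBoundary (0 : Grid J) := ⟨rfl, rfl⟩

theorem norm_le_sum_gridDiff {v : Grid J} (hv : v 0 = 0) (j : Fin (J + 2)) :
    ‖v j‖ ≤ ∑ k, ‖gridDiff v k‖ := by
  have key : ∀ m (hm : m < J + 2), ‖v ⟨m, hm⟩‖ ≤
      ∑ k ∈ Finset.univ.filter (fun k : Fin (J + 1) => (k : ℕ) < m), ‖gridDiff v k‖ := by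
    intro m
    induction m with
    | zero => intro hm; simp [show (⟨0, hm⟩ : Fin (J + 2)) = 0 from rfl, hv]
    | succ m ih =>
      intro hm
      have e : Finset.univ.filter (fun k : Fin (J + 1) => (k : ℕ) < m + 1) =
          insert (⟨m, by omega⟩ : Fin (J + 1))
            (Finset.univ.filter (fun k : Fin (J + 1) => (k : ℕ) < m)) := by
        ext k
        simp [Fin.ext_iff]
        omega
      rw [e, Finset.sum_insert (by simp)]
      have e1 : v ⟨m + 1, hm⟩ = gridDiff v ⟨m, by omega⟩ + v ⟨m, by omega⟩ := by
        simp [gridDiff]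
      rw [e1]
      exact (norm_add_le _ _).trans (add_le_add_right (ih (by omega)) _)
  refine (key j j.2).trans (Finset.sum_le_sum_of_subset_of_nonneg (Finset.filter_subset _ _) ?_)
  intros; positivity

/-- The discrete Sobolev inequality. -/
theorem norm_le_seminormOne (hh : 0 < h) (hℓ : h * (J + 1) = ℓ) {v : Grid J} (hv : v 0 = 0)
    (j : Fin (J + 2)) : ‖v j‖ ≤ Real.sqrt ℓ * seminormOne h v := by
  have hℓ0 : 0 ≤ ℓ := by rw [← hℓ]; positivity
  refine (norm_le_sum_gridDiff hv j).trans ?_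
  rw [← Real.sqrt_sq (seminormOne_nonneg (h := h) v), ← Real.sqrt_mul hℓ0]
  refine Real.le_sqrt_of_sq_le ?_
  refine sq_sum_le_card_mul_sum_sq.trans (le_of_eq ?_)
  rw [seminormOne_sq hh, Finset.card_univ, Fintype.card_fin, ← hℓ]
  push_cast
  field_simp

theorem normOne_le_seminormOne (hh : 0 < h) (hℓ : h * (J + 1) = ℓ) {v : Grid J} (hv : v 0 = 0) :
    normOne h v ≤ (2 * ℓ + 1) * seminormOne h v := by
  have hℓ0 : 0 ≤ ℓ := by rw [← hℓ]; positivity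
  have hS := seminormOne_nonneg (h := h) v
  unfold normOne
  refine Real.sqrt_le_iff.2 ⟨by positivity, ?_⟩
  have h1 : normZero h v ^ 2 ≤ 2 * ℓ * (ℓ * seminormOne h v ^ 2) := by
    unfold normZero
    rw [Real.sq_sqrt (by positivity)]
    have : ∑ j, ‖v j‖ ^ 2 ≤ (J + 2) * (ℓ * seminormOne h v ^ 2) := by
      refine (Finset.sum_le_card_nsmul _ _ (ℓ * seminormOne h v ^ 2) fun j _ => ?_).trans
        (le_of_eq ?_)
      · have := pow_le_pow_left₀ (norm_nonneg _) (norm_le_seminormOne hh hℓ hv j) 2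
        rwa [mul_pow, Real.sq_sqrt hℓ0] at this
      · rw [Finset.card_univ, Fintype.card_fin, nsmul_eq_mul]; push_cast; ring
    calc h * ∑ j, ‖v j‖ ^ 2 ≤ h * ((J + 2) * (ℓ * seminormOne h v ^ 2)) := by gcongr
      _ = (h * (J + 2)) * (ℓ * seminormOne h v ^ 2) := by ring
      _ ≤ _ := by
        refine mul_le_mul_of_nonneg_right ?_ (by positivity)
        -- There is one node more than there are edges, hence only `h (J + 2) ≤ 2 ℓ`.
        rw [← hℓ]
        nlinarith [mul_nonneg hh.le (Nat.cast_nonneg (α := ℝ) J)]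
  nlinarith [mul_nonneg hℓ0 hℓ0, mul_nonneg hℓ0 (sq_nonneg (seminormOne h v)),
    mul_nonneg (mul_nonneg hℓ0 hℓ0) (sq_nonneg (seminormOne h v))]

/-! ### Summation by parts and the energy inequality -/

theorem discreteLaplacian_eq (h : ℝ) (v : Grid J) (i : Fin J) :
    discreteLaplacian h v i = (gridDiff v i.succ - gridDiff v i.castSucc) / (h : ℂ) ^ 2 := by
  simp only [discreteLaplacian, gridDiff, Fin.succ_castSucc]
  ring

theorem discreteLaplacian_add (v w : Grid J) (i : Fin J) :
    discreteLaplacian h (v + w) i = discreteLaplacian h v i + discreteLaplacian h w i := by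
  simp only [discreteLaplacian, Pi.add_apply]; ring

theorem discreteLaplacian_sub (v w : Grid J) (i : Fin J) :
    discreteLaplacian h (v - w) i = discreteLaplacian h v i - discreteLaplacian h w i := by
  simp only [discreteLaplacian, Pi.sub_apply]; ring

theorem discreteLaplacian_smul (c : ℂ) (v : Grid J) (i : Fin J) :
    discreteLaplacian h (c • v) i = c * discreteLaplacian h v i := by
  simp only [discreteLaplacian, Pi.smul_apply, smul_eq_mul]; ring

/-- Abel summation; the boundary terms disappear because `p` vanishes at both ends, while `c` is
arbitrary. -/
theorem sum_gridDiff_mul {p : Grid J} (hp : VanishesAtBoundary p) (c : Fin (J + 1) → ℂ) :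
    ∑ j, gridDiff p j * c j = - ∑ i : Fin J, p (interior i) * (c i.succ - c i.castSucc) := by
  simp only [gridDiff, sub_mul, mul_sub, Finset.sum_sub_distrib]
  rw [Fin.sum_univ_castSucc, Fin.sum_univ_succ (fun j : Fin (J + 1) => p j.castSucc * c j)]
  have h1 : p (Fin.last J).succ = 0 := hp.2
  have h2 : p (Fin.castSucc 0) = 0 := hp.1
  rw [h1, h2]
  simp only [interior, Fin.succ_castSucc]
  ring

theorem sum_gridDiff_mul_conj (hh : 0 < h) {p : Grid J} (hp : VanishesAtBoundary p) (w : Grid J) :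
    ∑ j, gridDiff p j * (starRingEnd ℂ) (gridDiff w j) =
      - ((h : ℂ) ^ 2 * ∑ i : Fin J, p (interior i) *
        (starRingEnd ℂ) (discreteLaplacian h w i)) := by
  rw [sum_gridDiff_mul hp, Finset.mul_sum]
  congr 1
  refine Finset.sum_congr rfl fun i _ => ?_
  rw [discreteLaplacian_eq, map_div₀, map_sub, map_pow, Complex.conj_ofReal]
  have : (h : ℂ) ≠ 0 := by exact_mod_cast hh.ne'
  field_simp

theorem re_sum_gridDiff_le (hh : 0 < h) (p w : Grid J) :
    (∑ j, gridDiff p j * (starRingEnd ℂ) (gridDiff w j)).re ≤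
      h * (seminormOne h p * seminormOne h w) := by
  have h1 : (∑ j, gridDiff p j * (starRingEnd ℂ) (gridDiff w j)).re ≤
      ∑ j, ‖gridDiff p j‖ * ‖gridDiff w j‖ := by
    refine (Complex.re_le_norm _).trans ((norm_sum_le _ _).trans (le_of_eq ?_))
    simp
  refine h1.trans ((Real.sum_mul_le_sqrt_mul_sqrt _ _ _).trans (le_of_eq ?_))
  have key : ∀ v : Grid J, Real.sqrt (∑ j, ‖gridDiff v j‖ ^ 2) =
      Real.sqrt h * seminormOne h v := by
    intro v
    rw [← Real.sqrt_sq (seminormOne_nonneg (h := h) v), ← Real.sqrt_mul hh.le,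
      seminormOne_sq hh]
    congr 1
    field_simp
  rw [key, key]
  calc _ = Real.sqrt h * Real.sqrt h * (seminormOne h p * seminormOne h w) := by ring
    _ = _ := by rw [Real.mul_self_sqrt hh.le]

/-- In the interior `x - y - ρ` is `i μ` times the Laplacian of `x + y`, so summation by parts makes
its pairing with `x + y` purely imaginary. The real part of the pairing of `x - y` with `x + y` is
`h (|x|² - |y|²)`, and Cauchy–Schwarz bounds what `ρ` contributes. The condition on `ρ` at the
boundary is what permits the summation by parts. -/
theorem energy_inequality (hh : 0 < h) {x y ρ : Grid J} (hx : VanishesAtBoundary x)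
    (hy : VanishesAtBoundary y) (hρ : VanishesAtBoundary ρ) (μ : ℝ)
    (heq : ∀ i : Fin J, x (interior i) - y (interior i) =
      Complex.I * (μ : ℂ) * discreteLaplacian h (x + y) i + ρ (interior i)) :
    seminormOne h x ≤ seminormOne h y + seminormOne h ρ := by
  have hd : VanishesAtBoundary (x - y - ρ) := (hx.sub hy).sub hρ
  have e1 := sum_gridDiff_mul_conj hh hd (x + y)
  have e2 : (∑ j, gridDiff (x - y - ρ) j * (starRingEnd ℂ) (gridDiff (x + y) j)).re = 0 := by
    rw [e1]
    have : ∀ i : Fin J, (x - y - ρ) (interior i) *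
        (starRingEnd ℂ) (discreteLaplacian h (x + y) i) =
        Complex.I * ((μ * Complex.normSq (discreteLaplacian h (x + y) i) : ℝ) : ℂ) := by
      intro i
      simp only [Pi.sub_apply]
      rw [heq i]
      push_cast
      rw [Complex.normSq_eq_conj_mul_self]
      ring
    rw [Finset.sum_congr rfl fun i _ => this i, ← Finset.mul_sum, ← Complex.ofReal_sum,
      ← Complex.ofReal_pow]
    simp only [Complex.neg_re, Complex.mul_re, Complex.mul_im, Complex.ofReal_re,
      Complex.ofReal_im, Complex.I_re, Complex.I_im]
    ring
  have e3 : (∑ j, gridDiff (x - y) j * (starRingEnd ℂ) (gridDiff (x + y) j)).re =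
      h * (seminormOne h x ^ 2 - seminormOne h y ^ 2) := by
    rw [seminormOne_sq hh, seminormOne_sq hh, ← sub_div, mul_div_cancel₀ _ hh.ne',
      ← Finset.sum_sub_distrib, Complex.re_sum]
    refine Finset.sum_congr rfl fun j _ => ?_
    rw [gridDiff_sub, gridDiff_add, ← Complex.normSq_eq_norm_sq, ← Complex.normSq_eq_norm_sq,
      Complex.normSq_apply, Complex.normSq_apply]
    simp
    ring
  have e4 : (∑ j, gridDiff (x - y) j * (starRingEnd ℂ) (gridDiff (x + y) j)).re =
      (∑ j, gridDiff ρ j * (starRingEnd ℂ) (gridDiff (x + y) j)).re := by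
    have : (∑ j, gridDiff (x - y) j * (starRingEnd ℂ) (gridDiff (x + y) j)) =
        (∑ j, gridDiff (x - y - ρ) j * (starRingEnd ℂ) (gridDiff (x + y) j)) +
        ∑ j, gridDiff ρ j * (starRingEnd ℂ) (gridDiff (x + y) j) := by
      rw [← Finset.sum_add_distrib]
      refine Finset.sum_congr rfl fun j _ => ?_
      rw [gridDiff_sub (x - y) ρ]; ring
    rw [this, Complex.add_re, e2, zero_add]
  have e5 := re_sum_gridDiff_le hh ρ (x + y)
  rw [← e4, e3] at e5
  have e6 := le_of_mul_le_mul_left e5 hh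
  have hsum := seminormOne_add_le hh x y
  have px := seminormOne_nonneg (h := h) x
  have py := seminormOne_nonneg (h := h) y
  have pρ := seminormOne_nonneg (h := h) ρ
  -- The common factor `|x| + |y|` is cancelled from `|x|² - |y|² ≤ |ρ| (|x| + |y|)`; arguing by
  -- contradiction spares the case where it is zero.
  by_contra! hlt
  nlinarith [mul_le_mul_of_nonneg_left hsum pρ]

/-- Since the source `β` enters the step symmetrically, half of it may be attributed to each of the
two time levels. -/
theorem energy_inequality_split (hh : 0 < h) {x y β ρ : Grid J} (hx : VanishesAtBoundary x)
    (hy : VanishesAtBoundary y) (hβ : VanishesAtBoundary β) (hρ : VanishesAtBoundary ρ) (μ : ℝ)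
    (heq : ∀ i : Fin J, x (interior i) - y (interior i) =
      Complex.I * (μ : ℂ) * discreteLaplacian h (x + y) i + Complex.I * β (interior i)
        + ρ (interior i)) :
    seminormOne h (x - (Complex.I / 2) • β) ≤
      seminormOne h (y + (Complex.I / 2) • β) + seminormOne h ρ := by
  refine energy_inequality hh (hx.sub (hβ.smul _)) (hy.add (hβ.smul _)) hρ μ fun i => ?_
  have : x - (Complex.I / 2) • β + (y + (Complex.I / 2) • β) = x + y := by abel
  rw [this]
  simp only [Pi.sub_apply, Pi.add_apply, Pi.smul_apply, smul_eq_mul]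
  linear_combination heq i

/-! ### The discrete Poisson problem -/

/-- Stability of the Poisson problem: pairing `w` with itself gives the squared seminorm on one side
and, by the discrete Sobolev inequality, `ℓ √ℓ M` times the seminorm on the other. -/
theorem seminormOne_le_of_discreteLaplacian_le (hh : 0 < h) (hℓ : h * (J + 1) = ℓ) {w : Grid J}
    (hw : VanishesAtBoundary w) {M : ℝ} (hM : 0 ≤ M)
    (hs : ∀ i : Fin J, ‖discreteLaplacian h w i‖ ≤ M) :
    seminormOne h w ≤ ℓ * Real.sqrt ℓ * M := by
  have hℓ0 : 0 ≤ ℓ := by rw [← hℓ]; positivity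
  have pw := seminormOne_nonneg (h := h) w
  have e1 : h * seminormOne h w ^ 2 = (∑ j, gridDiff w j * (starRingEnd ℂ) (gridDiff w j)).re := by
    rw [seminormOne_sq hh, mul_div_cancel₀ _ hh.ne', Complex.re_sum]
    refine Finset.sum_congr rfl fun j _ => ?_
    rw [Complex.mul_conj, Complex.ofReal_re, Complex.normSq_eq_norm_sq]
  rw [sum_gridDiff_mul_conj hh hw] at e1
  have e2 : h * seminormOne h w ^ 2 ≤
      h ^ 2 * (J * (Real.sqrt ℓ * seminormOne h w * M)) := by
    rw [e1]
    refine (Complex.re_le_norm _).trans ?_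
    rw [norm_neg, norm_mul, norm_pow, Complex.norm_real, Real.norm_of_nonneg hh.le]
    gcongr
    refine (norm_sum_le _ _).trans ?_
    refine (Finset.sum_le_card_nsmul _ _ (Real.sqrt ℓ * seminormOne h w * M)
      fun i _ => ?_).trans (le_of_eq ?_)
    · rw [norm_mul, RCLike.norm_conj]
      exact mul_le_mul (norm_le_seminormOne hh hℓ hw.1 _) (hs i) (norm_nonneg _) (by positivity)
    · simp
  have e3 : seminormOne h w ^ 2 ≤ (h * J) * (Real.sqrt ℓ * seminormOne h w * M) := by
    have : h * seminormOne h w ^ 2 ≤ h * ((h * J) * (Real.sqrt ℓ * seminormOne h w * M)) := by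
      linarith [e2]
    exact le_of_mul_le_mul_left this hh
  have e4 : seminormOne h w ^ 2 ≤ ℓ * (Real.sqrt ℓ * seminormOne h w * M) := by
    refine e3.trans ?_
    gcongr
    rw [← hℓ]; nlinarith
  by_contra! hlt
  have h0 : 0 ≤ ℓ * Real.sqrt ℓ * M := by positivity
  nlinarith

theorem eq_zero_of_discreteLaplacian_eq_zero (hh : 0 < h) {w : Grid J}
    (hw : VanishesAtBoundary w) (hs : ∀ i : Fin J, discreteLaplacian h w i = 0) : w = 0 := by
  have h1 := seminormOne_le_of_discreteLaplacian_le hh rfl hw le_rfl (fun i => by simp [hs i])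
  rw [mul_zero] at h1
  ext j
  have h2 := norm_le_seminormOne hh rfl hw.1 j
  rw [le_antisymm h1 (seminormOne_nonneg w), mul_zero] at h2
  simpa using h2

/-- Extension of a function on the interior nodes by zero. -/
def extendZero (v : Fin J → ℂ) : Grid J := Fin.cons 0 (Fin.snoc v 0 : Fin (J + 1) → ℂ)

theorem extendZero_vanishes (v : Fin J → ℂ) : VanishesAtBoundary (extendZero v) := by
  constructor
  · simp [extendZero]
  · rw [← Fin.succ_last]; simp [extendZero]

theorem extendZero_interior (v : Fin J → ℂ) (i : Fin J) : extendZero v (interior i) = v i := by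
  simp only [interior, extendZero, ← Fin.succ_castSucc, Fin.cons_succ, Fin.snoc_castSucc]

theorem eq_boundary_or_interior (j : Fin (J + 2)) :
    j = 0 ∨ j = Fin.last (J + 1) ∨ ∃ i : Fin J, j = interior i := by
  induction j using Fin.cases with
  | zero => simp
  | succ k =>
    right
    induction k using Fin.lastCases with
    | last => simp
    | cast i => right; exact ⟨i, Fin.succ_castSucc i⟩

theorem VanishesAtBoundary.ext {v w : Grid J} (hv : VanishesAtBoundary v)
    (hw : VanishesAtBoundary w) (hi : ∀ i : Fin J, v (interior i) = w (interior i)) : v = w := by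
  ext j
  rcases eq_boundary_or_interior j with rfl | rfl | ⟨i, rfl⟩
  · rw [hv.1, hw.1]
  · rw [hv.2, hw.2]
  · exact hi i

/-- Uniqueness gives existence, since the discrete Laplacian is an endomorphism of the
finite-dimensional space of interior values. -/
theorem exists_discreteLaplacian_eq (hh : 0 < h) (s : Fin J → ℂ) :
    ∃ w : Grid J, VanishesAtBoundary w ∧ ∀ i, discreteLaplacian h w i = s i := by
  have hadd : ∀ v w : Fin J → ℂ, extendZero (v + w) = extendZero v + extendZero w := fun v w =>
    (extendZero_vanishes _).ext ((extendZero_vanishes _).add (extendZero_vanishes _))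
      fun i => by simp [extendZero_interior]
  have hsmul : ∀ (c : ℂ) (v : Fin J → ℂ), extendZero (c • v) = c • extendZero v := fun c v =>
    (extendZero_vanishes _).ext ((extendZero_vanishes _).smul c)
      fun i => by simp [extendZero_interior]
  let L : (Fin J → ℂ) →ₗ[ℂ] (Fin J → ℂ) :=
    { toFun := fun v i => discreteLaplacian h (extendZero v) i
      map_add' := fun v w => by ext i; simp [hadd, discreteLaplacian_add]
      map_smul' := fun c v => by ext i; simp [hsmul, discreteLaplacian_smul] }
  have hinj : Function.Injective L := by
    rw [injective_iff_map_eq_zero]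
    intro v hv
    have := eq_zero_of_discreteLaplacian_eq_zero hh (extendZero_vanishes v)
      (fun i => congrFun hv i)
    ext i
    rw [← extendZero_interior v i, this]
    rfl
  obtain ⟨v, hv⟩ := LinearMap.injective_iff_surjective.1 hinj s
  exact ⟨extendZero v, extendZero_vanishes v, fun i => congrFun hv i⟩

end Seminorm

end RelaxNLS

end

noncomputable section

namespace RelaxNLS

open Set

/-! ### Finite differences of compositions -/

/-- `F` is twice differentiable on `s`, and `F`, `F'`, `F''` and the Lipschitz constant of `F''` are
bounded by `M`. -/
def C2LipOn (s : Set ℝ) (M : ℝ) (F : ℝ → ℝ) : Prop :=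
  ∃ F₁ F₂ : ℝ → ℝ, (∀ x ∈ s, HasDerivWithinAt F (F₁ x) s x) ∧
    (∀ x ∈ s, HasDerivWithinAt F₁ (F₂ x) s x) ∧ (∀ x ∈ s, |F x| ≤ M) ∧ (∀ x ∈ s, |F₁ x| ≤ M) ∧
    (∀ x ∈ s, |F₂ x| ≤ M) ∧ ∀ x ∈ s, ∀ y ∈ s, |F₂ x - F₂ y| ≤ M * |x - y|

section Composition

variable {s : Set ℝ} {M : ℝ} {F F₁ F₂ : ℝ → ℝ}

theorem abs_sub_le_of_deriv_le (hs : Convex ℝ s) (hF : ∀ x ∈ s, HasDerivWithinAt F (F₁ x) s x)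
    (hM : ∀ x ∈ s, |F₁ x| ≤ M) {x y : ℝ} (hx : x ∈ s) (hy : y ∈ s) :
    |F x - F y| ≤ M * |x - y| :=
  hs.norm_image_sub_le_of_norm_hasDerivWithin_le hF hM hy hx

theorem segment_mem (hs : Convex ℝ s) {a b σ : ℝ} (ha : a ∈ s) (hb : b ∈ s)
    (hσ : σ ∈ Icc (0 : ℝ) 1) : a + σ * (b - a) ∈ s :=
  hs.add_smul_sub_mem ha hb hσ

/-- The difference of the two points is a convex combination of the differences at the end points.
-/
theorem abs_segment_sub_le {a b c d p σ : ℝ} (hσ : σ ∈ Icc (0 : ℝ) 1) (h0 : |a - c| ≤ p)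
    (h1 : |b - d| ≤ p) : |a + σ * (b - a) - (c + σ * (d - c))| ≤ p := by
  have e : a + σ * (b - a) - (c + σ * (d - c)) = (1 - σ) * (a - c) + σ * (b - d) := by ring
  rw [e]
  rw [abs_le] at *
  constructor <;> nlinarith [hσ.1, hσ.2, h0.1, h0.2, h1.1, h1.2]

theorem hasDerivWithinAt_comp_segment (hs : Convex ℝ s)
    (hF : ∀ x ∈ s, HasDerivWithinAt F (F₁ x) s x) {a b σ : ℝ} (ha : a ∈ s) (hb : b ∈ s)
    (hσ : σ ∈ Icc (0 : ℝ) 1) :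
    HasDerivWithinAt (fun σ => F (a + σ * (b - a))) (F₁ (a + σ * (b - a)) * (b - a))
      (Icc 0 1) σ := by
  have h1 : HasDerivWithinAt (fun σ : ℝ => a + σ * (b - a)) (b - a) (Icc 0 1) σ := by
    simpa using (((hasDerivAt_id σ).mul_const (b - a)).const_add a).hasDerivWithinAt
  exact (hF _ (segment_mem hs ha hb hσ)).comp σ h1 fun τ hτ => segment_mem hs ha hb hτ

theorem abs_sub_le_of_unit_deriv {Ψ Ψ' : ℝ → ℝ} {K : ℝ}
    (h : ∀ σ ∈ Icc (0 : ℝ) 1, HasDerivWithinAt Ψ (Ψ' σ) (Icc 0 1) σ)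
    (hK : ∀ σ ∈ Icc (0 : ℝ) 1, |Ψ' σ| ≤ K) : |Ψ 1 - Ψ 0| ≤ K := by
  have := abs_sub_le_of_deriv_le (convex_Icc (0 : ℝ) 1) h hK (right_mem_Icc.2 zero_le_one)
    (left_mem_Icc.2 zero_le_one)
  simpa using this

theorem abs_mul_le_of_le {u v p q : ℝ} (hu : |u| ≤ p) (hv : |v| ≤ q) : |u * v| ≤ p * q := by
  rw [abs_mul]
  exact mul_le_mul hu hv (abs_nonneg _) ((abs_nonneg _).trans hu)

/-- Second mixed difference of a composition. -/
theorem abs_square_diff_le (hs : Convex ℝ s) (hM0 : 0 ≤ M)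
    (hF : ∀ x ∈ s, HasDerivWithinAt F (F₁ x) s x) (hM : ∀ x ∈ s, |F₁ x| ≤ M)
    (hL : ∀ x ∈ s, ∀ y ∈ s, |F₁ x - F₁ y| ≤ M * |x - y|) {a b c d p q r : ℝ}
    (ha : a ∈ s) (hb : b ∈ s) (hc : c ∈ s) (hd : d ∈ s) (hba : |b - a| ≤ p)
    (hca : |c - a| ≤ q) (hdb : |d - b| ≤ q) (hr : |d - c - b + a| ≤ r) :
    |F d - F c - F b + F a| ≤ M * r + M * q * p := by
  -- The segments from `a` to `b` and from `c` to `d` are traversed with a common parameter, so the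
  -- mixed difference is an increment of one function on `[0,1]`. Its derivative splits into `F₁`
  -- times the mixed difference of the arguments and an increment of `F₁` times `b - a`.
  have key := abs_sub_le_of_unit_deriv (K := M * r + M * q * p)
    (Ψ := fun σ => F (c + σ * (d - c)) - F (a + σ * (b - a)))
    (fun σ hσ => (hasDerivWithinAt_comp_segment hs hF hc hd hσ).sub
      (hasDerivWithinAt_comp_segment hs hF ha hb hσ)) ?_
  · have e : F d - F c - F b + F a = (F d - F b) - (F c - F a) := by ring
    rw [e]
    simpa using key
  · intro σ hσ
    have hc' := segment_mem hs hc hd hσ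
    have ha' := segment_mem hs ha hb hσ
    have e : F₁ (c + σ * (d - c)) * (d - c) - F₁ (a + σ * (b - a)) * (b - a) =
        F₁ (c + σ * (d - c)) * (d - c - b + a) +
          (F₁ (c + σ * (d - c)) - F₁ (a + σ * (b - a))) * (b - a) := by ring
    rw [e]
    refine (abs_add_le _ _).trans (add_le_add (abs_mul_le_of_le (hM _ hc') hr)
      (abs_mul_le_of_le ?_ hba))
    exact (hL _ hc' _ ha').trans
      (mul_le_mul_of_nonneg_left (abs_segment_sub_le hσ hca hdb) hM0)

/-- Third mixed difference of a composition. -/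
theorem abs_cube_diff_le (hs : Convex ℝ s) (hM0 : 0 ≤ M)
    (hF : ∀ x ∈ s, HasDerivWithinAt F (F₁ x) s x) (hM : ∀ x ∈ s, |F₁ x| ≤ M)
    (hF₁ : ∀ x ∈ s, HasDerivWithinAt F₁ (F₂ x) s x) (hM₂ : ∀ x ∈ s, |F₂ x| ≤ M)
    (hL : ∀ x ∈ s, ∀ y ∈ s, |F₂ x - F₂ y| ≤ M * |x - y|)
    {a b c d a' b' c' d' px pt ps pxt pxs pts pxts : ℝ}
    (ha : a ∈ s) (hb : b ∈ s) (hc : c ∈ s) (hd : d ∈ s)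
    (ha' : a' ∈ s) (hb' : b' ∈ s) (hc' : c' ∈ s) (hd' : d' ∈ s)
    (hca : |c - a| ≤ px) (hdb : |d - b| ≤ px) (hca' : |c' - a'| ≤ px) (hdb' : |d' - b'| ≤ px)
    (hba : |b - a| ≤ pt) (hba' : |b' - a'| ≤ pt)
    (hps : |d' - d| ≤ ps) (hxt : |d - c - b + a| ≤ pxt) (hxt' : |d' - c' - b' + a'| ≤ pxt)
    (hts : |d' - c' - d + c| ≤ pts) (hxs : |d' - b' - d + b| ≤ pxs)
    (hxts : |(d' - c' - b' + a') - (d - c - b + a)| ≤ pxts) :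
    |(F d' - F c' - F b' + F a') - (F d - F c - F b + F a)| ≤
      M * ((pxt + px * pt) * ps + px * pts + pt * pxs + pxts) := by
  -- The four edges in the third direction are traversed simultaneously. The derivative in the
  -- parameter is a second mixed difference of products of `F₁` with increments; the discrete
  -- Leibniz rule leaves four terms, the first of which is handled by `abs_square_diff_le` for `F₁`.
  have key := abs_sub_le_of_unit_deriv (K := M * ((pxt + px * pt) * ps + px * pts + pt * pxs + pxts))
    (Ψ := fun σ => F (d + σ * (d' - d)) - F (c + σ * (c' - c)) - F (b + σ * (b' - b))
      + F (a + σ * (a' - a)))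
    (fun σ hσ => (((hasDerivWithinAt_comp_segment hs hF hd hd' hσ).sub
      (hasDerivWithinAt_comp_segment hs hF hc hc' hσ)).sub
      (hasDerivWithinAt_comp_segment hs hF hb hb' hσ)).add
      (hasDerivWithinAt_comp_segment hs hF ha ha' hσ)) ?_
  · simpa using key
  · intro σ hσ
    have Ha := segment_mem hs ha ha' hσ
    have Hb := segment_mem hs hb hb' hσ
    have Hc := segment_mem hs hc hc' hσ
    have Hd := segment_mem hs hd hd' hσ
    have Hca := abs_segment_sub_le hσ hca hca'
    have Hdb := abs_segment_sub_le hσ hdb hdb'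
    have Hba := abs_segment_sub_le hσ hba hba'
    have hL₁ : ∀ x ∈ s, ∀ y ∈ s, |F₁ x - F₁ y| ≤ M * |x - y| := fun x hx y hy =>
      abs_sub_le_of_deriv_le hs hF₁ hM₂ hx hy
    have Hxt : |d + σ * (d' - d) - (c + σ * (c' - c)) - (b + σ * (b' - b))
        + (a + σ * (a' - a))| ≤ pxt := by
      -- The mixed difference is affine in `σ`, so bounds at both ends suffice; the comparison
      -- segment is the degenerate one at `0`.
      have e : d + σ * (d' - d) - (c + σ * (c' - c)) - (b + σ * (b' - b)) + (a + σ * (a' - a)) =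
        (d - c - b + a) + σ * ((d' - c' - b' + a') - (d - c - b + a)) - (0 + σ * (0 - 0)) := by
        ring
      rw [e]
      exact abs_segment_sub_le hσ (by simpa using hxt) (by simpa using hxt')
    have HQ := abs_square_diff_le hs hM0 hF₁ hM₂ hL Ha Hb Hc Hd Hba Hca Hdb Hxt
    have e : F₁ (d + σ * (d' - d)) * (d' - d) - F₁ (c + σ * (c' - c)) * (c' - c)
        - F₁ (b + σ * (b' - b)) * (b' - b) + F₁ (a + σ * (a' - a)) * (a' - a) =
        (F₁ (d + σ * (d' - d)) - F₁ (c + σ * (c' - c)) - F₁ (b + σ * (b' - b))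
          + F₁ (a + σ * (a' - a))) * (d' - d)
        + (F₁ (c + σ * (c' - c)) - F₁ (a + σ * (a' - a))) * (d' - c' - d + c)
        + (F₁ (b + σ * (b' - b)) - F₁ (a + σ * (a' - a))) * (d' - b' - d + b)
        + F₁ (a + σ * (a' - a)) * ((d' - c' - b' + a') - (d - c - b + a)) := by ring
    rw [e]
    have t1 := abs_mul_le_of_le HQ hps
    have t2 := abs_mul_le_of_le ((hL₁ _ Hc _ Ha).trans (mul_le_mul_of_nonneg_left Hca hM0)) hts
    have t3 := abs_mul_le_of_le ((hL₁ _ Hb _ Ha).trans (mul_le_mul_of_nonneg_left Hba hM0)) hxs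
    have t4 := abs_mul_le_of_le (hM _ Ha) hxts
    refine (abs_add_le _ _).trans ?_
    refine (add_le_add ((abs_add_le _ _).trans (add_le_add ((abs_add_le _ _).trans
      (add_le_add t1 t2)) t3)) t4).trans (le_of_eq ?_)
    ring

end Composition

/-! ### Functions on the vertices of a cube -/

/-- Weights that control the mixed differences in the directions `x`, `t`, `s`. -/
structure Weights where
  x : ℝ
  t : ℝ
  s : ℝ
  xt : ℝ
  xs : ℝ
  ts : ℝ
  xts : ℝ

/-- The weights are nonnegative and submultiplicative over disjoint sets of directions. -/
structure Weights.Admissible (w : Weights) : Prop where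
  x_nonneg : 0 ≤ w.x
  t_nonneg : 0 ≤ w.t
  s_nonneg : 0 ≤ w.s
  x_t : w.x * w.t ≤ w.xt
  x_s : w.x * w.s ≤ w.xs
  t_s : w.t * w.s ≤ w.ts
  x_ts : w.x * w.ts ≤ w.xts
  t_xs : w.t * w.xs ≤ w.xts
  xt_s : w.xt * w.s ≤ w.xts

/-- The mixed differences of a function on the vertices of a cube are bounded by multiples of the
weights. The arguments refer to the directions `x`, `t`, `s`. -/
structure DiffBound {E : Type*} [NormedAddCommGroup E] (w : Weights) (c : ℝ)
    (f : Bool → Bool → Bool → E) : Prop where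
  x : ∀ t s, ‖f true t s - f false t s‖ ≤ c * w.x
  t : ∀ x s, ‖f x true s - f x false s‖ ≤ c * w.t
  s : ∀ x t, ‖f x t true - f x t false‖ ≤ c * w.s
  xt : ∀ s, ‖f true true s - f true false s - f false true s + f false false s‖ ≤ c * w.xt
  xs : ∀ t, ‖f true t true - f false t true - f true t false + f false t false‖ ≤ c * w.xs
  ts : ∀ x, ‖f x true true - f x false true - f x true false + f x false false‖ ≤ c * w.ts
  xts : ‖(f true true true - f true false true - f false true true + f false false true) -
    (f true true false - f true false false - f false true false + f false false false)‖
      ≤ c * w.xts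

/-- In addition to `DiffBound`, the values are bounded. -/
structure CubeBound {E : Type*} [NormedAddCommGroup E] (w : Weights) (c : ℝ)
    (f : Bool → Bool → Bool → E) : Prop extends DiffBound w c f where
  val : ∀ x t s, ‖f x t s‖ ≤ c

section Cube

variable {w : Weights}

theorem Weights.Admissible.xt_nonneg (hw : w.Admissible) : 0 ≤ w.xt :=
  (mul_nonneg hw.x_nonneg hw.t_nonneg).trans hw.x_t

theorem Weights.Admissible.xs_nonneg (hw : w.Admissible) : 0 ≤ w.xs :=
  (mul_nonneg hw.x_nonneg hw.s_nonneg).trans hw.x_s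

theorem Weights.Admissible.ts_nonneg (hw : w.Admissible) : 0 ≤ w.ts :=
  (mul_nonneg hw.t_nonneg hw.s_nonneg).trans hw.t_s

theorem Weights.Admissible.xts_nonneg (hw : w.Admissible) : 0 ≤ w.xts :=
  (mul_nonneg hw.x_nonneg hw.ts_nonneg).trans hw.x_ts

variable {E : Type*} [NormedAddCommGroup E]

theorem DiffBound.mono (hw : w.Admissible) {c c' : ℝ} (hc : c ≤ c') {f : Bool → Bool → Bool → E}
    (hf : DiffBound w c f) : DiffBound w c' f where
  x t s := (hf.x t s).trans (mul_le_mul_of_nonneg_right hc hw.x_nonneg)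
  t x s := (hf.t x s).trans (mul_le_mul_of_nonneg_right hc hw.t_nonneg)
  s x t := (hf.s x t).trans (mul_le_mul_of_nonneg_right hc hw.s_nonneg)
  xt s := (hf.xt s).trans (mul_le_mul_of_nonneg_right hc hw.xt_nonneg)
  xs t := (hf.xs t).trans (mul_le_mul_of_nonneg_right hc hw.xs_nonneg)
  ts x := (hf.ts x).trans (mul_le_mul_of_nonneg_right hc hw.ts_nonneg)
  xts := hf.xts.trans (mul_le_mul_of_nonneg_right hc hw.xts_nonneg)

theorem DiffBound.add {c c' : ℝ} {f g : Bool → Bool → Bool → E} (hf : DiffBound w c f)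
    (hg : DiffBound w c' g) : DiffBound w (c + c') (fun x t s => f x t s + g x t s) := by
  have key : ∀ {u v z : E} {p : ℝ}, ‖u‖ ≤ c * p → ‖v‖ ≤ c' * p → z = u + v →
      ‖z‖ ≤ (c + c') * p := by
    intro u v z p hu hv e
    rw [e, add_mul]
    exact (norm_add_le _ _).trans (add_le_add hu hv)
  exact
  { x := fun t s => key (hf.x t s) (hg.x t s) (by abel)
    t := fun x s => key (hf.t x s) (hg.t x s) (by abel)
    s := fun x t => key (hf.s x t) (hg.s x t) (by abel)
    xt := fun s => key (hf.xt s) (hg.xt s) (by abel)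
    xs := fun t => key (hf.xs t) (hg.xs t) (by abel)
    ts := fun x => key (hf.ts x) (hg.ts x) (by abel)
    xts := key hf.xts hg.xts (by abel) }

theorem CubeBound.add {c c' : ℝ} {f g : Bool → Bool → Bool → E} (hf : CubeBound w c f)
    (hg : CubeBound w c' g) : CubeBound w (c + c') (fun x t s => f x t s + g x t s) :=
  ⟨hf.toDiffBound.add hg.toDiffBound, fun x t s =>
    (norm_add_le _ _).trans (add_le_add (hf.val x t s) (hg.val x t s))⟩

/-- Discrete Leibniz rule. A third mixed difference of a product has eight terms, one for each way
of distributing the three directions over the factors, which is the constant `8`; admissibility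
bounds the weight of each term. -/
theorem CubeBound.mul {R : Type*} [NormedCommRing R] (hw : w.Admissible) {c c' : ℝ} (hc : 0 ≤ c)
    (hc' : 0 ≤ c') {f g : Bool → Bool → Bool → R} (hf : CubeBound w c f) (hg : CubeBound w c' g) :
    CubeBound w (8 * (c * c')) (fun x t s => f x t s * g x t s) := by
  have m : ∀ {u v : R} {p q r : ℝ}, ‖u‖ ≤ c * p → ‖v‖ ≤ c' * q → p * q ≤ r →
      ‖u * v‖ ≤ c * c' * r := by
    intro u v p q r hu hv hr
    refine (norm_mul_le _ _).trans ((mul_le_mul hu hv (norm_nonneg _)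
      ((norm_nonneg _).trans hu)).trans ?_)
    calc c * p * (c' * q) = c * c' * (p * q) := by ring
      _ ≤ _ := mul_le_mul_of_nonneg_left hr (mul_nonneg hc hc')
  have fv : ∀ x t s, ‖f x t s‖ ≤ c * 1 := fun x t s => by simpa using hf.val x t s
  have gv : ∀ x t s, ‖g x t s‖ ≤ c' * 1 := fun x t s => by simpa using hg.val x t s
  have two : ∀ {u v z : R} {K : ℝ}, 0 ≤ K → ‖u‖ ≤ c * c' * K → ‖v‖ ≤ c * c' * K → z = u + v →
      ‖z‖ ≤ 8 * (c * c') * K := by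
    intro u v z K hK hu hv e
    rw [e]
    refine (norm_add_le _ _).trans ?_
    nlinarith [mul_nonneg (mul_nonneg hc hc') hK]
  have four : ∀ {u v u' v' z : R} {K : ℝ}, 0 ≤ K → ‖u‖ ≤ c * c' * K → ‖v‖ ≤ c * c' * K →
      ‖u'‖ ≤ c * c' * K → ‖v'‖ ≤ c * c' * K → z = u + v + (u' + v') →
      ‖z‖ ≤ 8 * (c * c') * K := by
    intro u v u' v' z K hK hu hv hu' hv' e
    rw [e]
    refine (norm_add_le _ _).trans ?_
    have := norm_add_le u v
    have := norm_add_le u' v'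
    nlinarith [mul_nonneg (mul_nonneg hc hc') hK]
  refine ⟨⟨fun t s => ?_, fun x s => ?_, fun x t => ?_, fun s => ?_, fun t => ?_, fun x => ?_, ?_⟩,
    fun x t s => ?_⟩
  · exact two hw.x_nonneg (m (hf.x t s) (gv true t s) (by simp))
      (m (fv false t s) (hg.x t s) (by simp)) (by ring)
  · exact two hw.t_nonneg (m (hf.t x s) (gv x true s) (by simp))
      (m (fv x false s) (hg.t x s) (by simp)) (by ring)
  · exact two hw.s_nonneg (m (hf.s x t) (gv x t true) (by simp))
      (m (fv x t false) (hg.s x t) (by simp)) (by ring)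
  · exact four hw.xt_nonneg (m (hf.xt s) (gv true true s) (by simp))
      (m (hf.x false s) (hg.t true s) hw.x_t)
      (m (hf.t false s) (hg.x true s) (by linarith [hw.x_t]))
      (m (fv false false s) (hg.xt s) (by simp)) (by ring)
  · exact four hw.xs_nonneg (m (hf.xs t) (gv true t true) (by simp))
      (m (hf.x t false) (hg.s true t) hw.x_s)
      (m (hf.s false t) (hg.x t true) (by linarith [hw.x_s]))
      (m (fv false t false) (hg.xs t) (by simp)) (by ring)
  · exact four hw.ts_nonneg (m (hf.ts x) (gv x true true) (by simp))
      (m (hf.t x false) (hg.s x true) hw.t_s)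
      (m (hf.s x false) (hg.t x true) (by linarith [hw.t_s]))
      (m (fv x false false) (hg.ts x) (by simp)) (by ring)
  · have a1 := m hf.xts (gv true true true) (mul_one w.xts).le
    have a2 := m (fv false false false) hg.xts (one_mul w.xts).le
    have a3 := m (hf.xt false) (hg.s true true) hw.xt_s
    have a4 := m (hf.xs false) (hg.t true true) (r := w.xts) (by linarith [hw.t_xs])
    have a5 := m (hf.ts false) (hg.x true true) (r := w.xts) (by linarith [hw.x_ts])
    have a6 := m (hf.x false false) (hg.ts true) hw.x_ts
    have a7 := m (hf.t false false) (hg.xs true) hw.t_xs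
    have a8 := m (hf.s false false) (hg.xt true) (r := w.xts) (by linarith [hw.xt_s])
    have e : ∀ {u1 u2 u3 u4 u5 u6 u7 u8 z : R} {K : ℝ}, ‖u1‖ ≤ K → ‖u2‖ ≤ K → ‖u3‖ ≤ K →
        ‖u4‖ ≤ K → ‖u5‖ ≤ K → ‖u6‖ ≤ K → ‖u7‖ ≤ K → ‖u8‖ ≤ K →
        z = u1 + u2 + u3 + u4 + u5 + u6 + u7 + u8 → ‖z‖ ≤ 8 * K := by
      intro u1 u2 u3 u4 u5 u6 u7 u8 z K h1 h2 h3 h4 h5 h6 h7 h8 e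
      rw [e]
      linarith [norm_add_le (u1 + u2 + u3 + u4 + u5 + u6 + u7) u8,
        norm_add_le (u1 + u2 + u3 + u4 + u5 + u6) u7, norm_add_le (u1 + u2 + u3 + u4 + u5) u6,
        norm_add_le (u1 + u2 + u3 + u4) u5, norm_add_le (u1 + u2 + u3) u4,
        norm_add_le (u1 + u2) u3, norm_add_le u1 u2]
    rw [mul_assoc]
    exact e a1 a2 a3 a4 a5 a6 a7 a8 (by ring)
  · have := m (fv x t s) (gv x t s) (mul_one 1).le
    nlinarith [mul_nonneg hc hc']

/-- The class of functions on the cube is stable under composition with `C^{2,1}` functions. -/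
theorem DiffBound.comp (hw : w.Admissible) {c M : ℝ} (hc : 1 ≤ c) (hM : 0 ≤ M) {S : Set ℝ}
    (hS : Convex ℝ S) {F : ℝ → ℝ} (hF : C2LipOn S M F) {f : Bool → Bool → Bool → ℝ}
    (hf : DiffBound w c f) (hmem : ∀ x t s, f x t s ∈ S) :
    CubeBound w (5 * (M * c ^ 3)) (fun x t s => F (f x t s)) := by
  obtain ⟨F₁, F₂, h1, h2, b0, b1, b2, l2⟩ := hF
  have l1 : ∀ x ∈ S, ∀ y ∈ S, |F₁ x - F₁ y| ≤ M * |x - y| := fun x hx y hy =>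
    abs_sub_le_of_deriv_le hS h2 b2 hx hy
  have c2 : c ≤ c ^ 2 := by nlinarith
  have c3 : c ^ 2 ≤ c ^ 3 := by nlinarith
  have one : ∀ {u v p : ℝ}, 0 ≤ p → u ∈ S → v ∈ S → |u - v| ≤ c * p →
      |F u - F v| ≤ 5 * (M * c ^ 3) * p := by
    intro u v p hp hu hv h
    refine (abs_sub_le_of_deriv_le hS h1 b1 hu hv).trans ?_
    calc M * |u - v| ≤ M * (c * p) := mul_le_mul_of_nonneg_left h hM
      _ ≤ M * (c ^ 3 * p) := by gcongr; exact c2.trans c3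
      _ ≤ _ := by nlinarith [mul_nonneg (mul_nonneg hM (by positivity : 0 ≤ c ^ 3)) hp]
  have two : ∀ {a b d e p q r : ℝ}, 0 ≤ p → 0 ≤ q → q * p ≤ r → a ∈ S → b ∈ S → d ∈ S → e ∈ S →
      |b - a| ≤ c * p → |d - a| ≤ c * q → |e - b| ≤ c * q → |e - d - b + a| ≤ c * r →
      |F e - F d - F b + F a| ≤ 5 * (M * c ^ 3) * r := by
    intro a b d e p q r hp hq hpq ha hb hd he h1' h2' h3' h4'
    have hr : 0 ≤ r := (mul_nonneg hq hp).trans hpq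
    refine (abs_square_diff_le hS hM h1 b1 l1 ha hb hd he h1' h2' h3' h4').trans ?_
    calc M * (c * r) + M * (c * q) * (c * p) = M * (c * r) + M * (c ^ 2 * (q * p)) := by ring
      _ ≤ M * (c ^ 3 * r) + M * (c ^ 3 * r) := by gcongr; exact c2.trans c3
      _ ≤ _ := by nlinarith [mul_nonneg (mul_nonneg hM (by positivity : 0 ≤ c ^ 3)) hr]
  have hx := hw.x_nonneg
  have ht := hw.t_nonneg
  have hs := hw.s_nonneg
  refine ⟨⟨fun t s => ?_, fun x s => ?_, fun x t => ?_, fun s => ?_, fun t => ?_, fun x => ?_, ?_⟩,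
    fun x t s => ?_⟩
  · exact one hx (hmem _ _ _) (hmem _ _ _) (hf.x t s)
  · exact one ht (hmem _ _ _) (hmem _ _ _) (hf.t x s)
  · exact one hs (hmem _ _ _) (hmem _ _ _) (hf.s x t)
  · exact two ht hx hw.x_t (hmem _ _ _) (hmem _ _ _) (hmem _ _ _) (hmem _ _ _)
      (hf.t false s) (hf.x false s) (hf.x true s) (hf.xt s)
  · have := two hx hs (by linarith [hw.x_s]) (hmem _ _ _) (hmem _ _ _) (hmem _ _ _) (hmem _ _ _)
      (hf.x t false) (hf.s false t) (hf.s true t) (hf.xs t)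
    exact this
  · have := two ht hs (by linarith [hw.t_s]) (hmem _ _ _) (hmem _ _ _) (hmem _ _ _) (hmem _ _ _)
      (hf.t x false) (hf.s x false) (hf.s x true) (hf.ts x)
    exact this
  · have := abs_cube_diff_le hS hM h1 b1 h2 b2 l2 (hmem false false false) (hmem false true false)
      (hmem true false false) (hmem true true false) (hmem false false true) (hmem false true true)
      (hmem true false true) (hmem true true true) (hf.x false false) (hf.x true false)
      (hf.x false true) (hf.x true true) (hf.t false false) (hf.t false true) (hf.s true true)
      (hf.xt false) (hf.xt true) (hf.ts true) (hf.xs true) hf.xts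
    refine this.trans ?_
    have hxts := hw.xts_nonneg
    have hxt := hw.xt_nonneg
    have hxs := hw.xs_nonneg
    have hts := hw.ts_nonneg
    have q1 : w.x * w.t * w.s ≤ w.xts :=
      (mul_le_mul_of_nonneg_right hw.x_t hs).trans hw.xt_s
    -- As in Faà di Bruno's formula, the five terms belong to the five partitions of the set of
    -- directions; this is the origin of the factor `5` and of the power `c ^ 3`.
    calc M * ((c * w.xt + c * w.x * (c * w.t)) * (c * w.s) + c * w.x * (c * w.ts) +
          c * w.t * (c * w.xs) + c * w.xts)
        = M * (c ^ 2 * (w.xt * w.s) + c ^ 3 * (w.x * w.t * w.s) + c ^ 2 * (w.x * w.ts)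
          + c ^ 2 * (w.t * w.xs) + c * w.xts) := by ring
      _ ≤ M * (c ^ 3 * w.xts + c ^ 3 * w.xts + c ^ 3 * w.xts + c ^ 3 * w.xts + c ^ 3 * w.xts) := by
        gcongr
        · exact hw.xt_s
        · exact hw.x_ts
        · exact hw.t_xs
        · exact c2.trans c3
      _ = _ := by ring
  · refine (b0 _ (hmem x t s)).trans ?_
    have : 1 ≤ c ^ 3 := one_le_pow₀ hc
    nlinarith [mul_le_mul_of_nonneg_left this hM]

end Cube

end RelaxNLS

end

noncomputable section

namespace RelaxNLS

open Set

/-! ### Regularity of the cutoff -/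

/-- Gluing at `p`: where the values and the derivatives agree, the two one-sided derivatives combine
to a derivative. -/
theorem hasDerivAt_ite_le {p : ℝ} {f₁ f₂ f₁' f₂' : ℝ → ℝ} (h₁ : ∀ x, HasDerivAt f₁ (f₁' x) x)
    (h₂ : ∀ x, HasDerivAt f₂ (f₂' x) x) (e : f₁ p = f₂ p) (e' : f₁' p = f₂' p) (x : ℝ) :
    HasDerivAt (fun x => if x ≤ p then f₁ x else f₂ x) (if x ≤ p then f₁' x else f₂' x) x := by
  rcases lt_trichotomy x p with hx | rfl | hx
  · rw [if_pos hx.le]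
    refine (h₁ x).congr_of_eventuallyEq ?_
    filter_upwards [Iio_mem_nhds hx] with y hy
    rw [if_pos (le_of_lt hy)]
  · rw [if_pos le_rfl, ← hasDerivWithinAt_univ, ← Iic_union_Ici (a := x)]
    refine HasDerivWithinAt.union ?_ ?_
    · refine (h₁ x).hasDerivWithinAt.congr (fun y hy => if_pos hy) (if_pos le_rfl)
    · have := (h₂ x).hasDerivWithinAt (s := Ici x)
      rw [← e'] at this
      refine this.congr (fun y hy => ?_) (by rw [if_pos le_rfl, e])
      rcases eq_or_lt_of_le (show x ≤ y from hy) with rfl | hlt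
      · rw [if_pos le_rfl, e]
      · rw [if_neg (not_le.2 hlt)]
  · rw [if_neg (not_le.2 hx)]
    refine (h₂ x).congr_of_eventuallyEq ?_
    filter_upwards [Ioi_mem_nhds hx] with y hy
    rw [if_neg (not_le.2 hy)]

/-- The deviation of the normalized cutoff from the identity. -/
def cutoffDefect (s : ℝ) : ℝ :=
  if s ≤ 0 then 0 else
    if s ≤ 1 then 15 * s ^ 4 - 39 * s ^ 5 + 34 * s ^ 6 - 10 * s ^ 7 else 1 - s

/-- The derivative of `cutoffDefect`. -/
def cutoffDefect' (s : ℝ) : ℝ :=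
  if s ≤ 0 then 0 else
    if s ≤ 1 then 60 * s ^ 3 - 195 * s ^ 4 + 204 * s ^ 5 - 70 * s ^ 6 else -1

/-- The second derivative of `cutoffDefect`. -/
def cutoffDefect'' (s : ℝ) : ℝ :=
  if s ≤ 0 then 0 else
    if s ≤ 1 then 180 * s ^ 2 - 780 * s ^ 3 + 1020 * s ^ 4 - 420 * s ^ 5 else 0

theorem hasDerivAt_cutoffDefect (s : ℝ) : HasDerivAt cutoffDefect (cutoffDefect' s) s := by
  refine hasDerivAt_ite_le (p := 0) (f₁ := fun _ => 0) (f₁' := fun _ => 0)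
    (fun x => hasDerivAt_const x _)
    (hasDerivAt_ite_le (p := 1) (f₁ := fun s => 15 * s ^ 4 - 39 * s ^ 5 + 34 * s ^ 6 - 10 * s ^ 7)
      (f₁' := fun s => 60 * s ^ 3 - 195 * s ^ 4 + 204 * s ^ 5 - 70 * s ^ 6)
      (f₂ := fun s => 1 - s) (f₂' := fun _ => -1) (fun x => ?_) (fun x => ?_)
      ?_ ?_) ?_ ?_ s
  · have := ((((hasDerivAt_pow 4 x).const_mul 15).sub ((hasDerivAt_pow 5 x).const_mul 39)).add
      ((hasDerivAt_pow 6 x).const_mul 34)).sub ((hasDerivAt_pow 7 x).const_mul 10)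
    refine this.congr_deriv ?_
    norm_num; ring
  · simpa using (hasDerivAt_id x).const_sub 1
  all_goals norm_num

theorem hasDerivAt_cutoffDefect' (s : ℝ) : HasDerivAt cutoffDefect' (cutoffDefect'' s) s := by
  refine hasDerivAt_ite_le (p := 0) (f₁ := fun _ => 0) (f₁' := fun _ => 0)
    (fun x => hasDerivAt_const x _)
    (hasDerivAt_ite_le (p := 1) (f₁ := fun s => 60 * s ^ 3 - 195 * s ^ 4 + 204 * s ^ 5 - 70 * s ^ 6)
      (f₁' := fun s => 180 * s ^ 2 - 780 * s ^ 3 + 1020 * s ^ 4 - 420 * s ^ 5)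
      (f₂ := fun s => -1) (f₂' := fun _ => 0) (fun x => ?_)
      (fun x => hasDerivAt_const x _) ?_ ?_) ?_ ?_ s
  · have := ((((hasDerivAt_pow 3 x).const_mul 60).sub ((hasDerivAt_pow 4 x).const_mul 195)).add
      ((hasDerivAt_pow 5 x).const_mul 204)).sub ((hasDerivAt_pow 6 x).const_mul 70)
    refine this.congr_deriv ?_
    norm_num; ring
  all_goals norm_num

theorem abs_pow_le_one {s : ℝ} (h0 : 0 ≤ s) (h1 : s ≤ 1) (n : ℕ) : 0 ≤ s ^ n ∧ s ^ n ≤ 1 :=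
  ⟨pow_nonneg h0 n, pow_le_one₀ h0 h1⟩

/-- The constant, like those of the next two bounds, merely exceeds the sum of the absolute values
of the coefficients on the unit interval. -/
theorem abs_cutoffDefect'_le (s : ℝ) : |cutoffDefect' s| ≤ 600 := by
  unfold cutoffDefect'
  split_ifs with h0 h1
  · norm_num
  · push Not at h0
    obtain ⟨a3, b3⟩ := abs_pow_le_one h0.le h1 3
    obtain ⟨a4, b4⟩ := abs_pow_le_one h0.le h1 4
    obtain ⟨a5, b5⟩ := abs_pow_le_one h0.le h1 5
    obtain ⟨a6, b6⟩ := abs_pow_le_one h0.le h1 6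
    rw [abs_le]; constructor <;> linarith
  · norm_num

theorem abs_cutoffDefect''_le (s : ℝ) : |cutoffDefect'' s| ≤ 3000 := by
  unfold cutoffDefect''
  split_ifs with h0 h1
  · norm_num
  · push Not at h0
    obtain ⟨a3, b3⟩ := abs_pow_le_one h0.le h1 3
    obtain ⟨a4, b4⟩ := abs_pow_le_one h0.le h1 4
    obtain ⟨a5, b5⟩ := abs_pow_le_one h0.le h1 5
    obtain ⟨a6, b6⟩ := abs_pow_le_one h0.le h1 2
    rw [abs_le]; constructor <;> linarith
  · norm_num

/-- The polynomial piece vanishes at `0` and at `1`, so the second derivative is a polynomial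
composed with the projection onto `[0,1]`, which does not increase distances. -/
theorem abs_cutoffDefect''_sub_le (s s' : ℝ) :
    |cutoffDefect'' s - cutoffDefect'' s'| ≤ 10000 * |s - s'| := by
  let P : ℝ → ℝ := fun s => 180 * s ^ 2 - 780 * s ^ 3 + 1020 * s ^ 4 - 420 * s ^ 5
  have hP : ∀ s, cutoffDefect'' s = P (max 0 (min s 1)) := by
    intro s
    simp only [cutoffDefect'', P]
    split_ifs with h0 h1
    · rw [min_eq_left (by linarith), max_eq_left h0]; norm_num
    · rw [min_eq_left h1, max_eq_right (by linarith)]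
    · rw [min_eq_right (by linarith)]; norm_num
  have hmem : ∀ s : ℝ, max 0 (min s 1) ∈ Icc (0 : ℝ) 1 := fun s =>
    ⟨le_max_left _ _, max_le zero_le_one (min_le_right _ _)⟩
  have hd : ∀ x ∈ Icc (0 : ℝ) 1, HasDerivWithinAt P
      (360 * x - 2340 * x ^ 2 + 4080 * x ^ 3 - 2100 * x ^ 4) (Icc 0 1) x := by
    intro x _
    have := ((((hasDerivAt_pow 2 x).const_mul 180).sub ((hasDerivAt_pow 3 x).const_mul 780)).add
      ((hasDerivAt_pow 4 x).const_mul 1020)).sub ((hasDerivAt_pow 5 x).const_mul 420)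
    refine (this.congr_deriv ?_).hasDerivWithinAt
    norm_num; ring
  have hb : ∀ x ∈ Icc (0 : ℝ) 1,
      |360 * x - 2340 * x ^ 2 + 4080 * x ^ 3 - 2100 * x ^ 4| ≤ 10000 := by
    intro x hx
    obtain ⟨a3, b3⟩ := abs_pow_le_one hx.1 hx.2 3
    obtain ⟨a4, b4⟩ := abs_pow_le_one hx.1 hx.2 4
    obtain ⟨a6, b6⟩ := abs_pow_le_one hx.1 hx.2 2
    rw [abs_le]; constructor <;> linarith [hx.1, hx.2]
  rw [hP, hP]
  refine (abs_sub_le_of_deriv_le (convex_Icc _ _) hd hb (hmem s) (hmem s')).trans ?_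
  refine mul_le_mul_of_nonneg_left ?_ (by norm_num)
  refine (abs_max_sub_max_le_max 0 (min s 1) 0 (min s' 1)).trans ?_
  rw [sub_self, abs_zero]
  refine max_le (abs_nonneg _) ((abs_min_sub_min_le_max s 1 s' 1).trans ?_)
  simp

theorem cutoffNonneg_eq {δ : ℝ} (hδ : 0 < δ) (x : ℝ) :
    cutoffNonneg δ x = x + δ * cutoffDefect (δ⁻¹ * x - 1) := by
  have e : δ * (δ⁻¹ * x) = x := by field_simp
  unfold cutoffNonneg cutoffDefect
  have i0 : δ⁻¹ * x - 1 ≤ 0 ↔ x ≤ δ := by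
    rw [sub_nonpos, inv_mul_le_iff₀ hδ, mul_one]
  have i1 : δ⁻¹ * x - 1 ≤ 1 ↔ x ≤ 2 * δ := by
    rw [sub_le_iff_le_add, inv_mul_le_iff₀ hδ]
    constructor <;> intro h <;> linarith
  simp only [i0, i1]
  split_ifs with h0 h1
  · simp
  · simp only [cutoffPoly, profile, Polynomial.eval_mul, Polynomial.eval_C, Polynomial.eval_comp,
      Polynomial.eval_add, Polynomial.eval_sub, Polynomial.eval_pow, Polynomial.eval_X,
      Polynomial.eval_one, Polynomial.eval_ofNat]
    linear_combination e
  · linear_combination e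

/-- Each defect vanishes on the half-line belonging to the other one. The formula therefore holds
without a case distinction at `0`, and no gluing of the odd extension is needed. -/
theorem cutoff_eq {δ : ℝ} (hδ : 0 < δ) (x : ℝ) :
    cutoff δ x = x + δ * cutoffDefect (δ⁻¹ * x - 1) - δ * cutoffDefect (δ⁻¹ * (-x) - 1) := by
  have neg : ∀ y, y ≤ 0 → cutoffDefect (δ⁻¹ * y - 1) = 0 := by
    intro y hy
    have : δ⁻¹ * y ≤ 0 := mul_nonpos_of_nonneg_of_nonpos (by positivity) hy
    rw [cutoffDefect, if_pos (by linarith)]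
  unfold cutoff
  split_ifs with h
  · rw [cutoffNonneg_eq hδ, neg (-x) (by linarith)]; ring
  · rw [cutoffNonneg_eq hδ, neg x (by linarith)]; ring

theorem cutoff_of_abs_le {δ x : ℝ} (hx : |x| ≤ δ) : cutoff δ x = x := by
  rw [abs_le] at hx
  unfold cutoff cutoffNonneg
  split_ifs <;> linarith

theorem abs_cutoff_le {δ : ℝ} (hδ : 0 < δ) (x : ℝ) : |cutoff δ x| ≤ 100 * δ := by
  have key : ∀ x, 0 ≤ x → |cutoffNonneg δ x| ≤ 100 * δ := by
    intro x hx
    by_cases h1 : x ≤ 2 * δ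
    · have hq : |cutoffDefect (δ⁻¹ * x - 1)| ≤ 98 := by
        set s := δ⁻¹ * x - 1 with hs
        have hs1 : s ≤ 1 := by
          rw [hs, sub_le_iff_le_add, inv_mul_le_iff₀ hδ]; linarith
        unfold cutoffDefect
        split_ifs with h0
        · norm_num
        · push Not at h0
          obtain ⟨a4, b4⟩ := abs_pow_le_one h0.le hs1 4
          obtain ⟨a5, b5⟩ := abs_pow_le_one h0.le hs1 5
          obtain ⟨a6, b6⟩ := abs_pow_le_one h0.le hs1 6
          obtain ⟨a7, b7⟩ := abs_pow_le_one h0.le hs1 7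
          rw [abs_le]; constructor <;> linarith
      rw [cutoffNonneg_eq hδ]
      rw [abs_le] at *
      constructor <;> nlinarith
    · unfold cutoffNonneg
      rw [if_neg (by linarith), if_neg h1, abs_of_pos (by linarith)]
      linarith
  unfold cutoff
  split_ifs with h
  · exact key x h
  · rw [abs_neg]; exact key (-x) (by linarith)

theorem exists_c2LipOn_cutoff {δ : ℝ} (hδ : 0 < δ) :
    ∃ M, 0 ≤ M ∧ C2LipOn univ M (cutoff δ) := by
  -- The summands dominate, in this order, the function, its derivative, its second derivative and
  -- the Lipschitz constant of the latter; each derivative scales with a further factor `δ⁻¹`.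
  set M := 100 * δ + 1201 + 6000 * δ⁻¹ + 20000 * (δ⁻¹ * δ⁻¹) with hM
  have hi : 0 < δ⁻¹ := inv_pos.2 hδ
  have hii : 0 < δ⁻¹ * δ⁻¹ := mul_pos hi hi
  have e : δ * δ⁻¹ = 1 := mul_inv_cancel₀ hδ.ne'
  refine ⟨M, by positivity, fun x => 1 + cutoffDefect' (δ⁻¹ * x - 1)
    + cutoffDefect' (δ⁻¹ * (-x) - 1), fun x => δ⁻¹ * cutoffDefect'' (δ⁻¹ * x - 1)
    - δ⁻¹ * cutoffDefect'' (δ⁻¹ * (-x) - 1), fun x _ => ?_, fun x _ => ?_, fun x _ => ?_,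
    fun x _ => ?_, fun x _ => ?_, fun x _ y _ => ?_⟩
  · have l1 : HasDerivAt (fun x : ℝ => δ⁻¹ * x - 1) δ⁻¹ x := by
      simpa using ((hasDerivAt_id x).const_mul δ⁻¹).sub_const 1
    have l2 : HasDerivAt (fun x : ℝ => δ⁻¹ * (-x) - 1) (-δ⁻¹) x := by
      simpa using ((hasDerivAt_id x).neg.const_mul δ⁻¹).sub_const 1
    have := ((hasDerivAt_id x).add (((hasDerivAt_cutoffDefect _).comp x l1).const_mul δ)).sub
      (((hasDerivAt_cutoffDefect _).comp x l2).const_mul δ)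
    rw [show cutoff δ = fun x => x + δ * cutoffDefect (δ⁻¹ * x - 1)
      - δ * cutoffDefect (δ⁻¹ * (-x) - 1) from funext (cutoff_eq hδ)]
    refine (this.congr_deriv ?_).hasDerivWithinAt
    linear_combination (cutoffDefect' (δ⁻¹ * x - 1) + cutoffDefect' (δ⁻¹ * (-x) - 1)) * e
  · have l1 : HasDerivAt (fun x : ℝ => δ⁻¹ * x - 1) δ⁻¹ x := by
      simpa using ((hasDerivAt_id x).const_mul δ⁻¹).sub_const 1
    have l2 : HasDerivAt (fun x : ℝ => δ⁻¹ * (-x) - 1) (-δ⁻¹) x := by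
      simpa using ((hasDerivAt_id x).neg.const_mul δ⁻¹).sub_const 1
    have := (((hasDerivAt_cutoffDefect' _).comp x l1).const_add 1).add
      ((hasDerivAt_cutoffDefect' _).comp x l2)
    refine (this.congr_deriv ?_).hasDerivWithinAt
    ring
  · refine (abs_cutoff_le hδ x).trans ?_
    rw [hM]; linarith
  · have := abs_cutoffDefect'_le (δ⁻¹ * x - 1)
    have := abs_cutoffDefect'_le (δ⁻¹ * (-x) - 1)
    rw [abs_le] at *
    constructor <;> linarith
  · have := abs_cutoffDefect''_le (δ⁻¹ * x - 1)
    have := abs_cutoffDefect''_le (δ⁻¹ * (-x) - 1)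
    rw [abs_le] at *
    constructor <;> nlinarith
  · have h1 := abs_cutoffDefect''_sub_le (δ⁻¹ * x - 1) (δ⁻¹ * y - 1)
    have h2 := abs_cutoffDefect''_sub_le (δ⁻¹ * (-x) - 1) (δ⁻¹ * (-y) - 1)
    rw [show δ⁻¹ * x - 1 - (δ⁻¹ * y - 1) = δ⁻¹ * (x - y) by ring, abs_mul, abs_of_pos hi] at h1
    rw [show δ⁻¹ * (-x) - 1 - (δ⁻¹ * (-y) - 1) = -(δ⁻¹ * (x - y)) by ring, abs_neg, abs_mul,
      abs_of_pos hi] at h2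
    have e2 : δ⁻¹ * cutoffDefect'' (δ⁻¹ * x - 1) - δ⁻¹ * cutoffDefect'' (δ⁻¹ * (-x) - 1) -
        (δ⁻¹ * cutoffDefect'' (δ⁻¹ * y - 1) - δ⁻¹ * cutoffDefect'' (δ⁻¹ * (-y) - 1)) =
        δ⁻¹ * ((cutoffDefect'' (δ⁻¹ * x - 1) - cutoffDefect'' (δ⁻¹ * y - 1)) -
          (cutoffDefect'' (δ⁻¹ * (-x) - 1) - cutoffDefect'' (δ⁻¹ * (-y) - 1))) := by ring
    rw [e2, abs_mul, abs_of_pos hi]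
    calc _ ≤ δ⁻¹ * (10000 * (δ⁻¹ * |x - y|) + 10000 * (δ⁻¹ * |x - y|)) := by
          gcongr
          exact (abs_sub _ _).trans (add_le_add h1 h2)
      _ = 20000 * (δ⁻¹ * δ⁻¹) * |x - y| := by ring
      _ ≤ _ := by
        gcongr
        rw [hM]; linarith [hδ]

/-- The Lipschitz constant of the second derivative comes from the third, bounded on the compact
interval. Derivatives are taken within the half-line, the only place where `g` is smooth. -/
theorem exists_c2LipOn_of_contDiffOn {g : ℝ → ℝ} (hg : ContDiffOn ℝ 3 g (Ici 0)) (R : ℝ) :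
    ∃ M, 0 ≤ M ∧ C2LipOn (Icc 0 R) M g := by
  have hu : UniqueDiffOn ℝ (Ici (0 : ℝ)) := uniqueDiffOn_Ici 0
  have hsub : Icc 0 R ⊆ Ici (0 : ℝ) := Icc_subset_Ici_self
  have c1 : ContDiffOn ℝ 2 (derivWithin g (Ici 0)) (Ici 0) := hg.derivWithin hu (by norm_num)
  have c2 : ContDiffOn ℝ 1 (derivWithin (derivWithin g (Ici 0)) (Ici 0)) (Ici 0) :=
    c1.derivWithin hu (by norm_num)
  have c3 : ContDiffOn ℝ 0 (derivWithin (derivWithin (derivWithin g (Ici 0)) (Ici 0)) (Ici 0))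
    (Ici 0) := c2.derivWithin hu (by norm_num)
  have bd : ∀ f : ℝ → ℝ, ContinuousOn f (Ici 0) → ∃ M, ∀ x ∈ Icc 0 R, |f x| ≤ M := fun f hf =>
    isCompact_Icc.exists_bound_of_continuousOn (hf.mono hsub)
  obtain ⟨M0, h0⟩ := bd _ hg.continuousOn
  obtain ⟨M1, h1⟩ := bd _ c1.continuousOn
  obtain ⟨M2, h2⟩ := bd _ c2.continuousOn
  obtain ⟨M3, h3⟩ := bd _ c3.continuousOn
  have dv : ∀ f : ℝ → ℝ, DifferentiableOn ℝ f (Ici 0) → ∀ x ∈ Icc 0 R,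
      HasDerivWithinAt f (derivWithin f (Ici 0) x) (Icc 0 R) x := fun f hf x hx =>
    ((hf x (hsub hx)).hasDerivWithinAt).mono hsub
  have d0 := dv _ (hg.differentiableOn (by norm_num))
  have d1 := dv _ (c1.differentiableOn (by norm_num))
  have d2 := dv _ (c2.differentiableOn (by norm_num))
  have l0 := le_abs_self M0
  have l1 := le_abs_self M1
  have l2 := le_abs_self M2
  have l3 := le_abs_self M3
  have n0 := abs_nonneg M0
  have n1 := abs_nonneg M1
  have n2 := abs_nonneg M2
  have n3 := abs_nonneg M3
  refine ⟨|M0| + |M1| + |M2| + |M3|, by positivity, _, _, d0, d1,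
    fun x hx => (h0 x hx).trans (by linarith), fun x hx => (h1 x hx).trans (by linarith),
    fun x hx => (h2 x hx).trans (by linarith), fun x hx y hy => ?_⟩
  exact abs_sub_le_of_deriv_le (convex_Icc 0 R) d2
    (fun x hx => (h3 x hx).trans (by linarith)) hx hy

end RelaxNLS

end

noncomputable section

namespace RelaxNLS

open Set

/-! ### One-dimensional Taylor estimates -/

section Taylor

variable {E : Type*} [NormedAddCommGroup E] [NormedSpace ℝ E]

/-- Applied repeatedly to a Taylor remainder and its derivatives with respect to the step length,
this replaces integral remainder formulas. -/
theorem norm_le_of_deriv_le {K K' : ℝ → E} {r C : ℝ} (hC : 0 ≤ C)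
    (hd : ∀ s ∈ Icc 0 r, HasDerivWithinAt K (K' s) (Icc 0 r) s)
    (hK : ∀ s ∈ Icc 0 r, ‖K' s‖ ≤ C) (h0 : K 0 = 0) : ∀ s ∈ Icc 0 r, ‖K s‖ ≤ C * r := by
  intro s hs
  have hr : (0 : ℝ) ∈ Icc 0 r := ⟨le_rfl, hs.1.trans hs.2⟩
  have := (convex_Icc 0 r).norm_image_sub_le_of_norm_hasDerivWithin_le hd hK hr hs
  rw [h0, sub_zero, sub_zero, Real.norm_of_nonneg hs.1] at this
  exact this.trans (mul_le_mul_of_nonneg_left hs.2 hC)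

theorem hasDerivWithinAt_comp_add {I : Set ℝ} {v v' : ℝ → E}
    (hv : ∀ y ∈ I, HasDerivWithinAt v (v' y) I y) {I' : Set ℝ} {x : ℝ}
    (hx : ∀ s ∈ I', x + s ∈ I) :
    ∀ s ∈ I', HasDerivWithinAt (fun s => v (x + s)) (v' (x + s)) I' s := by
  intro s hs
  have h1 : HasDerivWithinAt (fun s : ℝ => x + s) 1 I' s :=
    ((hasDerivAt_id s).const_add x).hasDerivWithinAt
  exact (HasDerivWithinAt.scomp s (hv _ (hx s hs)) h1 hx).congr_deriv (by simp)

theorem hasDerivWithinAt_comp_sub {I : Set ℝ} {v v' : ℝ → E}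
    (hv : ∀ y ∈ I, HasDerivWithinAt v (v' y) I y) {I' : Set ℝ} {x : ℝ}
    (hx : ∀ s ∈ I', x - s ∈ I) :
    ∀ s ∈ I', HasDerivWithinAt (fun s => v (x - s)) (-v' (x - s)) I' s := by
  intro s hs
  have h1 : HasDerivWithinAt (fun s : ℝ => x - s) (-1) I' s :=
    ((hasDerivAt_id s).const_sub x).hasDerivWithinAt
  exact (HasDerivWithinAt.scomp s (hv _ (hx s hs)) h1 hx).congr_deriv (by simp)

/-- The error of the trapezoidal rule. -/
theorem norm_trapezoid_le {I : Set ℝ} {v v₁ v₂ v₃ : ℝ → E} {t τ M : ℝ} (hτ : 0 ≤ τ)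
    (hM : 0 ≤ M) (hI : ∀ s ∈ Icc 0 τ, t + s ∈ I)
    (h0 : ∀ y ∈ I, HasDerivWithinAt v (v₁ y) I y) (h1 : ∀ y ∈ I, HasDerivWithinAt v₁ (v₂ y) I y)
    (h2 : ∀ y ∈ I, HasDerivWithinAt v₂ (v₃ y) I y) (h3 : ∀ y ∈ I, ‖v₃ y‖ ≤ M) :
    ‖v (t + τ) - v t - (τ / 2) • (v₁ (t + τ) + v₁ t)‖ ≤ M * τ ^ 3 := by
  have lin : ∀ s : ℝ, HasDerivWithinAt (fun s : ℝ => s / 2) (1 / 2) (Icc 0 τ) s := fun s =>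
    ((hasDerivAt_id s).div_const 2).hasDerivWithinAt
  have d0 := hasDerivWithinAt_comp_add h0 hI
  have d1 := hasDerivWithinAt_comp_add h1 hI
  have d2 := hasDerivWithinAt_comp_add h2 hI
  have b2 : ∀ s ∈ Icc 0 τ, ‖-((s / 2) • v₃ (t + s))‖ ≤ τ * M := by
    intro s hs
    rw [norm_neg, norm_smul, Real.norm_of_nonneg (by linarith [hs.1])]
    exact mul_le_mul (by linarith [hs.1, hs.2]) (h3 _ (hI s hs)) (norm_nonneg _) hτ
  -- `K` is the derivative of the trapezoidal error in the step length; in its own derivative all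
  -- `v₂` terms cancel and only `-(s / 2) • v₃` remains.
  have b1 := norm_le_of_deriv_le (K := fun s => v₁ (t + s) - (1 / 2 : ℝ) • (v₁ (t + s) + v₁ t)
      - (s / 2) • v₂ (t + s)) (by positivity) (fun s hs => ?_) b2 (by simp; module)
  · have b0 := norm_le_of_deriv_le (K := fun s => v (t + s) - v t
      - (s / 2) • (v₁ (t + s) + v₁ t)) (by positivity) (fun s hs => ?_) b1 (by simp) τ
      ⟨hτ, le_rfl⟩
    · refine b0.trans (le_of_eq (by ring))
    · refine (((d0 s hs).sub_const (v t)).sub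
        ((lin s).smul ((d1 s hs).add_const (v₁ t)))).congr_deriv ?_
      module
  · refine (((d1 s hs).sub (((d1 s hs).add_const (v₁ t)).const_smul (1 / 2 : ℝ))).sub
      ((lin s).smul (d2 s hs))).congr_deriv ?_
    module

/-- The second central difference. -/
theorem norm_secondDiff_le {I : Set ℝ} {v v₁ v₂ : ℝ → E} {t r M : ℝ} (hr : 0 ≤ r)
    (hM : 0 ≤ M) (hI : ∀ s ∈ Icc 0 r, t + s ∈ I) (hI' : ∀ s ∈ Icc 0 r, t - s ∈ I)
    (h0 : ∀ y ∈ I, HasDerivWithinAt v (v₁ y) I y) (h1 : ∀ y ∈ I, HasDerivWithinAt v₁ (v₂ y) I y)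
    (h2 : ∀ y ∈ I, ‖v₂ y‖ ≤ M) :
    ‖v (t + r) - (2 : ℝ) • v t + v (t - r)‖ ≤ 2 * M * r ^ 2 := by
  have d0 := hasDerivWithinAt_comp_add h0 hI
  have d1 := hasDerivWithinAt_comp_add h1 hI
  have d0' := hasDerivWithinAt_comp_sub h0 hI'
  have d1' := hasDerivWithinAt_comp_sub h1 hI'
  have b2 : ∀ s ∈ Icc 0 r, ‖v₂ (t + s) + v₂ (t - s)‖ ≤ 2 * M := by
    intro s hs
    refine (norm_add_le _ _).trans ?_
    linarith [h2 _ (hI s hs), h2 _ (hI' s hs)]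
  have b1 := norm_le_of_deriv_le (K := fun s => v₁ (t + s) - v₁ (t - s)) (by positivity)
    (fun s hs => ((d1 s hs).sub (d1' s hs)).congr_deriv (by module)) b2 (by simp)
  have b0 := norm_le_of_deriv_le (K := fun s => v (t + s) - (2 : ℝ) • v t + v (t - s))
    (by positivity) (fun s hs => (((d0 s hs).sub_const _).add (d0' s hs)).congr_deriv
      (by module)) b1 (by simp; module) r ⟨hr, le_rfl⟩
  exact b0.trans (le_of_eq (by ring))

/-- The error of the second central difference quotient. -/
theorem norm_secondDiff_sub_le {I : Set ℝ} {v v₁ v₂ v₃ v₄ : ℝ → E} {x h M : ℝ} (hh : 0 ≤ h)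
    (hM : 0 ≤ M) (hI : ∀ s ∈ Icc 0 h, x + s ∈ I) (hI' : ∀ s ∈ Icc 0 h, x - s ∈ I)
    (h0 : ∀ y ∈ I, HasDerivWithinAt v (v₁ y) I y) (h1 : ∀ y ∈ I, HasDerivWithinAt v₁ (v₂ y) I y)
    (h2 : ∀ y ∈ I, HasDerivWithinAt v₂ (v₃ y) I y) (h3 : ∀ y ∈ I, HasDerivWithinAt v₃ (v₄ y) I y)
    (h4 : ∀ y ∈ I, ‖v₄ y‖ ≤ M) :
    ‖v (x + h) - (2 : ℝ) • v x + v (x - h) - h ^ 2 • v₂ x‖ ≤ 2 * M * h ^ 4 := by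
  have d0 := hasDerivWithinAt_comp_add h0 hI
  have d1 := hasDerivWithinAt_comp_add h1 hI
  have d2 := hasDerivWithinAt_comp_add h2 hI
  have d3 := hasDerivWithinAt_comp_add h3 hI
  have d0' := hasDerivWithinAt_comp_sub h0 hI'
  have d1' := hasDerivWithinAt_comp_sub h1 hI'
  have d2' := hasDerivWithinAt_comp_sub h2 hI'
  have d3' := hasDerivWithinAt_comp_sub h3 hI'
  have b4 : ∀ s ∈ Icc 0 h, ‖v₄ (x + s) + v₄ (x - s)‖ ≤ 2 * M := by
    intro s hs
    refine (norm_add_le _ _).trans ?_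
    linarith [h4 _ (hI s hs), h4 _ (hI' s hs)]
  have b3 := norm_le_of_deriv_le (K := fun s => v₃ (x + s) - v₃ (x - s)) (by positivity)
    (fun s hs => ((d3 s hs).sub (d3' s hs)).congr_deriv (by module)) b4 (by simp)
  have b2 := norm_le_of_deriv_le (K := fun s => v₂ (x + s) - (2 : ℝ) • v₂ x + v₂ (x - s))
    (by positivity) (fun s hs => (((d2 s hs).sub_const _).add (d2' s hs)).congr_deriv
      (by module)) b3 (by simp; module)
  have b1 := norm_le_of_deriv_le (K := fun s => v₁ (x + s) - v₁ (x - s) - (2 * s) • v₂ x)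
    (by positivity) (fun s hs => (((d1 s hs).sub (d1' s hs)).sub
      ((((hasDerivAt_id s).const_mul 2).hasDerivWithinAt).smul_const (v₂ x))).congr_deriv
      (by module)) b2 (by simp)
  have b0 := norm_le_of_deriv_le (K := fun s => v (x + s) - (2 : ℝ) • v x + v (x - s)
      - s ^ 2 • v₂ x) (by positivity) (fun s hs => ((((d0 s hs).sub_const _).add (d0' s hs)).sub
      (((hasDerivAt_pow 2 s).hasDerivWithinAt).smul_const (v₂ x))).congr_deriv
      (by norm_num; module)) b1 (by simp; module) h ⟨hh, le_rfl⟩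
  exact b0.trans (le_of_eq (by ring))

end Taylor

/-! ### Smooth functions on a rectangle -/

section Rectangle

variable {E : Type*} [NormedAddCommGroup E] [NormedSpace ℝ E]

/-- `F` is of class `C^n` on the closed rectangle `[0,T] × [a,b]`. -/
def SmoothOn (T a b : ℝ) (n : ℕ) (F : ℝ → ℝ → E) : Prop :=
  ContDiffOn ℝ n (fun p : ℝ × ℝ => F p.1 p.2) (Icc 0 T ×ˢ Icc a b)

/-- The partial derivative in `t`. -/
def dt (T : ℝ) (F : ℝ → ℝ → E) (t x : ℝ) : E := derivWithin (fun s => F s x) (Icc 0 T) t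

/-- The partial derivative in `x`. -/
def dx (a b : ℝ) (F : ℝ → ℝ → E) (t x : ℝ) : E := derivWithin (fun y => F t y) (Icc a b) x

/-- Bounds for a function on `[0,T] × [a,b]` and its differences. -/
structure RegularOn (T a b M : ℝ) (F : ℝ → ℝ → E) : Prop where
  nonneg : 0 ≤ M
  bound : ∀ t ∈ Icc 0 T, ∀ x ∈ Icc a b, ‖F t x‖ ≤ M
  lip_x : ∀ t ∈ Icc 0 T, ∀ x ∈ Icc a b, ∀ y ∈ Icc a b, ‖F t x - F t y‖ ≤ M * |x - y|
  lip_t : ∀ t ∈ Icc 0 T, ∀ s ∈ Icc 0 T, ∀ x ∈ Icc a b, ‖F t x - F s x‖ ≤ M * |t - s|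
  mixed : ∀ t ∈ Icc 0 T, ∀ s ∈ Icc 0 T, ∀ x ∈ Icc a b, ∀ y ∈ Icc a b,
    ‖F t x - F s x - (F t y - F s y)‖ ≤ M * |t - s| * |x - y|
  second_t : ∀ t r, 0 ≤ r → t + r ∈ Icc 0 T → t - r ∈ Icc 0 T → ∀ x ∈ Icc a b,
    ‖F (t + r) x - (2 : ℝ) • F t x + F (t - r) x‖ ≤ M * r ^ 2

variable {T a b : ℝ} {n : ℕ} {F : ℝ → ℝ → E}

theorem SmoothOn.of_le {m : ℕ} (hF : SmoothOn T a b n F) (h : m ≤ n) : SmoothOn T a b m F :=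
  ContDiffOn.of_le hF (by exact_mod_cast h)

theorem SmoothOn.hasDerivWithinAt_fderivWithin_t (hF : SmoothOn T a b (n + 1) F)
    {t x : ℝ} (ht : t ∈ Icc 0 T) (hx : x ∈ Icc a b) :
    HasDerivWithinAt (fun s => F s x) (fderivWithin ℝ (fun p : ℝ × ℝ => F p.1 p.2)
      (Icc 0 T ×ˢ Icc a b) (t, x) (1, 0)) (Icc 0 T) t := by
  have h1 := ((hF.differentiableOn (by simp)) (t, x) ⟨ht, hx⟩).hasFDerivWithinAt
  have h2 : HasDerivWithinAt (fun s : ℝ => (s, x)) ((1 : ℝ), (0 : ℝ)) (Icc 0 T) t :=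
    ((hasDerivAt_id t).prodMk (hasDerivAt_const t x)).hasDerivWithinAt
  exact h1.comp_hasDerivWithinAt t h2 fun s hs => mk_mem_prod hs hx

theorem SmoothOn.hasDerivWithinAt_fderivWithin_x (hF : SmoothOn T a b (n + 1) F)
    {t x : ℝ} (ht : t ∈ Icc 0 T) (hx : x ∈ Icc a b) :
    HasDerivWithinAt (fun y => F t y) (fderivWithin ℝ (fun p : ℝ × ℝ => F p.1 p.2)
      (Icc 0 T ×ˢ Icc a b) (t, x) (0, 1)) (Icc a b) x := by
  have h1 := ((hF.differentiableOn (by simp)) (t, x) ⟨ht, hx⟩).hasFDerivWithinAt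
  have h2 : HasDerivWithinAt (fun y : ℝ => (t, y)) ((0 : ℝ), (1 : ℝ)) (Icc a b) x :=
    ((hasDerivAt_const x t).prodMk (hasDerivAt_id x)).hasDerivWithinAt
  exact h1.comp_hasDerivWithinAt x h2 fun s hs => mk_mem_prod ht hs

theorem uniqueDiffOn_rectangle (hT : 0 < T) (hab : a < b) :
    UniqueDiffOn ℝ (Icc 0 T ×ˢ Icc a b) := (uniqueDiffOn_Icc hT).prod (uniqueDiffOn_Icc hab)

/-- The partial derivative is the Fréchet derivative within the rectangle applied to a fixed
direction; unique differentiability of the interval identifies it with `derivWithin`. -/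
theorem SmoothOn.partial_t (hT : 0 < T) (hab : a < b) (hF : SmoothOn T a b (n + 1) F) :
    SmoothOn T a b n (dt T F) := by
  have h := (ContDiffOn.fderivWithin hF (uniqueDiffOn_rectangle hT hab)
    (m := n) (by norm_cast)).clm_apply (contDiffOn_const (c := ((1 : ℝ), (0 : ℝ))))
  refine h.congr fun p hp => ?_
  exact (hF.hasDerivWithinAt_fderivWithin_t hp.1 hp.2).derivWithin (uniqueDiffOn_Icc hT _ hp.1)

theorem SmoothOn.partial_x (hT : 0 < T) (hab : a < b) (hF : SmoothOn T a b (n + 1) F) :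
    SmoothOn T a b n (dx a b F) := by
  have h := (ContDiffOn.fderivWithin hF (uniqueDiffOn_rectangle hT hab)
    (m := n) (by norm_cast)).clm_apply (contDiffOn_const (c := ((0 : ℝ), (1 : ℝ))))
  refine h.congr fun p hp => ?_
  exact (hF.hasDerivWithinAt_fderivWithin_x hp.1 hp.2).derivWithin (uniqueDiffOn_Icc hab _ hp.2)

theorem SmoothOn.hasDerivWithinAt_t (hF : SmoothOn T a b (n + 1) F) {x : ℝ} (hx : x ∈ Icc a b) :
    ∀ t ∈ Icc 0 T, HasDerivWithinAt (fun s => F s x) (dt T F t x) (Icc 0 T) t :=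
  fun _ ht => (hF.hasDerivWithinAt_fderivWithin_t ht hx).differentiableWithinAt.hasDerivWithinAt

theorem SmoothOn.hasDerivWithinAt_x (hF : SmoothOn T a b (n + 1) F) {t : ℝ} (ht : t ∈ Icc 0 T) :
    ∀ x ∈ Icc a b, HasDerivWithinAt (fun y => F t y) (dx a b F t x) (Icc a b) x :=
  fun _ hx => (hF.hasDerivWithinAt_fderivWithin_x ht hx).differentiableWithinAt.hasDerivWithinAt

theorem SmoothOn.exists_bound (hF : SmoothOn T a b n F) :
    ∃ M, 0 ≤ M ∧ ∀ t ∈ Icc 0 T, ∀ x ∈ Icc a b, ‖F t x‖ ≤ M := by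
  obtain ⟨M, hM⟩ := (isCompact_Icc.prod isCompact_Icc).exists_bound_of_continuousOn
    (ContDiffOn.continuousOn hF)
  exact ⟨|M|, abs_nonneg _, fun t ht x hx => (hM (t, x) ⟨ht, hx⟩).trans (le_abs_self M)⟩

theorem RegularOn.mono {M M' : ℝ} (hF : RegularOn T a b M F) (h : M ≤ M') :
    RegularOn T a b M' F where
  nonneg := hF.nonneg.trans h
  bound t ht x hx := (hF.bound t ht x hx).trans h
  lip_x t ht x hx y hy := (hF.lip_x t ht x hx y hy).trans (by gcongr)
  lip_t t ht s hs x hx := (hF.lip_t t ht s hs x hx).trans (by gcongr)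
  mixed t ht s hs x hx y hy := (hF.mixed t ht s hs x hx y hy).trans (by gcongr)
  second_t t r hr h1 h2 x hx := (hF.second_t t r hr h1 h2 x hx).trans (by gcongr)

theorem SmoothOn.exists_regularOn (hT : 0 < T) (hab : a < b) (hF : SmoothOn T a b 2 F) :
    ∃ M, RegularOn T a b M F := by
  have hFt := hF.partial_t hT hab
  have hFx := hF.partial_x hT hab
  obtain ⟨M0, n0, h0⟩ := hF.exists_bound
  obtain ⟨M1, n1, h1⟩ := hFx.exists_bound
  obtain ⟨M2, n2, h2⟩ := hFt.exists_bound
  obtain ⟨M3, n3, h3⟩ := (hFx.partial_t hT hab).exists_bound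
  obtain ⟨M4, n4, h4⟩ := (hFt.partial_t hT hab).exists_bound
  -- One summand for each of `F`, `F_x`, `F_t`, `F_xt`, `F_tt`; the last is doubled as in
  -- `norm_secondDiff_le`.
  have key : RegularOn T a b (M0 + M1 + M2 + M3 + 2 * M4) F :=
    { nonneg := by positivity
      bound := fun t ht x hx => (h0 t ht x hx).trans (by linarith)
      lip_x := fun t ht x hx y hy => by
        have := (convex_Icc a b).norm_image_sub_le_of_norm_hasDerivWithin_le
          (hF.hasDerivWithinAt_x ht) (h1 t ht) hy hx
        rw [Real.norm_eq_abs] at this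
        refine this.trans ?_
        gcongr; linarith
      lip_t := fun t ht s hs x hx => by
        have := (convex_Icc 0 T).norm_image_sub_le_of_norm_hasDerivWithin_le
          (hF.hasDerivWithinAt_t hx) (fun t ht => h2 t ht x hx) hs ht
        rw [Real.norm_eq_abs] at this
        refine this.trans ?_
        gcongr; linarith
      -- The mean value inequality is used twice: in `t` for `F_x`, then in `x` for the time
      -- increment of `F`.
      mixed := fun t ht s hs x hx y hy => by
        have bz : ∀ z ∈ Icc a b, ‖dx a b F t z - dx a b F s z‖ ≤
            M3 * |t - s| := by
          intro z hz
          have := (convex_Icc 0 T).norm_image_sub_le_of_norm_hasDerivWithin_le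
            (hFx.hasDerivWithinAt_t hz) (fun t ht => h3 t ht z hz) hs ht
          rwa [Real.norm_eq_abs] at this
        have := (convex_Icc a b).norm_image_sub_le_of_norm_hasDerivWithin_le
          (fun z hz => (hF.hasDerivWithinAt_x ht z hz).sub (hF.hasDerivWithinAt_x hs z hz)) bz hy hx
        rw [Real.norm_eq_abs] at this
        refine this.trans ?_
        gcongr; linarith
      second_t := fun t r hr ht1 ht2 x hx => by
        refine (norm_secondDiff_le (I := Icc 0 T) hr n4 (fun s hs => ⟨by linarith [ht2.1, hs.1, hs.2],
          by linarith [ht1.2, hs.2]⟩) (fun s hs => ⟨by linarith [ht2.1, hs.2],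
          by linarith [ht1.2, hs.1, hs.2]⟩) (hF.hasDerivWithinAt_t hx)
          (hFt.hasDerivWithinAt_t hx) (fun t ht => h4 t ht x hx)).trans ?_
        gcongr; linarith }
  exact ⟨_, key⟩

end Rectangle

end RelaxNLS

end

noncomputable section

namespace RelaxNLS

open Set

/-! ### Consistency of the difference formulas -/

section Consistency

variable {E : Type*} [NormedAddCommGroup E] [NormedSpace ℝ E]

/-- The local error of the trapezoidal rule in time. -/
def trapezoidError (T : ℝ) (F : ℝ → ℝ → E) (τ t x : ℝ) : E :=
  F (t + τ) x - F t x - (τ / 2) • (dt T F (t + τ) x + dt T F t x)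

/-- The second central difference in time. -/
def secondDiff (F : ℝ → ℝ → E) (r t x : ℝ) : E :=
  F (t + r) x - (2 : ℝ) • F t x + F (t - r) x

/-- The error of the second central difference in space. -/
def laplacianError (a b : ℝ) (F : ℝ → ℝ → E) (h t x : ℝ) : E :=
  F t (x + h) - (2 : ℝ) • F t x + F t (x - h) - h ^ 2 • dx a b (dx a b F) t x

variable {T a b : ℝ} {F : ℝ → ℝ → E}

theorem hasDerivWithinAt_shift {n : ℕ} (hF : SmoothOn T a b (n + 1) F) {x σ : ℝ}
    (hx : x ∈ Icc a b) {I : Set ℝ} (hI : ∀ s ∈ I, σ + s ∈ Icc 0 T) :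
    ∀ s ∈ I, HasDerivWithinAt (fun s => F (σ + s) x) (dt T F (σ + s) x) I s :=
  hasDerivWithinAt_comp_add (hF.hasDerivWithinAt_t hx) hI

/-- The error functional is linear, so the trapezoidal estimate is applied to the space increment of
`F` and to its time shift. The factor `|x - y|` is what the `H¹` seminorm requires, and the extra
`τ` of the shifted estimate survives the later division by `τ`. Three derivatives serve the
quadrature and two the mixed increments. -/
theorem SmoothOn.exists_trapezoidError_le (hT : 0 < T) (hab : a < b) (hF : SmoothOn T a b 5 F) :
    ∃ M, 0 ≤ M ∧ ∀ τ t, 0 ≤ τ → 0 ≤ t → t + τ ≤ T → ∀ x ∈ Icc a b, ∀ y ∈ Icc a b,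
      ‖trapezoidError T F τ t x - trapezoidError T F τ t y‖ ≤ M * τ ^ 3 * |x - y| ∧
      (τ + t + τ ≤ T →
        ‖trapezoidError T F τ (τ + t) x - trapezoidError T F τ (τ + t) y -
          (trapezoidError T F τ t x - trapezoidError T F τ t y)‖ ≤ M * τ ^ 4 * |x - y|) := by
  have hF1 := hF.partial_t hT hab
  have hF2 := hF1.partial_t hT hab
  obtain ⟨M, hM⟩ := (hF2.partial_t hT hab).exists_regularOn hT hab
  have hM0 := hM.nonneg
  refine ⟨M, hM0, fun τ t hτ ht htT x hx y hy => ⟨?_, fun hT' => ?_⟩⟩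
  · have := norm_trapezoid_le (I := Icc 0 T) (M := M * |x - y|) (t := t) hτ (by positivity)
      (fun s hs => ⟨by linarith [hs.1], by linarith [hs.2]⟩)
      (fun s hs => (hF.hasDerivWithinAt_t hx s hs).sub (hF.hasDerivWithinAt_t hy s hs))
      (fun s hs => (hF1.hasDerivWithinAt_t hx s hs).sub (hF1.hasDerivWithinAt_t hy s hs))
      (fun s hs => (hF2.hasDerivWithinAt_t hx s hs).sub (hF2.hasDerivWithinAt_t hy s hs))
      (fun s hs => hM.lip_x s hs x hx y hy)
    refine le_trans (le_of_eq (congrArg norm ?_)) (this.trans (le_of_eq (by ring)))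
    simp only [trapezoidError, Pi.sub_apply]
    module
  -- On the shortened interval both `s` and `τ + s` stay in `[0,T]`, so the shifted increment is a
  -- differentiable function of `s` alone.
  · have hI : ∀ s ∈ Icc 0 (T - τ), τ + s ∈ Icc 0 T := fun s hs =>
      ⟨by linarith [hs.1], by linarith [hs.2]⟩
    have hI' : Icc 0 (T - τ) ⊆ Icc 0 T := Icc_subset_Icc_right (by linarith)
    have D : ∀ {n : ℕ} {G : ℝ → ℝ → E}, SmoothOn T a b (n + 1) G → ∀ s ∈ Icc 0 (T - τ),
        HasDerivWithinAt (fun s => G (τ + s) x - G (τ + s) y - (G s x - G s y))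
          (dt T G (τ + s) x - dt T G (τ + s) y - (dt T G s x - dt T G s y)) (Icc 0 (T - τ)) s :=
      fun hG s hs => ((hasDerivWithinAt_shift hG hx hI s hs).sub
        (hasDerivWithinAt_shift hG hy hI s hs)).sub
        (((hG.hasDerivWithinAt_t hx s (hI' hs)).mono hI').sub
          ((hG.hasDerivWithinAt_t hy s (hI' hs)).mono hI'))
    have := norm_trapezoid_le (I := Icc 0 (T - τ)) (M := M * τ * |x - y|) (t := t) hτ (by positivity)
      (fun s hs => ⟨by linarith [hs.1], by linarith [hs.2]⟩) (D hF) (D hF1) (D hF2)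
      (fun s hs => by
        have := hM.mixed _ (hI s hs) _ (hI' hs) x hx y hy
        rw [show τ + s - s = τ by ring, abs_of_nonneg hτ] at this
        refine le_trans (le_of_eq (congrArg norm ?_)) this
        abel)
    refine le_trans (le_of_eq (congrArg norm ?_)) (this.trans (le_of_eq (by ring)))
    simp only [trapezoidError, add_assoc]
    module

/-- Again by linearity, the increments in `x` and under a time shift `σ` are treated as new
functions whose second derivative is small. -/
theorem SmoothOn.exists_secondDiff_le (hT : 0 < T) (hab : a < b) (hF : SmoothOn T a b 4 F) :
    ∃ M, 0 ≤ M ∧ ∀ r t, 0 ≤ r → 0 ≤ t - r → t + r ≤ T → ∀ x ∈ Icc a b, ∀ y ∈ Icc a b,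
      ‖secondDiff F r t x‖ ≤ M * r ^ 2 ∧
      ‖secondDiff F r t x - secondDiff F r t y‖ ≤ M * r ^ 2 * |x - y| ∧
      ∀ σ, 0 ≤ σ → σ + t + r ≤ T →
        ‖secondDiff F r (σ + t) x - secondDiff F r t x‖ ≤ M * r ^ 2 * σ ∧
        ‖secondDiff F r (σ + t) x - secondDiff F r (σ + t) y -
          (secondDiff F r t x - secondDiff F r t y)‖ ≤ M * r ^ 2 * σ * |x - y| := by
  have hF1 := hF.partial_t hT hab
  obtain ⟨M, hM⟩ := (hF1.partial_t hT hab).exists_regularOn hT hab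
  have hM0 := hM.nonneg
  refine ⟨2 * M, by positivity, fun r t hr ht htT x hx y hy => ⟨?_, ?_, fun σ hσ hT' => ?_⟩⟩
  · have := norm_secondDiff_le (I := Icc 0 T) (t := t) hr hM0
      (fun s hs => ⟨by linarith [hs.1], by linarith [hs.2]⟩)
      (fun s hs => ⟨by linarith [hs.2], by linarith [hs.1]⟩)
      (hF.hasDerivWithinAt_t hx) (hF1.hasDerivWithinAt_t hx) (fun s hs => hM.bound s hs x hx)
    exact this
  · have := norm_secondDiff_le (I := Icc 0 T) (M := M * |x - y|) (t := t) hr (by positivity)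
      (fun s hs => ⟨by linarith [hs.1], by linarith [hs.2]⟩)
      (fun s hs => ⟨by linarith [hs.2], by linarith [hs.1]⟩)
      (fun s hs => (hF.hasDerivWithinAt_t hx s hs).sub (hF.hasDerivWithinAt_t hy s hs))
      (fun s hs => (hF1.hasDerivWithinAt_t hx s hs).sub (hF1.hasDerivWithinAt_t hy s hs))
      (fun s hs => hM.lip_x s hs x hx y hy)
    refine le_trans (le_of_eq (congrArg norm ?_)) (this.trans (le_of_eq (by ring)))
    simp only [secondDiff, Pi.sub_apply]
    module
  · have hI : ∀ s ∈ Icc 0 (T - σ), σ + s ∈ Icc 0 T := fun s hs =>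
      ⟨by linarith [hs.1], by linarith [hs.2]⟩
    have hI' : Icc 0 (T - σ) ⊆ Icc 0 T := Icc_subset_Icc_right (by linarith)
    have D : ∀ {n : ℕ} {G : ℝ → ℝ → E}, SmoothOn T a b (n + 1) G → ∀ z ∈ Icc a b,
        ∀ s ∈ Icc 0 (T - σ), HasDerivWithinAt (fun s => G (σ + s) z - G s z)
          (dt T G (σ + s) z - dt T G s z) (Icc 0 (T - σ)) s :=
      fun hG z hz s hs => (hasDerivWithinAt_shift hG hz hI s hs).sub
        ((hG.hasDerivWithinAt_t hz s (hI' hs)).mono hI')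
    constructor
    · have := norm_secondDiff_le (I := Icc 0 (T - σ)) (M := M * σ) (t := t) hr (by positivity)
        (fun s hs => ⟨by linarith [hs.1], by linarith [hs.2]⟩)
        (fun s hs => ⟨by linarith [hs.2], by linarith [hs.1]⟩)
        (D hF x hx) (D hF1 x hx)
        (fun s hs => by
          have := hM.lip_t _ (hI s hs) _ (hI' hs) x hx
          rwa [show σ + s - s = σ by ring, abs_of_nonneg hσ] at this)
      refine le_trans (le_of_eq (congrArg norm ?_)) (this.trans (le_of_eq (by ring)))
      simp only [secondDiff, add_assoc, add_sub_assoc]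
      module
    · have := norm_secondDiff_le (I := Icc 0 (T - σ)) (M := M * σ * |x - y|) (t := t) hr (by positivity)
        (fun s hs => ⟨by linarith [hs.1], by linarith [hs.2]⟩)
        (fun s hs => ⟨by linarith [hs.2], by linarith [hs.1]⟩)
        (fun s hs => (D hF x hx s hs).sub (D hF y hy s hs))
        (fun s hs => (D hF1 x hx s hs).sub (D hF1 y hy s hs))
        (fun s hs => by
          have := hM.mixed _ (hI s hs) _ (hI' hs) x hx y hy
          rwa [show σ + s - s = σ by ring, abs_of_nonneg hσ] at this)
      refine le_trans (le_of_eq (congrArg norm ?_)) (this.trans (le_of_eq (by ring)))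
      simp only [secondDiff, add_assoc, add_sub_assoc, Pi.sub_apply]
      module

/-- The elliptic correction will be differenced twice in time, so the truncation error is estimated
together with its first and second time differences. Four space derivatives and two more account for
the class `C⁶`. -/
theorem SmoothOn.exists_laplacianError_le (hT : 0 < T) (hab : a < b) (hF : SmoothOn T a b 6 F) :
    ∃ M, 0 ≤ M ∧ ∀ h x, 0 ≤ h → a ≤ x - h → x + h ≤ b →
      (∀ t ∈ Icc 0 T, ‖laplacianError a b F h t x‖ ≤ M * h ^ 4) ∧
      (∀ t ∈ Icc 0 T, ∀ s ∈ Icc 0 T,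
        ‖laplacianError a b F h t x - laplacianError a b F h s x‖ ≤ M * h ^ 4 * |t - s|) ∧
      ∀ t r, 0 ≤ r → t + r ∈ Icc 0 T → t - r ∈ Icc 0 T →
        ‖laplacianError a b F h (t + r) x - (2 : ℝ) • laplacianError a b F h t x +
          laplacianError a b F h (t - r) x‖ ≤ M * h ^ 4 * r ^ 2 := by
  have hF1 := hF.partial_x hT hab
  have hF2 := hF1.partial_x hT hab
  have hF3 := hF2.partial_x hT hab
  obtain ⟨M, hM⟩ := (hF3.partial_x hT hab).exists_regularOn hT hab
  have hM0 := hM.nonneg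
  refine ⟨2 * M, by positivity, fun h x hh hx1 hx2 => ⟨fun t ht => ?_, fun t ht s hs => ?_,
    fun t r hr ht1 ht2 => ?_⟩⟩
  · have := norm_secondDiff_sub_le (I := Icc a b) (x := x) hh hM0
      (fun s hs => ⟨by linarith [hs.1], by linarith [hs.2]⟩)
      (fun s hs => ⟨by linarith [hs.2], by linarith [hs.1]⟩)
      (hF.hasDerivWithinAt_x ht) (hF1.hasDerivWithinAt_x ht) (hF2.hasDerivWithinAt_x ht)
      (hF3.hasDerivWithinAt_x ht) (fun y hy => hM.bound t ht y hy)
    exact this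
  · have := norm_secondDiff_sub_le (I := Icc a b) (x := x) (M := M * |t - s|) hh (by positivity)
      (fun s hs => ⟨by linarith [hs.1], by linarith [hs.2]⟩)
      (fun s hs => ⟨by linarith [hs.2], by linarith [hs.1]⟩)
      (fun y hy => (hF.hasDerivWithinAt_x ht y hy).sub (hF.hasDerivWithinAt_x hs y hy))
      (fun y hy => (hF1.hasDerivWithinAt_x ht y hy).sub (hF1.hasDerivWithinAt_x hs y hy))
      (fun y hy => (hF2.hasDerivWithinAt_x ht y hy).sub (hF2.hasDerivWithinAt_x hs y hy))
      (fun y hy => (hF3.hasDerivWithinAt_x ht y hy).sub (hF3.hasDerivWithinAt_x hs y hy))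
      (fun y hy => hM.lip_t t ht s hs y hy)
    refine le_trans (le_of_eq (congrArg norm ?_)) (this.trans (le_of_eq (by ring)))
    simp only [laplacianError, Pi.sub_apply]
    module
  · have ht : t ∈ Icc 0 T := ⟨by linarith [ht2.1], by linarith [ht1.2]⟩
    have D : ∀ {n : ℕ} {G : ℝ → ℝ → E}, SmoothOn T a b (n + 1) G → ∀ y ∈ Icc a b,
        HasDerivWithinAt (fun y => G (t + r) y - (2 : ℝ) • G t y + G (t - r) y)
          (dx a b G (t + r) y - (2 : ℝ) • dx a b G t y + dx a b G (t - r) y) (Icc a b) y :=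
      fun hG y hy => ((hG.hasDerivWithinAt_x ht1 y hy).sub
        ((hG.hasDerivWithinAt_x ht y hy).const_smul (2 : ℝ))).add (hG.hasDerivWithinAt_x ht2 y hy)
    have := norm_secondDiff_sub_le (I := Icc a b) (x := x) (M := M * r ^ 2) hh (by positivity)
      (fun s hs => ⟨by linarith [hs.1], by linarith [hs.2]⟩)
      (fun s hs => ⟨by linarith [hs.2], by linarith [hs.1]⟩)
      (D hF) (D hF1) (D hF2) (D hF3) (fun y hy => hM.second_t t r hr ht1 ht2 y hy)
    refine le_trans (le_of_eq (congrArg norm ?_)) (this.trans (le_of_eq (by ring)))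
    simp only [laplacianError]
    module

end Consistency

end RelaxNLS

end

noncomputable section

namespace RelaxNLS

open Set

/-! ### The data of the problem and its residuals -/

/-- The hypotheses on the solution and on the cutoff parameter. -/
structure Setting (T a b : ℝ) (g : ℝ → ℝ) (f : ℝ → ℝ → ℂ) (u₀ : ℝ → ℂ) (u : ℝ → ℝ → ℂ)
    (δ : ℝ) : Prop where
  hT : 0 < T
  hab : a < b
  hg : ContDiffOn ℝ 5 g (Ici 0)
  hu : ContDiffOn ℝ 6 (fun p : ℝ × ℝ => u p.1 p.2) (Icc 0 T ×ˢ Icc a b)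
  hsol : IsSolution T a b g f u₀ u
  hδ : 0 < δ
  hδu : ∀ t ∈ Icc 0 T, ∀ x ∈ Icc a b, ‖u t x‖ ≤ δ
  hδg : ∀ t ∈ Icc 0 T, ∀ x ∈ Icc a b, |g (‖u t x‖ ^ 2)| ≤ δ

/-- The potential `g(|u|²)`. -/
def potential (g : ℝ → ℝ) (u : ℝ → ℝ → ℂ) (t x : ℝ) : ℝ := g (‖u t x‖ ^ 2)

variable {T a b : ℝ} {g : ℝ → ℝ} {f : ℝ → ℝ → ℂ} {u₀ : ℝ → ℂ} {u : ℝ → ℝ → ℂ} {δ : ℝ}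

theorem Setting.smooth_u (H : Setting T a b g f u₀ u δ) : SmoothOn T a b 6 u := H.hu

theorem Setting.smooth_potential (H : Setting T a b g f u₀ u δ) :
    SmoothOn T a b 5 (potential g u) := by
  have h1 : ContDiffOn ℝ 5 (fun p : ℝ × ℝ => ‖u p.1 p.2‖ ^ 2) (Icc 0 T ×ˢ Icc a b) :=
    ContDiffOn.norm_sq ℝ (H.hu.of_le (by norm_num))
  exact ContDiffOn.comp (t := Ici 0) H.hg h1 fun p _ => by simp

theorem Setting.smooth_potential_mul (H : Setting T a b g f u₀ u δ) :
    SmoothOn T a b 5 (fun t x => (potential g u t x : ℂ) * u t x) := by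
  have h1 : ContDiffOn ℝ 5 (fun p : ℝ × ℝ => (potential g u p.1 p.2 : ℂ))
      (Icc 0 T ×ˢ Icc a b) :=
    Complex.ofRealCLM.contDiff.comp_contDiffOn H.smooth_potential
  exact h1.mul (H.hu.of_le (by norm_num))

theorem dx_dx_eq_iteratedDerivWithin {E : Type*} [NormedAddCommGroup E] [NormedSpace ℝ E]
    (a b : ℝ) (F : ℝ → ℝ → E) (t x : ℝ) :
    dx a b (dx a b F) t x = iteratedDerivWithin 2 (fun y => F t y) (Icc a b) x := by
  rw [iteratedDerivWithin_succ, iteratedDerivWithin_one]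
  rfl

theorem Setting.pde (H : Setting T a b g f u₀ u δ) {t x : ℝ} (ht : t ∈ Icc 0 T)
    (hx : x ∈ Icc a b) :
    dt T u t x = Complex.I * dx a b (dx a b u) t x
      + Complex.I * (potential g u t x : ℂ) * u t x + f t x := by
  rw [dx_dx_eq_iteratedDerivWithin]
  exact H.hsol.pde t ht x hx

/-- No regularity of `f` is assumed; the equation expresses it through continuous quantities. -/
theorem Setting.exists_source_bound (H : Setting T a b g f u₀ u δ) :
    ∃ M, 0 ≤ M ∧ ∀ t ∈ Icc 0 T, ∀ x ∈ Icc a b, ‖f t x‖ ≤ M := by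
  obtain ⟨M1, n1, h1⟩ := (H.smooth_u.partial_t H.hT H.hab).exists_bound
  obtain ⟨M2, n2, h2⟩ := ((H.smooth_u.partial_x H.hT H.hab).partial_x H.hT H.hab).exists_bound
  obtain ⟨M3, n3, h3⟩ := H.smooth_potential_mul.exists_bound
  refine ⟨M1 + M2 + M3, by positivity, fun t ht x hx => ?_⟩
  have e : f t x = dt T u t x - Complex.I * dx a b (dx a b u) t x
      - Complex.I * ((potential g u t x : ℂ) * u t x) := by rw [H.pde ht hx]; ring
  rw [e]
  refine (norm_sub_le _ _).trans (add_le_add ((norm_sub_le _ _).trans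
    (add_le_add (h1 t ht x hx) ?_)) ?_)
  · rw [norm_mul, Complex.norm_I, one_mul]; exact h2 t ht x hx
  · rw [norm_mul, Complex.norm_I, one_mul]; exact h3 t ht x hx

/-! ### The consistency error of averaging the nonlinear term -/

/-- Weights for functions of `x` and `t` alone. -/
def spaceTimeWeights (p q : ℝ) : Weights := ⟨p, q, 0, p * q, 0, 0, 0⟩

theorem spaceTimeWeights_admissible {p q : ℝ} (hp : 0 ≤ p) (hq : 0 ≤ q) :
    (spaceTimeWeights p q).Admissible := by
  constructor <;> simp [spaceTimeWeights, hp, hq]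

/-- A function of two directions is regarded as constant in the third, so that `CubeBound.mul` also
serves as Leibniz rule for second mixed differences. -/
theorem cubeBound_of_forall_bool {E : Type*} [NormedAddCommGroup E] {p q c : ℝ}
    {F : Bool → Bool → E} (h0 : ∀ x t, ‖F x t‖ ≤ c) (hx : ∀ t, ‖F true t - F false t‖ ≤ c * p)
    (ht : ∀ x, ‖F x true - F x false‖ ≤ c * q)
    (hxt : ‖F true true - F false true - (F true false - F false false)‖ ≤ c * q * p) :
    CubeBound (spaceTimeWeights p q) c (fun x t _ => F x t) where
  val x t _ := h0 x t
  x t _ := hx t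
  t x _ := ht x
  s x t := by simp [spaceTimeWeights]
  xt _ := by
    refine le_trans (le_of_eq (congrArg norm ?_)) (hxt.trans (le_of_eq ?_))
    · abel
    · simp only [spaceTimeWeights]; ring
  xs t := by simp [spaceTimeWeights]
  ts x := by simp [spaceTimeWeights]
  xts := by simp [spaceTimeWeights]

/-- The error of averaging the nonlinear term over a time step. -/
def averagingError (g : ℝ → ℝ) (u : ℝ → ℝ → ℂ) (τ t x : ℝ) : ℂ :=
  (potential g u (t + τ / 2) x : ℂ) * ((u (t + τ) x + u t x) / 2)
    - ((potential g u (t + τ) x : ℂ) * u (t + τ) x + (potential g u t x : ℂ) * u t x) / 2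

/-- Both averages are compared with the product at the midpoint, which cancels; second differences
with step `τ / 2` remain and provide the order `τ²`. -/
theorem averagingError_eq (g : ℝ → ℝ) (u : ℝ → ℝ → ℂ) (τ t x : ℝ) :
    averagingError g u τ t x = 1 / 2 * ((potential g u (t + τ / 2) x : ℂ) *
        secondDiff u (τ / 2) (t + τ / 2) x)
      - 1 / 2 * secondDiff (fun t x => (potential g u t x : ℂ) * u t x) (τ / 2) (t + τ / 2) x := by
  simp only [averagingError, secondDiff, Complex.real_smul]
  rw [show t + τ / 2 + τ / 2 = t + τ by ring, show t + τ / 2 - τ / 2 = t by ring]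
  push_cast
  ring

theorem Setting.exists_averagingError_le (H : Setting T a b g f u₀ u δ) :
    ∃ M, 0 ≤ M ∧ ∀ τ t σ, 0 ≤ τ → 0 ≤ t → 0 ≤ σ → σ + t + τ ≤ T → ∀ x ∈ Icc a b, ∀ y ∈ Icc a b,
      ‖averagingError g u τ t x - averagingError g u τ t y‖ ≤ M * τ ^ 2 * |x - y| ∧
      ‖averagingError g u τ (σ + t) x - averagingError g u τ (σ + t) y -
        (averagingError g u τ t x - averagingError g u τ t y)‖ ≤ M * τ ^ 2 * σ * |x - y| := by
  obtain ⟨K, hK⟩ := (H.smooth_potential.of_le (m := 2) (by norm_num)).exists_regularOn H.hT H.hab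
  obtain ⟨A, hA0, hA⟩ := (H.smooth_u.of_le (m := 4) (by norm_num)).exists_secondDiff_le H.hT H.hab
  obtain ⟨B, hB0, hB⟩ :=
    (H.smooth_potential_mul.of_le (m := 4) (by norm_num)).exists_secondDiff_le H.hT H.hab
  have hK0 := hK.nonneg
  -- The factor `8` of the product rule is compensated by `1/2` and by `(τ/2)²`.
  refine ⟨K * A + B, by positivity, fun τ t σ hτ ht hσ hT' x hx y hy => ?_⟩
  set w := spaceTimeWeights |x - y| σ with hw
  have hwA : w.Admissible := spaceTimeWeights_admissible (abs_nonneg _) hσ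
  let X : Bool → ℝ := fun i => cond i x y
  let S : Bool → ℝ := fun i => cond i (σ + (t + τ / 2)) (t + τ / 2)
  have hX : ∀ i, X i ∈ Icc a b := by intro i; cases i <;> assumption
  have hr : 0 ≤ τ / 2 := by linarith
  have k1 : CubeBound w K (fun i j _ => (potential g u (S j) (X i) : ℂ)) := by
    have e : ∀ r : ℝ, ‖(r : ℂ)‖ = ‖r‖ := fun r => Complex.norm_real r
    have hS : ∀ j, S j ∈ Icc 0 T := by
      intro j; cases j <;> constructor <;> simp only [S, cond] <;> linarith
    refine cubeBound_of_forall_bool (fun i j => ?_) (fun j => ?_) (fun i => ?_) ?_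
    · rw [e]; exact hK.bound _ (hS j) _ (hX i)
    · rw [← Complex.ofReal_sub, e]; exact hK.lip_x _ (hS j) _ hx _ hy
    · rw [← Complex.ofReal_sub, e]
      have := hK.lip_t _ (hS true) _ (hS false) _ (hX i)
      simpa [S, abs_of_nonneg hσ] using this
    · rw [← Complex.ofReal_sub, ← Complex.ofReal_sub, ← Complex.ofReal_sub, e]
      have := hK.mixed _ (hS true) _ (hS false) _ hx _ hy
      rw [show S true - S false = σ by simp [S], abs_of_nonneg hσ] at this
      refine le_trans (le_of_eq (congrArg norm ?_)) this
      simp only [X, cond]; ring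
  have key : ∀ {F : ℝ → ℝ → ℂ} {M : ℝ}, (∀ r t, 0 ≤ r → 0 ≤ t - r → t + r ≤ T →
      ∀ x ∈ Icc a b, ∀ y ∈ Icc a b, ‖secondDiff F r t x‖ ≤ M * r ^ 2 ∧
      ‖secondDiff F r t x - secondDiff F r t y‖ ≤ M * r ^ 2 * |x - y| ∧
      ∀ σ, 0 ≤ σ → σ + t + r ≤ T →
        ‖secondDiff F r (σ + t) x - secondDiff F r t x‖ ≤ M * r ^ 2 * σ ∧
        ‖secondDiff F r (σ + t) x - secondDiff F r (σ + t) y -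
          (secondDiff F r t x - secondDiff F r t y)‖ ≤ M * r ^ 2 * σ * |x - y|) →
      CubeBound w (M * (τ / 2) ^ 2) (fun i j _ => secondDiff F (τ / 2) (S j) (X i)) := by
    intro F M hF
    have h1 : ∀ j, 0 ≤ S j - τ / 2 := by
      intro j; cases j <;> simp only [S, cond] <;> linarith
    have h2 : ∀ j, S j + τ / 2 ≤ T := by
      intro j; cases j <;> simp only [S, cond] <;> linarith
    refine cubeBound_of_forall_bool (fun i j => ?_) (fun j => ?_) (fun i => ?_) ?_
    · exact (hF _ _ hr (h1 j) (h2 j) _ (hX i) _ hy).1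
    · exact (hF _ _ hr (h1 j) (h2 j) _ hx _ hy).2.1
    · exact ((hF _ _ hr (h1 false) (h2 false) _ (hX i) _ hy).2.2 σ hσ (h2 true)).1
    · exact ((hF _ _ hr (h1 false) (h2 false) _ hx _ hy).2.2 σ hσ (h2 true)).2
  have k2 := k1.mul hwA hK0 (by positivity) (key hA)
  have k3 := key hB
  have e : ∀ z, averagingError g u τ (σ + t) z =
      1 / 2 * ((potential g u (σ + (t + τ / 2)) z : ℂ) *
        secondDiff u (τ / 2) (σ + (t + τ / 2)) z)
      - 1 / 2 * secondDiff (fun t x => (potential g u t x : ℂ) * u t x) (τ / 2)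
        (σ + (t + τ / 2)) z := by
    intro z
    rw [averagingError_eq, add_assoc σ t]
  have hh : ‖(1 / 2 : ℂ)‖ = 1 / 2 := by norm_num
  constructor
  · have a1 := k2.x false false
    have a2 := k3.x false false
    simp only [X, S, cond, hw, spaceTimeWeights] at a1 a2
    rw [averagingError_eq, averagingError_eq]
    calc _ = ‖(1 / 2 : ℂ) * ((potential g u (t + τ / 2) x : ℂ) *
          secondDiff u (τ / 2) (t + τ / 2) x - (potential g u (t + τ / 2) y : ℂ) *
          secondDiff u (τ / 2) (t + τ / 2) y) - (1 / 2 : ℂ) *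
          (secondDiff (fun t x => (potential g u t x : ℂ) * u t x) (τ / 2) (t + τ / 2) x -
          secondDiff (fun t x => (potential g u t x : ℂ) * u t x) (τ / 2) (t + τ / 2) y)‖ := by
          congr 1; ring
      _ ≤ 1 / 2 * (8 * (K * (A * (τ / 2) ^ 2)) * |x - y|) +
          1 / 2 * (B * (τ / 2) ^ 2 * |x - y|) := by
          refine (norm_sub_le _ _).trans ?_
          rw [norm_mul, norm_mul, hh]
          gcongr
      _ ≤ _ := by
          nlinarith [mul_nonneg hB0 (mul_nonneg (sq_nonneg τ) (abs_nonneg (x - y)))]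
  · have a1 := k2.xt false
    have a2 := k3.xt false
    simp only [X, S, cond, hw, spaceTimeWeights] at a1 a2
    rw [averagingError_eq _ _ _ t, averagingError_eq _ _ _ t, e, e]
    refine le_trans (le_of_eq (congrArg norm ?_)) ((norm_sub_le _ _).trans
      ((add_le_add ((norm_mul_le (1 / 2 : ℂ) _).trans (mul_le_mul_of_nonneg_left a1
        (norm_nonneg _))) ((norm_mul_le (1 / 2 : ℂ) _).trans (mul_le_mul_of_nonneg_left a2
        (norm_nonneg _)))).trans ?_))
    · ring
    · rw [hh]
      nlinarith [mul_nonneg hB0 (mul_nonneg (mul_nonneg (sq_nonneg τ) hσ) (abs_nonneg (x - y)))]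

/-! ### Nodes and restrictions -/

theorem meshWidth_pos (hab : a < b) (J : ℕ) : 0 < meshWidth a b J := by
  unfold meshWidth
  have : 0 < b - a := by linarith
  positivity

theorem meshWidth_mul (a b : ℝ) (J : ℕ) : meshWidth a b J * (J + 1) = b - a := by
  unfold meshWidth
  field_simp

theorem spaceNode_mem (hab : a < b) {J : ℕ} (j : Fin (J + 2)) :
    spaceNode a b J j ∈ Icc a b := by
  have hh := meshWidth_pos hab J
  have hm := meshWidth_mul a b J
  have hj : ((j : ℕ) : ℝ) ≤ J + 1 := by exact_mod_cast Nat.lt_succ_iff.1 j.2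
  unfold spaceNode
  constructor
  · nlinarith [Nat.cast_nonneg (α := ℝ) (j : ℕ)]
  · nlinarith

theorem spaceNode_succ (J : ℕ) (j : Fin (J + 1)) :
    spaceNode a b J j.succ = spaceNode a b J j.castSucc + meshWidth a b J := by
  simp only [spaceNode, Fin.val_succ, Fin.val_castSucc]
  push_cast
  ring

theorem spaceNode_zero (J : ℕ) : spaceNode a b J 0 = a := by simp [spaceNode]

theorem spaceNode_last (J : ℕ) : spaceNode a b J (Fin.last (J + 1)) = b := by
  have hm := meshWidth_mul a b J
  simp only [spaceNode, Fin.val_last]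
  push_cast
  linarith

theorem norm_gridDiff_restrict_le (hab : a < b) {J : ℕ} {z : ℝ → ℂ} {c : ℝ}
    (hz : ∀ x ∈ Icc a b, ∀ y ∈ Icc a b, ‖z x - z y‖ ≤ c * |x - y|) (j : Fin (J + 1)) :
    ‖gridDiff (restrict a b J z) j‖ ≤ meshWidth a b J * c := by
  have := hz _ (spaceNode_mem hab j.succ) _ (spaceNode_mem hab j.castSucc)
  rw [spaceNode_succ, add_sub_cancel_left, abs_of_pos (meshWidth_pos hab J), ← spaceNode_succ]
    at this
  rw [mul_comm]
  exact this

theorem seminormOne_restrict_le (hab : a < b) {J : ℕ} {z : ℝ → ℂ} {c : ℝ} (hc : 0 ≤ c)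
    (hz : ∀ x ∈ Icc a b, ∀ y ∈ Icc a b, ‖z x - z y‖ ≤ c * |x - y|) :
    seminormOne (meshWidth a b J) (restrict a b J z) ≤ Real.sqrt (b - a) * c :=
  seminormOne_le_const (meshWidth_pos hab J) (meshWidth_mul a b J) hc
    (norm_gridDiff_restrict_le hab hz)

theorem vanishesAtBoundary_restrict {J : ℕ} {z : ℝ → ℂ} (ha : z a = 0) (hb : z b = 0) :
    VanishesAtBoundary (restrict a b J z) := by
  constructor
  · rw [restrict, spaceNode_zero, ha]
  · rw [restrict, spaceNode_last, hb]

theorem discreteLaplacian_restrict {J : ℕ} (z : ℝ → ℂ) (i : Fin J) :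
    discreteLaplacian (meshWidth a b J) (restrict a b J z) i =
      (z (spaceNode a b J (interior i) + meshWidth a b J) - (2 : ℝ) • z (spaceNode a b J (interior i))
        + z (spaceNode a b J (interior i) - meshWidth a b J)) / (meshWidth a b J : ℂ) ^ 2 := by
  have h1 : spaceNode a b J i.succ.succ = spaceNode a b J (interior i) + meshWidth a b J :=
    spaceNode_succ J i.succ
  have h2 : spaceNode a b J i.castSucc.castSucc =
      spaceNode a b J (interior i) - meshWidth a b J := by
    have := spaceNode_succ (a := a) (b := b) J i.castSucc
    rw [interior, ← Fin.succ_castSucc, this]; ring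
  simp only [discreteLaplacian, restrict]
  rw [h1, h2]
  simp only [interior, Complex.real_smul]
  push_cast
  ring

theorem spaceNode_interior_mem (hab : a < b) {J : ℕ} (i : Fin J) :
    a ≤ spaceNode a b J (interior i) - meshWidth a b J ∧
      spaceNode a b J (interior i) + meshWidth a b J ≤ b := by
  have h1 := spaceNode_succ (a := a) (b := b) J i.succ
  have h2 := spaceNode_succ (a := a) (b := b) J i.castSucc
  rw [Fin.succ_castSucc] at h2
  constructor
  · rw [interior, h2]; have := (spaceNode_mem hab i.castSucc.castSucc).1; linarith
  · rw [interior, ← h1]; exact (spaceNode_mem hab i.succ.succ).2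

/-! ### The elliptic correction -/

/-- The correction that turns the restriction of `u t` into its discrete elliptic projection. -/
theorem Setting.exists_ellipticCorrection (H : Setting T a b g f u₀ u δ) :
    ∃ M, 0 ≤ M ∧ ∀ J : ℕ, ∃ η : ℝ → Grid J, (∀ t, VanishesAtBoundary (η t)) ∧
      (∀ t, ∀ i : Fin J, discreteLaplacian (meshWidth a b J) (restrict a b J (u t) + η t) i =
        dx a b (dx a b u) t (spaceNode a b J (interior i))) ∧
      (∀ t ∈ Icc 0 T, seminormOne (meshWidth a b J) (η t) ≤ M * meshWidth a b J ^ 2) ∧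
      (∀ t ∈ Icc 0 T, ∀ s ∈ Icc 0 T,
        seminormOne (meshWidth a b J) (η t - η s) ≤ M * meshWidth a b J ^ 2 * |t - s|) ∧
      ∀ t r, 0 ≤ r → t + r ∈ Icc 0 T → t - r ∈ Icc 0 T →
        seminormOne (meshWidth a b J) (η (t + r) - (2 : ℂ) • η t + η (t - r)) ≤
          M * meshWidth a b J ^ 2 * r ^ 2 := by
  obtain ⟨M, hM0, hM⟩ := H.smooth_u.exists_laplacianError_le H.hT H.hab
  have hℓ : 0 ≤ b - a := by linarith [H.hab]
  refine ⟨(b - a) * Real.sqrt (b - a) * M, by positivity, fun J => ?_⟩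
  set h := meshWidth a b J with hh
  have h0 : 0 < h := meshWidth_pos H.hab J
  have hc0 : (h : ℂ) ≠ 0 := by exact_mod_cast h0.ne'
  -- `η t` solves the discrete Poisson problem whose right-hand side is minus the truncation error
  -- of `u t`.
  choose η hη1 hη2 using fun t => exists_discreteLaplacian_eq h0
    (fun i : Fin J => dx a b (dx a b u) t (spaceNode a b J (interior i)) -
      discreteLaplacian h (restrict a b J (u t)) i)
  have hη3 : ∀ t i, discreteLaplacian h (η t) i =
      -(laplacianError a b u h t (spaceNode a b J (interior i)) / (h : ℂ) ^ 2) := by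
    intro t i
    rw [hη2, hh, discreteLaplacian_restrict, ← hh, laplacianError, Complex.real_smul (x := h ^ 2)]
    push_cast
    field_simp
    ring
  have hn : ‖(h : ℂ) ^ 2‖ = h ^ 2 := by
    rw [norm_pow, Complex.norm_real, Real.norm_of_nonneg h0.le]
  -- The problem is linear, so one stability estimate transfers the bounds of the truncation error
  -- and of its time differences to `η`.
  have fin : ∀ {w : Grid J} {c : ℝ}, 0 ≤ c → VanishesAtBoundary w →
      (∀ i, ∃ z : ℂ, discreteLaplacian h w i = -(z / (h : ℂ) ^ 2) ∧ ‖z‖ ≤ M * h ^ 4 * c) →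
      seminormOne h w ≤ (b - a) * Real.sqrt (b - a) * M * h ^ 2 * c := by
    intro w c hc hw hz
    refine (seminormOne_le_of_discreteLaplacian_le h0 (meshWidth_mul a b J) hw (M := M * h ^ 2 * c)
      (by positivity) fun i => ?_).trans (le_of_eq (by ring))
    obtain ⟨z, e, hz⟩ := hz i
    rw [e, norm_neg, norm_div, hn, div_le_iff₀ (by positivity)]
    exact hz.trans (le_of_eq (by ring))
  refine ⟨η, hη1, fun t i => ?_, fun t ht => ?_, fun t ht s hs => ?_, fun t r hr ht1 ht2 => ?_⟩
  · rw [discreteLaplacian_add, hη2]; ring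
  · have := fin zero_le_one (hη1 t) (fun i => ⟨_, hη3 t i, by
      have hx := spaceNode_interior_mem H.hab i
      rw [mul_one]
      exact (hM h _ h0.le hx.1 hx.2).1 t ht⟩)
    rwa [mul_one] at this
  · refine fin (abs_nonneg _) ((hη1 t).sub (hη1 s)) (fun i =>
      ⟨laplacianError a b u h t (spaceNode a b J (interior i)) -
        laplacianError a b u h s (spaceNode a b J (interior i)), ?_, ?_⟩)
    · rw [discreteLaplacian_sub, hη3, hη3]; ring
    · have hx := spaceNode_interior_mem H.hab i
      exact (hM h _ h0.le hx.1 hx.2).2.1 t ht s hs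
  · refine fin (sq_nonneg _) (((hη1 _).sub ((hη1 t).smul 2)).add (hη1 _)) (fun i =>
      ⟨laplacianError a b u h (t + r) (spaceNode a b J (interior i)) -
        (2 : ℝ) • laplacianError a b u h t (spaceNode a b J (interior i)) +
        laplacianError a b u h (t - r) (spaceNode a b J (interior i)), ?_, ?_⟩)
    · rw [discreteLaplacian_add, discreteLaplacian_sub, discreteLaplacian_smul, hη3, hη3, hη3,
        Complex.real_smul]
      push_cast
      ring
    · have hx := spaceNode_interior_mem H.hab i
      exact (hM h _ h0.le hx.1 hx.2).2.2 t r hr ht1 ht2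

end RelaxNLS

end

noncomputable section

namespace RelaxNLS

open Set

/-! ### The corrected solution satisfies the scheme up to small residuals -/

variable {T a b : ℝ} {g : ℝ → ℝ} {f : ℝ → ℝ → ℂ} {u₀ : ℝ → ℂ} {u : ℝ → ℝ → ℂ} {δ : ℝ}

/-- The restriction of `u t`, corrected by `η t`. -/
def corrected (a b : ℝ) {J : ℕ} (u : ℝ → ℝ → ℂ) (η : ℝ → Grid J) (t : ℝ) : Grid J :=
  restrict a b J (u t) + η t

/-- The correction `η` together with the residuals `R τ t` of a time step from `t` to `t + τ` and
`R₀ s` of the initial step from `0` to `s`. -/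
structure IsCorrection (T a b : ℝ) (g : ℝ → ℝ) (f : ℝ → ℝ → ℂ) (u : ℝ → ℝ → ℂ) (J : ℕ) (M : ℝ)
    (η : ℝ → Grid J) (R : ℝ → ℝ → Grid J) (R₀ : ℝ → Grid J) : Prop where
  vanishes : ∀ t, VanishesAtBoundary (η t)
  laplacian : ∀ t, ∀ i : Fin J, discreteLaplacian (meshWidth a b J) (corrected a b u η t) i =
    dx a b (dx a b u) t (spaceNode a b J (interior i))
  bound : ∀ t ∈ Icc 0 T, seminormOne (meshWidth a b J) (η t) ≤ M * meshWidth a b J ^ 2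
  lip : ∀ t ∈ Icc 0 T, ∀ s ∈ Icc 0 T,
    seminormOne (meshWidth a b J) (η t - η s) ≤ M * meshWidth a b J ^ 2 * |t - s|
  step_vanishes : ∀ τ t, 0 ≤ τ → 0 ≤ t → t + τ ≤ T → VanishesAtBoundary (R τ t)
  step_eq : ∀ τ t, 0 ≤ τ → 0 ≤ t → t + τ ≤ T → ∀ i : Fin J,
    corrected a b u η (t + τ) (interior i) - corrected a b u η t (interior i) =
      Complex.I * τ * discreteLaplacian (meshWidth a b J)
          ((1 / 2 : ℂ) • (corrected a b u η (t + τ) + corrected a b u η t)) i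
        + Complex.I * τ * ((potential g u (t + τ / 2) (spaceNode a b J (interior i)) : ℂ) *
          ((u (t + τ) (spaceNode a b J (interior i)) + u t (spaceNode a b J (interior i))) / 2))
        + τ * ((f (t + τ) (spaceNode a b J (interior i))
          + f t (spaceNode a b J (interior i))) / 2)
        + R τ t (interior i)
  step_bound : ∀ τ t, 0 ≤ τ → 0 ≤ t → t + τ ≤ T →
    seminormOne (meshWidth a b J) (R τ t) ≤ M * τ * (τ ^ 2 + meshWidth a b J ^ 2)
  step_lip : ∀ τ t, 0 ≤ τ → 0 ≤ t → τ + t + τ ≤ T →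
    seminormOne (meshWidth a b J) (R τ (τ + t) - R τ t) ≤
      M * τ ^ 2 * (τ ^ 2 + meshWidth a b J ^ 2)
  start_vanishes : ∀ s, 0 ≤ s → s ≤ T → VanishesAtBoundary (R₀ s)
  start_eq : ∀ s, 0 ≤ s → s ≤ T → ∀ i : Fin J,
    corrected a b u η s (interior i) - corrected a b u η 0 (interior i) =
      Complex.I * s * discreteLaplacian (meshWidth a b J)
          ((1 / 2 : ℂ) • (corrected a b u η s + corrected a b u η 0)) i
        + Complex.I * s * ((potential g u 0 (spaceNode a b J (interior i)) : ℂ) *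
          ((u s (spaceNode a b J (interior i)) + u 0 (spaceNode a b J (interior i))) / 2))
        + s * ((f s (spaceNode a b J (interior i)) + f 0 (spaceNode a b J (interior i))) / 2)
        + R₀ s (interior i)
  start_bound : ∀ s, 0 ≤ s → s ≤ T →
    seminormOne (meshWidth a b J) (R₀ s) ≤ M * s * (s + meshWidth a b J ^ 2)

/-- Needed for the trapezoidal residual to vanish at the boundary, as the energy inequality demands.
-/
theorem Setting.dt_boundary (H : Setting T a b g f u₀ u δ) {t : ℝ} (ht : t ∈ Icc 0 T) :
    dt T u t a = 0 ∧ dt T u t b = 0 := by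
  have key : ∀ x, (∀ t ∈ Icc 0 T, u t x = 0) → dt T u t x = 0 := by
    intro x hx
    have e : dt T u t x = derivWithin (fun _ => (0 : ℂ)) (Icc 0 T) t :=
      derivWithin_congr (fun s hs => hx s hs) (hx t ht)
    rw [e]; simp
  exact ⟨key a fun t ht => (H.hsol.boundary t ht).1, key b fun t ht => (H.hsol.boundary t ht).2⟩

theorem norm_I_mul_ofReal {r : ℝ} (hr : 0 ≤ r) : ‖Complex.I * (r : ℂ)‖ = r := by
  rw [norm_mul, Complex.norm_I, one_mul, Complex.norm_real, Real.norm_of_nonneg hr]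

/-- Since the discrete Laplacian of the corrected solution is exactly `u_xx`, inserting the equation
into the trapezoidal rule leaves only time increments of `η`, the quadrature error and the averaging
error. All three vanish at the boundary, and their time differences gain a further factor `τ`. -/
theorem Setting.exists_isCorrection (H : Setting T a b g f u₀ u δ) :
    ∃ M, 0 ≤ M ∧ ∀ J : ℕ, ∃ η R R₀, IsCorrection T a b g f u J M η R R₀ := by
  obtain ⟨A, hA0, hA⟩ := H.exists_ellipticCorrection
  obtain ⟨B, hB0, hB⟩ := (H.smooth_u.of_le (m := 5) (by norm_num)).exists_trapezoidError_le H.hT H.hab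
  obtain ⟨C, hC0, hC⟩ := H.exists_averagingError_le
  obtain ⟨K, hK⟩ := (H.smooth_potential.of_le (m := 2) (by norm_num)).exists_regularOn H.hT H.hab
  obtain ⟨L, hL⟩ := (H.smooth_u.of_le (m := 2) (by norm_num)).exists_regularOn H.hT H.hab
  have hK0 := hK.nonneg
  have hL0 := hL.nonneg
  have hT := H.hT
  have hab := H.hab
  set s0 := Real.sqrt (b - a) with hs0
  have hs00 : 0 ≤ s0 := Real.sqrt_nonneg _
  refine ⟨A + s0 * B + s0 * B * T + s0 * C + s0 * (K * L), by positivity, fun J => ?_⟩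
  set M := A + s0 * B + s0 * B * T + s0 * C + s0 * (K * L) with hM
  obtain ⟨η, h1, h2, h3, h4, h5⟩ := hA J
  set h := meshWidth a b J with hh
  have hh0 : 0 < h := meshWidth_pos hab J
  have hAM : A ≤ M := by
    have : 0 ≤ s0 * B + s0 * B * T + s0 * C + s0 * (K * L) := by positivity
    rw [hM]; linarith
  have smul_bound : ∀ {v : Grid J} {r : ℝ}, 0 ≤ r →
      seminormOne h ((Complex.I * (r : ℂ)) • v) = r * seminormOne h v := by
    intro v r hr
    rw [seminormOne_smul hh0, norm_I_mul_ofReal hr]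
  have trap_eq : ∀ τ t x, 0 ≤ τ → 0 ≤ t → t + τ ≤ T → x ∈ Icc a b →
      u (t + τ) x - u t x = trapezoidError T u τ t x + (τ / 2 : ℂ) *
        ((Complex.I * dx a b (dx a b u) (t + τ) x
          + Complex.I * (potential g u (t + τ) x : ℂ) * u (t + τ) x + f (t + τ) x)
        + (Complex.I * dx a b (dx a b u) t x
          + Complex.I * (potential g u t x : ℂ) * u t x + f t x)) := by
    intro τ t x hτ ht htT hx
    rw [← H.pde ⟨by linarith, htT⟩ hx, ← H.pde ⟨ht, by linarith⟩ hx, trapezoidError,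
      Complex.real_smul]
    push_cast
    ring
  have lap_eq : ∀ t s (i : Fin J), discreteLaplacian h
      ((1 / 2 : ℂ) • (corrected a b u η t + corrected a b u η s)) i =
      1 / 2 * (dx a b (dx a b u) t (spaceNode a b J (interior i)) +
        dx a b (dx a b u) s (spaceNode a b J (interior i))) := by
    intro t s i
    rw [discreteLaplacian_smul, discreteLaplacian_add]
    unfold corrected
    rw [h2, h2]
  have trap_vanishes : ∀ τ t, 0 ≤ τ → 0 ≤ t → t + τ ≤ T →
      VanishesAtBoundary (restrict a b J (trapezoidError T u τ t)) := by
    intro τ t hτ ht htT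
    have m1 : t ∈ Icc 0 T := ⟨ht, by linarith⟩
    have m2 : t + τ ∈ Icc 0 T := ⟨by linarith, htT⟩
    apply vanishesAtBoundary_restrict <;>
      simp [trapezoidError, H.hsol.boundary _ m1, H.hsol.boundary _ m2, H.dt_boundary m1,
        H.dt_boundary m2]
  refine ⟨η, fun τ t => (η (t + τ) - η t) + restrict a b J (trapezoidError T u τ t)
      - (Complex.I * (τ : ℂ)) • restrict a b J (averagingError g u τ t),
    fun s => (η s - η 0) + restrict a b J (trapezoidError T u s 0)
      + (Complex.I * ((s / 2 : ℝ) : ℂ)) • restrict a b J (fun x =>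
        ((potential g u s x - potential g u 0 x : ℝ) : ℂ) * u s x), ?_⟩
  refine ⟨h1, h2, fun t ht => (h3 t ht).trans (by gcongr),
    fun t ht s hs => (h4 t ht s hs).trans (by gcongr), fun τ t hτ ht htT => ?_,
    fun τ t hτ ht htT i => ?_, fun τ t hτ ht htT => ?_, fun τ t hτ ht htT => ?_,
    fun s hs hsT => ?_, fun s hs hsT i => ?_, fun s hs hsT => ?_⟩
  · have m1 : t ∈ Icc 0 T := ⟨ht, by linarith⟩
    have m2 : t + τ ∈ Icc 0 T := ⟨by linarith, htT⟩
    refine (((h1 _).sub (h1 _)).add (trap_vanishes τ t hτ ht htT)).sub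
      (VanishesAtBoundary.smul _ ?_)
    apply vanishesAtBoundary_restrict <;>
      simp [averagingError, H.hsol.boundary _ m1, H.hsol.boundary _ m2]
  · rw [lap_eq]
    have e := trap_eq τ t _ hτ ht htT (spaceNode_mem hab (interior i))
    simp only [corrected, restrict, Pi.add_apply, Pi.sub_apply, Pi.smul_apply, smul_eq_mul,
      averagingError]
    linear_combination e
  · have m1 : t ∈ Icc 0 T := ⟨ht, by linarith⟩
    have m2 : t + τ ∈ Icc 0 T := ⟨by linarith, htT⟩
    have b1 := h4 _ m2 _ m1
    rw [add_sub_cancel_left, abs_of_nonneg hτ] at b1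
    have b2 := seminormOne_restrict_le hab (J := J) (z := trapezoidError T u τ t)
      (c := B * τ ^ 3) (by positivity) fun x hx y hy => (hB τ t hτ ht htT x hx y hy).1
    have b3 := seminormOne_restrict_le hab (J := J) (z := averagingError g u τ t)
      (c := C * τ ^ 2) (by positivity) fun x hx y hy =>
        (hC τ t 0 hτ ht le_rfl (by linarith) x hx y hy).1
    rw [← hh, ← hs0] at b2 b3
    refine (seminormOne_sub_le hh0 _ _).trans ?_
    rw [smul_bound hτ]
    refine (add_le_add ((seminormOne_add_le hh0 _ _).trans (add_le_add b1 b2))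
      (mul_le_mul_of_nonneg_left b3 hτ)).trans ?_
    have e : M * τ * (τ ^ 2 + h ^ 2) - (A * h ^ 2 * τ + s0 * (B * τ ^ 3) + τ * (s0 * (C * τ ^ 2)))
        = τ * ((A + s0 * B * T + s0 * (K * L)) * τ ^ 2
          + (s0 * B + s0 * B * T + s0 * C + s0 * (K * L)) * h ^ 2) := by rw [hM]; ring
    have : 0 ≤ τ * ((A + s0 * B * T + s0 * (K * L)) * τ ^ 2
          + (s0 * B + s0 * B * T + s0 * C + s0 * (K * L)) * h ^ 2) := by positivity
    linarith
  -- The difference of consecutive increments of `η` is a second difference centred at `τ + t`.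
  · have b1 := h5 (τ + t) τ hτ ⟨by linarith, htT⟩ ⟨by linarith, by linarith⟩
    have b2 := seminormOne_restrict_le hab (J := J)
      (z := fun x => trapezoidError T u τ (τ + t) x - trapezoidError T u τ t x)
      (c := B * τ ^ 4) (by positivity) fun x hx y hy => by
        refine le_trans (le_of_eq (congrArg norm ?_))
          ((hB τ t hτ ht (by linarith) x hx y hy).2 htT)
        ring
    have b3 := seminormOne_restrict_le hab (J := J)
      (z := fun x => averagingError g u τ (τ + t) x - averagingError g u τ t x)
      (c := C * τ ^ 2 * τ) (by positivity) fun x hx y hy => by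
        refine le_trans (le_of_eq (congrArg norm ?_)) (hC τ t τ hτ ht hτ htT x hx y hy).2
        ring
    rw [← hh, ← hs0] at b2 b3
    have e : (η (τ + t + τ) - η (τ + t) + restrict a b J (trapezoidError T u τ (τ + t))
        - (Complex.I * (τ : ℂ)) • restrict a b J (averagingError g u τ (τ + t)))
        - (η (t + τ) - η t + restrict a b J (trapezoidError T u τ t)
        - (Complex.I * (τ : ℂ)) • restrict a b J (averagingError g u τ t)) =
        (η (τ + t + τ) - (2 : ℂ) • η (τ + t) + η (τ + t - τ))
        + restrict a b J (fun x => trapezoidError T u τ (τ + t) x - trapezoidError T u τ t x)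
        - (Complex.I * (τ : ℂ)) • restrict a b J (fun x => averagingError g u τ (τ + t) x
          - averagingError g u τ t x) := by
      rw [show t + τ = τ + t by ring, show τ + t - τ = t by ring]
      ext j
      simp only [restrict, Pi.add_apply, Pi.sub_apply, Pi.smul_apply, smul_eq_mul]
      ring
    rw [e]
    refine (seminormOne_sub_le hh0 _ _).trans ?_
    rw [smul_bound hτ]
    refine (add_le_add ((seminormOne_add_le hh0 _ _).trans (add_le_add b1 b2))
      (mul_le_mul_of_nonneg_left b3 hτ)).trans ?_
    have e : M * τ ^ 2 * (τ ^ 2 + h ^ 2) - (A * h ^ 2 * τ ^ 2 + s0 * (B * τ ^ 4)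
        + τ * (s0 * (C * τ ^ 2 * τ)))
        = τ ^ 2 * ((A + s0 * B * T + s0 * (K * L)) * τ ^ 2
          + (s0 * B + s0 * B * T + s0 * C + s0 * (K * L)) * h ^ 2) := by rw [hM]; ring
    have : 0 ≤ τ ^ 2 * ((A + s0 * B * T + s0 * (K * L)) * τ ^ 2
          + (s0 * B + s0 * B * T + s0 * C + s0 * (K * L)) * h ^ 2) := by positivity
    linarith
  · refine (((h1 _).sub (h1 _)).add (trap_vanishes s 0 hs le_rfl (by simpa using hsT))).add
      (VanishesAtBoundary.smul _ ?_)
    apply vanishesAtBoundary_restrict <;> simp [H.hsol.boundary s ⟨hs, hsT⟩]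
  · rw [lap_eq]
    have e := trap_eq s 0 _ hs le_rfl (by simpa using hsT) (spaceNode_mem hab (interior i))
    rw [zero_add] at e
    simp only [corrected, restrict, Pi.add_apply, Pi.sub_apply, Pi.smul_apply, smul_eq_mul]
    push_cast
    linear_combination e
  · have m1 : (0 : ℝ) ∈ Icc 0 T := ⟨le_rfl, hT.le⟩
    have m2 : s ∈ Icc 0 T := ⟨hs, hsT⟩
    have b1 := h4 _ m2 _ m1
    rw [sub_zero, abs_of_nonneg hs] at b1
    have b2 := seminormOne_restrict_le hab (J := J) (z := trapezoidError T u s 0)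
      (c := B * s ^ 3) (by positivity) fun x hx y hy =>
        (hB s 0 hs le_rfl (by simpa using hsT) x hx y hy).1
    -- Freezing the potential at time `0` is only first order, but this step is made once and its
    -- residual carries another factor `s`.
    have b3 := seminormOne_restrict_le hab (J := J) (z := fun x =>
        ((potential g u s x - potential g u 0 x : ℝ) : ℂ) * u s x)
      (c := 2 * (K * L) * s) (by positivity) fun x hx y hy => by
        have q1 := hK.mixed s m2 0 m1 x hx y hy
        have q2 := hL.bound s m2 x hx
        have q3 := hK.lip_t s m2 0 m1 y hy
        have q4 := hL.lip_x s m2 x hx y hy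
        rw [sub_zero, abs_of_nonneg hs] at q1 q3
        calc _ = ‖((potential g u s x - potential g u 0 x - (potential g u s y - potential g u 0 y)
              : ℝ) : ℂ) * u s x + ((potential g u s y - potential g u 0 y : ℝ) : ℂ)
              * (u s x - u s y)‖ := by congr 1; push_cast; ring
          _ ≤ K * s * |x - y| * L + K * s * (L * |x - y|) := by
            refine (norm_add_le _ _).trans ?_
            rw [norm_mul, norm_mul, Complex.norm_real, Complex.norm_real]
            gcongr
          _ = _ := by ring
    rw [← hh, ← hs0] at b2 b3
    refine (seminormOne_add_le hh0 _ _).trans ?_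
    rw [smul_bound (by positivity)]
    refine (add_le_add ((seminormOne_add_le hh0 _ _).trans (add_le_add b1 b2))
      (mul_le_mul_of_nonneg_left b3 (by positivity))).trans ?_
    have e : M * s * (s + h ^ 2) - (A * h ^ 2 * s + s0 * (B * s ^ 3)
        + s / 2 * (s0 * (2 * (K * L) * s)))
        = s * ((A + s0 * B + s0 * C) * s + s0 * B * (T - s) * s
          + (s0 * B + s0 * B * T + s0 * C + s0 * (K * L)) * h ^ 2) := by rw [hM]; ring
    have hTs : 0 ≤ T - s := by linarith
    have : 0 ≤ s * ((A + s0 * B + s0 * C) * s + s0 * B * (T - s) * s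
          + (s0 * B + s0 * B * T + s0 * C + s0 * (K * L)) * h ^ 2) := by positivity
    linarith

end RelaxNLS

end

noncomputable section

namespace RelaxNLS

open Set

/-! ### Bounds for the nonlinear terms -/

section Nonlinear

variable {J : ℕ} {h σ K ℓ δ : ℝ}

/-- A real grid function as a complex one. -/
def toGrid (p : RealGrid J) : Grid J := fun j => (p j : ℂ)

/-- The grid function `n_δ(Φ) γ_δ(V)`. -/
def cutoffProduct (δ : ℝ) (Φ : RealGrid J) (V : Grid J) : Grid J :=
  fun j => (cutoff δ (Φ j) : ℂ) * mollifier δ (V j)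

/-- The grid function `g(|γ_δ(V)|²)`. -/
def cutoffPotential (δ : ℝ) (g : ℝ → ℝ) (V : Grid J) : Grid J :=
  fun j => (g (‖mollifier δ (V j)‖ ^ 2) : ℂ)

/-- Bounds for the values and differences of a pair of grid functions at time distance `σ`. -/
structure RegularPair (h σ K : ℝ) (U : Bool → Grid J) : Prop where
  bound : ∀ t j, ‖U t j‖ ≤ K
  x : ∀ t j, ‖gridDiff (U t) j‖ ≤ h * K
  t : ∀ j, ‖U true j - U false j‖ ≤ K * σ
  xt : ∀ j, ‖gridDiff (U true - U false) j‖ ≤ h * (K * σ)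

/-- Weights for exact data with mesh widths `h`, `σ` and errors of sizes `z`, `zx`, `zt`, `zxt`. -/
def errorWeights (h σ z zx zt zxt : ℝ) : Weights :=
  ⟨h + zx, σ + zt, z, (h + zx) * (σ + zt) + zxt, zx + h * z, zt + σ * z,
    zxt + (σ + zt) * zx + h * (zt + σ * z)⟩

/-- Here the maximum norm `z` of the errors must be at most one: products of an error with an error
are to be dominated by terms linear in the errors. This is the source of every smallness condition
below. -/
theorem errorWeights_admissible {z zx zt zxt : ℝ} (hh : 0 ≤ h) (hσ : 0 ≤ σ) (hz : 0 ≤ z)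
    (hz1 : z ≤ 1) (hzx : 0 ≤ zx) (hzt : 0 ≤ zt) (hzxt : 0 ≤ zxt) :
    (errorWeights h σ z zx zt zxt).Admissible := by
  have a1 : 0 ≤ zx * (1 - z) := mul_nonneg hzx (by linarith)
  have a2 : 0 ≤ zt * (1 - z) := mul_nonneg hzt (by linarith)
  have a3 : 0 ≤ zxt * (1 - z) := mul_nonneg hzxt (by linarith)
  have a4 : 0 ≤ zx * (zt * (1 - z)) := mul_nonneg hzx a2
  have a5 : 0 ≤ σ * (zx * (1 - z)) := mul_nonneg hσ a1
  have a6 : 0 ≤ h * (zt * (1 - z)) := mul_nonneg hh a2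
  constructor
  all_goals simp only [errorWeights]
  · positivity
  · positivity
  · positivity
  · linarith
  · nlinarith
  · nlinarith
  · nlinarith
  · nlinarith
  · nlinarith

/-- The end points of an edge. -/
def edgeNode (j : Fin (J + 1)) (X : Bool) : Fin (J + 2) := cond X j.succ j.castSucc

/-- The direction `s` leads from exact data (`false`) to approximate data (`true`). Differences
along `s` are errors; differences of `V` in the other directions are those of `U` plus those of the
error. -/
theorem diffBound_of_error {z zx zt zxt : ℝ} (hh : 0 ≤ h) (hσ : 0 ≤ σ) (hz : 0 ≤ z)
    (hzx : 0 ≤ zx) (hzt : 0 ≤ zt) (hzxt : 0 ≤ zxt) (hK : 0 ≤ K) {U V : Bool → Grid J}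
    (hU : RegularPair h σ K U) (j : Fin (J + 1)) (b0 : ∀ t j, ‖(U t - V t) j‖ ≤ z)
    (bx : ∀ t, ‖gridDiff (U t - V t) j‖ ≤ zx)
    (bt : ∀ j, ‖(U true - V true - (U false - V false)) j‖ ≤ zt)
    (bxt : ‖gridDiff (U true - V true - (U false - V false)) j‖ ≤ zxt) :
    DiffBound (errorWeights h σ z zx zt zxt) (K + 1)
      (fun X t s => cond s (V t (edgeNode j X)) (U t (edgeNode j X))) where
  x t s := by
    cases s
    · refine (hU.x t j).trans ?_
      simp only [errorWeights]
      nlinarith [mul_nonneg hK hzx]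
    · have e : V t j.succ - V t j.castSucc = gridDiff (U t) j - gridDiff (U t - V t) j := by
        simp only [gridDiff, Pi.sub_apply]; ring
      simp only [edgeNode, cond, errorWeights]
      rw [e]
      refine (norm_sub_le _ _).trans ((add_le_add (hU.x t j) (bx t)).trans ?_)
      nlinarith [mul_nonneg hK hzx]
  t X s := by
    cases s
    · refine (hU.t _).trans ?_
      simp only [errorWeights]
      nlinarith [mul_nonneg hK hzt]
    · have e : V true (edgeNode j X) - V false (edgeNode j X) =
          (U true (edgeNode j X) - U false (edgeNode j X)) -
          (U true - V true - (U false - V false)) (edgeNode j X) := by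
        simp only [Pi.sub_apply]; ring
      simp only [errorWeights, cond]
      rw [e]
      refine (norm_sub_le _ _).trans ((add_le_add (hU.t _) (bt _)).trans ?_)
      nlinarith [mul_nonneg hK hzt]
  s X t := by
    simp only [errorWeights, cond]
    rw [norm_sub_rev]
    refine (b0 t _).trans ?_
    nlinarith [mul_nonneg hK hz]
  xt s := by
    have p1 : 0 ≤ zx * σ := by positivity
    have p2 : 0 ≤ h * zt := by positivity
    have p3 : 0 ≤ zx * zt := by positivity
    have p4 : 0 ≤ h * σ := by positivity
    cases s
    · refine le_trans (le_of_eq (congrArg norm ?_)) ((hU.xt j).trans ?_)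
      · simp only [edgeNode, cond, gridDiff, Pi.sub_apply]; ring
      · simp only [errorWeights]
        nlinarith [mul_nonneg hK p1, mul_nonneg hK p2, mul_nonneg hK p3, mul_nonneg hK hzxt]
    · refine le_trans (le_of_eq (congrArg norm (?_ : _ = gridDiff (U true - U false) j -
        gridDiff (U true - V true - (U false - V false)) j)))
        ((norm_sub_le _ _).trans ((add_le_add (hU.xt j) bxt).trans ?_))
      · simp only [edgeNode, cond, gridDiff, Pi.sub_apply]; ring
      · simp only [errorWeights]
        nlinarith [mul_nonneg hK p1, mul_nonneg hK p2, mul_nonneg hK p3, mul_nonneg hK hzxt]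
  xs t := by
    refine le_trans (le_of_eq ((congrArg norm (?_ : _ = -gridDiff (U t - V t) j)).trans
      (norm_neg _))) ((bx t).trans ?_)
    · simp only [edgeNode, cond, gridDiff, Pi.sub_apply]; ring
    · simp only [errorWeights]
      nlinarith [mul_nonneg hK hzx, mul_nonneg hh hz, mul_nonneg hK (mul_nonneg hh hz)]
  ts X := by
    refine le_trans (le_of_eq ((congrArg norm (?_ : _ =
      -(U true - V true - (U false - V false)) (edgeNode j X))).trans
      (norm_neg _))) ((bt _).trans ?_)
    · simp only [cond, Pi.sub_apply]; ring
    · simp only [errorWeights]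
      nlinarith [mul_nonneg hK hzt, mul_nonneg hσ hz, mul_nonneg hK (mul_nonneg hσ hz)]
  xts := by
    refine le_trans (le_of_eq ((congrArg norm (?_ : _ =
      -gridDiff (U true - V true - (U false - V false)) j)).trans
      (norm_neg _))) (bxt.trans ?_)
    · simp only [edgeNode, cond, gridDiff, Pi.sub_apply]; ring
    · simp only [errorWeights]
      have p : 0 ≤ (σ + zt) * zx + h * (zt + σ * z) := by positivity
      nlinarith [mul_nonneg hK hzxt, mul_nonneg hK p]

theorem DiffBound.re {w : Weights} {c : ℝ} {f : Bool → Bool → Bool → ℂ} (hf : DiffBound w c f) :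
    DiffBound w c (fun X t s => (f X t s).re) := by
  have key : ∀ {z : ℂ} {r B : ℝ}, ‖z‖ ≤ B → z.re = r → ‖r‖ ≤ B := fun h e => by
    rw [← e]; exact (Complex.abs_re_le_norm _).trans h
  exact ⟨fun t s => key (hf.x t s) (by simp), fun x s => key (hf.t x s) (by simp),
    fun x t => key (hf.s x t) (by simp), fun s => key (hf.xt s) (by simp),
    fun t => key (hf.xs t) (by simp), fun x => key (hf.ts x) (by simp), key hf.xts (by simp)⟩

theorem DiffBound.im {w : Weights} {c : ℝ} {f : Bool → Bool → Bool → ℂ} (hf : DiffBound w c f) :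
    DiffBound w c (fun X t s => (f X t s).im) := by
  have key : ∀ {z : ℂ} {r B : ℝ}, ‖z‖ ≤ B → z.im = r → ‖r‖ ≤ B := fun h e => by
    rw [← e]; exact (Complex.abs_im_le_norm _).trans h
  exact ⟨fun t s => key (hf.x t s) (by simp), fun x s => key (hf.t x s) (by simp),
    fun x t => key (hf.s x t) (by simp), fun s => key (hf.xt s) (by simp),
    fun t => key (hf.xs t) (by simp), fun x => key (hf.ts x) (by simp), key hf.xts (by simp)⟩

theorem mollifier_re (δ : ℝ) (z : ℂ) : (mollifier δ z).re = cutoff δ z.re := by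
  simp [mollifier]

theorem mollifier_im (δ : ℝ) (z : ℂ) : (mollifier δ z).im = cutoff δ z.im := by
  simp [mollifier]

theorem norm_mollifier_sq (δ : ℝ) (z : ℂ) :
    ‖mollifier δ z‖ ^ 2 = cutoff δ z.re * cutoff δ z.re + cutoff δ z.im * cutoff δ z.im := by
  rw [← Complex.normSq_eq_norm_sq, Complex.normSq_apply, mollifier_re, mollifier_im]

/-- The mixed differences of the nonlinear terms along an edge. -/
theorem exists_edge_bound (hδ : 0 < δ) {g : ℝ → ℝ} (hg : ContDiffOn ℝ 3 g (Ici 0)) (hK : 0 ≤ K) :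
    ∃ C, 0 ≤ C ∧ ∀ (J : ℕ) (w : Weights), w.Admissible → ∀ (φ Φ : Bool → RealGrid J)
      (U V : Bool → Grid J) (j : Fin (J + 1)),
      DiffBound w (K + 1)
        (fun X t s => cond s (toGrid (Φ t) (edgeNode j X)) (toGrid (φ t) (edgeNode j X))) →
      DiffBound w (K + 1) (fun X t s => cond s (V t (edgeNode j X)) (U t (edgeNode j X))) →
      (∀ t, ‖gridDiff (cutoffProduct δ (φ t) (U t) - cutoffProduct δ (Φ t) (V t)) j‖
        ≤ C * w.xs) ∧
      ‖gridDiff (cutoffProduct δ (φ true) (U true) - cutoffProduct δ (Φ true) (V true) -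
        (cutoffProduct δ (φ false) (U false) - cutoffProduct δ (Φ false) (V false))) j‖
          ≤ C * w.xts ∧
      (∀ t, ‖gridDiff (cutoffPotential δ g (U t) - cutoffPotential δ g (V t)) j‖ ≤ C * w.xs) ∧
      ‖gridDiff (cutoffPotential δ g (U true) - cutoffPotential δ g (V true) -
        (cutoffPotential δ g (U false) - cutoffPotential δ g (V false))) j‖ ≤ C * w.xts := by
  obtain ⟨M, hM0, hM⟩ := exists_c2LipOn_cutoff hδ
  -- The range of `|γ_δ|²` lies in `[0, R]`, so `g` is needed only on a compact interval, whatever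
  -- `V` is.
  set R := 2 * (100 * δ) ^ 2 with hR
  obtain ⟨M', hM0', hM'⟩ := exists_c2LipOn_of_contDiffOn hg R
  set c0 := 5 * (M * (K + 1) ^ 3) with hc0
  have hc00 : 0 ≤ c0 := by positivity
  set c1 := 8 * (c0 * c0) with hc1
  have hc10 : 0 ≤ c1 := by positivity
  set c2 := 5 * (M' * (c1 + c1 + 1) ^ 3) with hc2
  have hc20 : 0 ≤ c2 := by positivity
  refine ⟨c1 + c1 + c2, by positivity, fun J w hw φ Φ U V j d1 d2 => ?_⟩
  have hxs := hw.xs_nonneg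
  have hxts := hw.xts_nonneg
  have k1 := d1.re.comp hw (by linarith) hM0 convex_univ hM (fun _ _ _ => mem_univ _)
  have k2 := d2.re.comp hw (by linarith) hM0 convex_univ hM (fun _ _ _ => mem_univ _)
  have k3 := d2.im.comp hw (by linarith) hM0 convex_univ hM (fun _ _ _ => mem_univ _)
  have k12 := k1.mul hw hc00 hc00 k2
  have k13 := k1.mul hw hc00 hc00 k3
  -- This is `|γ_δ|²`, a polynomial in the cut-off real and imaginary parts.
  have k4 := (k2.mul hw hc00 hc00 k2).add (k3.mul hw hc00 hc00 k3)
  have kg := (k4.toDiffBound.mono hw (by linarith : _ ≤ c1 + c1 + 1)).comp hw (by linarith) hM0'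
    (convex_Icc 0 R) hM' (fun X t s => by
      refine ⟨add_nonneg (mul_self_nonneg _) (mul_self_nonneg _), ?_⟩
      have q : ∀ x, cutoff δ x * cutoff δ x ≤ (100 * δ) ^ 2 := by
        intro x
        have := abs_cutoff_le hδ x
        rw [← sq, ← sq_abs]
        gcongr
      rw [hR, two_mul]
      exact add_le_add (q _) (q _))
  simp only [← norm_mollifier_sq] at kg
  have cx : ∀ {z : ℂ} {B r i : ℝ}, ‖r‖ ≤ c1 * B → ‖i‖ ≤ c1 * B → 0 ≤ B → z.re = -r →
      z.im = -i → ‖z‖ ≤ (c1 + c1 + c2) * B := by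
    intro z B r i hr hi hB er ei
    refine (Complex.norm_le_abs_re_add_abs_im z).trans ?_
    rw [er, ei, abs_neg, abs_neg]
    have := mul_nonneg hc20 hB
    rw [Real.norm_eq_abs] at hr hi
    linarith
  have cg : ∀ {z : ℂ} {B r : ℝ}, ‖r‖ ≤ c2 * B → 0 ≤ B → z = ((-r : ℝ) : ℂ) →
      ‖z‖ ≤ (c1 + c1 + c2) * B := by
    intro z B r hr hB e
    rw [e, Complex.norm_real, norm_neg]
    have := mul_nonneg hc10 hB
    linarith
  refine ⟨fun t => ?_, ?_, fun t => ?_, ?_⟩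
  · refine cx (k12.xs t) (k13.xs t) hxs ?_ ?_
    · simp only [gridDiff, cutoffProduct, Pi.sub_apply, Complex.sub_re, Complex.re_ofReal_mul,
        mollifier_re, toGrid, edgeNode, cond, Complex.ofReal_re]
      ring
    · simp only [gridDiff, cutoffProduct, Pi.sub_apply, Complex.sub_im, Complex.im_ofReal_mul,
        mollifier_im, toGrid, edgeNode, cond, Complex.ofReal_re]
      ring
  · refine cx k12.xts k13.xts hxts ?_ ?_
    · simp only [gridDiff, cutoffProduct, Pi.sub_apply, Complex.sub_re, Complex.re_ofReal_mul,
        mollifier_re, toGrid, edgeNode, cond, Complex.ofReal_re]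
      ring
    · simp only [gridDiff, cutoffProduct, Pi.sub_apply, Complex.sub_im, Complex.im_ofReal_mul,
        mollifier_im, toGrid, edgeNode, cond, Complex.ofReal_re]
      ring
  · refine cg (kg.xs t) hxs ?_
    simp only [gridDiff, cutoffPotential, Pi.sub_apply, edgeNode, cond]
    push_cast
    ring
  · refine cg kg.xts hxts ?_
    simp only [gridDiff, cutoffPotential, Pi.sub_apply, edgeNode, cond]
    push_cast
    ring

/-- The sum of the seminorms of the errors at two times. -/
def errorSum (h : ℝ) (e ζ : Bool → Grid J) : ℝ :=
  seminormOne h (e false) + seminormOne h (e true) + seminormOne h (ζ false)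
    + seminormOne h (ζ true)

/-- The seminorms of the differences of the errors at two times. -/
def errorDiff (h : ℝ) (e ζ : Bool → Grid J) : ℝ :=
  seminormOne h (e true - e false) + seminormOne h (ζ true - ζ false)

theorem errorSum_nonneg (e ζ : Bool → Grid J) : 0 ≤ errorSum h e ζ := by
  have := fun v : Grid J => seminormOne_nonneg (h := h) v
  unfold errorSum
  linarith [this (e false), this (e true), this (ζ false), this (ζ true)]

theorem errorDiff_nonneg (e ζ : Bool → Grid J) : 0 ≤ errorDiff h e ζ := by
  have := fun v : Grid J => seminormOne_nonneg (h := h) v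
  unfold errorDiff
  linarith [this (e true - e false), this (ζ true - ζ false)]

/-- The bounds for the nonlinear terms in the discrete `H¹` seminorm, for small errors. -/
theorem exists_nonlinear_bound (hδ : 0 < δ) {g : ℝ → ℝ} (hg : ContDiffOn ℝ 3 g (Ici 0))
    (hK : 0 ≤ K) :
    ∃ C, 0 ≤ C ∧ ∀ (J : ℕ) (h σ : ℝ), 0 < h → h * (J + 1) = ℓ → 0 ≤ σ →
      ∀ (φ Φ : Bool → RealGrid J) (U V : Bool → Grid J),
      RegularPair h σ K (fun t => toGrid (φ t)) → RegularPair h σ K U →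
      (∀ t, φ t 0 = Φ t 0) → (∀ t, U t 0 = V t 0) →
      ∀ A D : ℝ, errorSum h (fun t => toGrid (φ t) - toGrid (Φ t)) (fun t => U t - V t) ≤ A →
      errorDiff h (fun t => toGrid (φ t) - toGrid (Φ t)) (fun t => U t - V t) ≤ D →
      (Real.sqrt ℓ + 1) * A ≤ 1 →
      (∀ t, seminormOne h (cutoffProduct δ (φ t) (U t) - cutoffProduct δ (Φ t) (V t))
        ≤ C * A) ∧
      seminormOne h (cutoffProduct δ (φ true) (U true) - cutoffProduct δ (Φ true) (V true) -
        (cutoffProduct δ (φ false) (U false) - cutoffProduct δ (Φ false) (V false)))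
          ≤ C * (D + σ * A) ∧
      (∀ t, seminormOne h (cutoffPotential δ g (U t) - cutoffPotential δ g (V t)) ≤ C * A) ∧
      seminormOne h (cutoffPotential δ g (U true) - cutoffPotential δ g (V true) -
        (cutoffPotential δ g (U false) - cutoffPotential δ g (V false))) ≤ C * (D + σ * A) := by
  obtain ⟨C, hC0, hC⟩ := exists_edge_bound hδ hg hK
  set s0 := Real.sqrt ℓ with hs0
  have hs00 : 0 ≤ s0 := Real.sqrt_nonneg _
  refine ⟨C * (1 + s0) ^ 2, by positivity, ?_⟩
  intro J h σ hh hhℓ hσ φ Φ U V hφ hU hφ0 hU0 A D hA hD hsmall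
  set e : Bool → Grid J := fun t => toGrid (φ t) - toGrid (Φ t) with he
  set ζ : Bool → Grid J := fun t => U t - V t with hζ
  have hA0 : 0 ≤ A := (errorSum_nonneg e ζ).trans hA
  have hD0 : 0 ≤ D := (errorDiff_nonneg e ζ).trans hD
  have n := fun v : Grid J => seminormOne_nonneg (h := h) v
  have hA1 : A ≤ 1 := by nlinarith [mul_nonneg hs00 hA0]
  have hz1 : s0 * A ≤ 1 := by nlinarith
  have sup : ∀ {v : Grid J} {B : ℝ}, v 0 = 0 → seminormOne h v ≤ B → ∀ j, ‖v j‖ ≤ s0 * B :=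
    fun hv hB j => (norm_le_seminormOne hh hhℓ hv j).trans (mul_le_mul_of_nonneg_left hB hs00)
  have e0 : ∀ t, e t 0 = 0 := fun t => by simp [he, toGrid, hφ0 t]
  have ζ0 : ∀ t, ζ t 0 = 0 := fun t => by simp [hζ, hU0 t]
  have eA : ∀ t, seminormOne h (e t) ≤ A := by
    intro t
    refine le_trans ?_ hA
    unfold errorSum
    cases t <;> linarith [n (e false), n (e true), n (ζ false), n (ζ true)]
  have ζA : ∀ t, seminormOne h (ζ t) ≤ A := by
    intro t
    refine le_trans ?_ hA
    unfold errorSum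
    cases t <;> linarith [n (e false), n (e true), n (ζ false), n (ζ true)]
  have eD : seminormOne h (e true - e false) ≤ D := by
    refine le_trans ?_ hD
    unfold errorDiff
    linarith [n (ζ true - ζ false)]
  have ζD : seminormOne h (ζ true - ζ false) ≤ D := by
    refine le_trans ?_ hD
    unfold errorDiff
    linarith [n (e true - e false)]
  -- The error increments of both quantities at both times are added up, since the potential and the
  -- solution must share one set of weights.
  let zx : Fin (J + 1) → ℝ := fun j => ‖gridDiff (e false) j‖ + ‖gridDiff (e true) j‖
    + ‖gridDiff (ζ false) j‖ + ‖gridDiff (ζ true) j‖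
  let zxt : Fin (J + 1) → ℝ := fun j => ‖gridDiff (e true - e false) j‖
    + ‖gridDiff (ζ true - ζ false) j‖
  have hzx : ∀ j, 0 ≤ zx j := fun j => by positivity
  have hzxt : ∀ j, 0 ≤ zxt j := fun j => by positivity
  have Nzx : edgeNorm h zx ≤ A := by
    refine le_trans ?_ hA
    refine (edgeNorm_add_le hh _ _).trans ?_
    unfold errorSum
    rw [seminormOne_eq_edgeNorm hh (ζ true)]
    gcongr
    refine (edgeNorm_add_le hh _ _).trans ?_
    rw [seminormOne_eq_edgeNorm hh (ζ false)]
    gcongr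
    refine (edgeNorm_add_le hh _ _).trans ?_
    rw [seminormOne_eq_edgeNorm hh (e false), seminormOne_eq_edgeNorm hh (e true)]
  have Nzxt : edgeNorm h zxt ≤ D := by
    refine le_trans ?_ hD
    refine (edgeNorm_add_le hh _ _).trans ?_
    unfold errorDiff
    rw [seminormOne_eq_edgeNorm hh (e true - e false), seminormOne_eq_edgeNorm hh (ζ true - ζ false)]
  -- Maximum norms are replaced by seminorms through the Sobolev inequality; the edge increments
  -- remain functions of the edge, as only their sums of squares are controlled.
  let w : Fin (J + 1) → Weights := fun j =>
    errorWeights h σ (s0 * A) (zx j) (s0 * D) (zxt j)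
  have hw : ∀ j, (w j).Admissible := fun j =>
    errorWeights_admissible hh.le hσ (by positivity) hz1 (hzx j) (by positivity) (hzxt j)
  have main := fun j => hC J (w j) (hw j) φ Φ U V j
    (diffBound_of_error hh.le hσ (by positivity) (hzx j) (by positivity) (hzxt j) hK hφ j
      (V := fun t => toGrid (Φ t)) (fun t => sup (e0 t) (eA t))
      (fun t => by
        change ‖gridDiff (e t) j‖ ≤ zx j
        cases t <;> simp only [zx] <;> linarith [norm_nonneg (gridDiff (e false) j),
          norm_nonneg (gridDiff (e true) j), norm_nonneg (gridDiff (ζ false) j),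
          norm_nonneg (gridDiff (ζ true) j)])
      (sup (v := e true - e false) (by simp [e0]) eD)
      (le_add_of_nonneg_right (norm_nonneg _)))
    (diffBound_of_error hh.le hσ (by positivity) (hzx j) (by positivity) (hzxt j) hK hU j
      (V := V) (fun t => sup (ζ0 t) (ζA t))
      (fun t => by
        change ‖gridDiff (ζ t) j‖ ≤ zx j
        cases t <;> simp only [zx] <;> linarith [norm_nonneg (gridDiff (e false) j),
          norm_nonneg (gridDiff (e true) j), norm_nonneg (gridDiff (ζ false) j),
          norm_nonneg (gridDiff (ζ true) j)])
      (sup (v := ζ true - ζ false) (by simp [ζ0]) ζD)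
      (le_add_of_nonneg_left (norm_nonneg _)))
  have fin_xs : ∀ {v : Grid J}, (∀ j, ‖gridDiff v j‖ ≤ C * (w j).xs) →
      seminormOne h v ≤ C * (1 + s0) ^ 2 * A := by
    intro v hv
    refine (seminormOne_le_of_gridDiff_le hh v hv).trans ?_
    simp only [w, errorWeights]
    rw [edgeNorm_const_mul hh hC0, mul_assoc]
    refine mul_le_mul_of_nonneg_left ?_ hC0
    refine (edgeNorm_add_le hh _ _).trans ?_
    rw [edgeNorm_const hh hhℓ (by positivity), ← hs0]
    nlinarith [mul_nonneg hs00 hA0]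
  have fin_xts : ∀ {v : Grid J}, (∀ j, ‖gridDiff v j‖ ≤ C * (w j).xts) →
      seminormOne h v ≤ C * (1 + s0) ^ 2 * (D + σ * A) := by
    intro v hv
    refine (seminormOne_le_of_gridDiff_le hh v hv).trans ?_
    simp only [w, errorWeights]
    rw [edgeNorm_const_mul hh hC0, mul_assoc]
    refine mul_le_mul_of_nonneg_left ?_ hC0
    refine (edgeNorm_add_le hh _ _).trans ?_
    rw [edgeNorm_const hh hhℓ (by positivity), ← hs0]
    have h1 : edgeNorm h (fun j => zxt j + (σ + s0 * D) * zx j) ≤ D + (σ + s0 * D) * A := by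
      refine (edgeNorm_add_le hh _ _).trans ?_
      rw [edgeNorm_const_mul hh (by positivity)]
      gcongr
    -- The only quadratic contribution is made linear by `A ≤ 1`.
    have h2 : s0 * D * A ≤ s0 * D := mul_le_of_le_one_right (by positivity) hA1
    have h3 : 0 ≤ s0 * (σ * A) := by positivity
    calc _ ≤ D + (σ + s0 * D) * A + s0 * (s0 * D + σ * (s0 * A)) := by gcongr
      _ ≤ _ := by nlinarith [mul_nonneg hs00 hD0]
  exact ⟨fun t => fin_xs fun j => (main j).1 t, fin_xts fun j => (main j).2.1,
    fun t => fin_xs fun j => (main j).2.2.1 t, fin_xts fun j => (main j).2.2.2⟩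

end Nonlinear

end RelaxNLS

end

noncomputable section

namespace RelaxNLS

open Finset

/-! ### The discrete Gronwall argument -/

/-- This is `1 / (1 - y) ≤ 1 + 2 y` for `y ≤ 1/2`. -/
theorem le_of_le_add_mul {y p q : ℝ} (hy0 : 0 ≤ y) (hy : y ≤ 1 / 2) (hp : 0 ≤ p)
    (h : q ≤ p + y * q) : q ≤ (1 + 2 * y) * p := by
  nlinarith [mul_nonneg hy0 hp, mul_nonneg (mul_nonneg hy0 hp) (by linarith : 0 ≤ 1 - 2 * y)]

/-- The scalar inequalities that connect the errors of the scheme: `th k`, `e k` and `X k` measure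
the errors of `V^k`, `Φ^{k+1/2}` and of the difference quotient, `B k` the error of the nonlinear
term, `de`, `dB` its two-step differences and `xh` the modified difference quotients. -/
structure ErrorRecursion (C c₁ τ ε : ℝ) (N : ℕ) (X th e B de dB xh : ℕ → ℝ) : Prop where
  X_nonneg : ∀ k, 0 ≤ X k
  th_nonneg : ∀ k, 0 ≤ th k
  e_nonneg : ∀ k, 0 ≤ e k
  th_zero : th 0 ≤ 0
  th_succ : ∀ k < N, th (k + 1) ≤ th k + τ * X k
  e_zero : e 0 ≤ C * ε
  e_one : 1 < N → th 1 ≤ c₁ → e 1 ≤ e 0 + C * (th 1 + ε)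
  e_add_two : ∀ k, k + 2 < N → e (k + 2) ≤ e k + de (k + 2)
  de_le : ∀ k, k + 2 < N → th (k + 1) ≤ c₁ → th (k + 2) ≤ c₁ →
    de (k + 2) ≤ C * τ * (th (k + 2) + th (k + 1) + X (k + 1) + ε)
  crude : ∀ k < N, th (k + 1) ≤ th k + C * τ * (1 + e k + th k + th (k + 1))
  B_le : ∀ k < N, e k ≤ c₁ → th k ≤ c₁ → th (k + 1) ≤ c₁ →
    B k ≤ C * (e k + th k + th (k + 1) + ε)
  dB_le : ∀ k, k + 2 < N → e k ≤ c₁ → e (k + 2) ≤ c₁ → th k ≤ c₁ → th (k + 1) ≤ c₁ →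
    th (k + 2) ≤ c₁ → th (k + 3) ≤ c₁ →
    dB (k + 2) ≤ C * (de (k + 2) + τ * (X (k + 2) + X (k + 1) + X k) +
      τ * (th (k + 3) + th (k + 2) + th (k + 1) + th k + e (k + 2) + e k + ε))
  X_zero : X 0 ≤ B 0 + C * ε
  xh_one : 1 < N → xh 1 ≤ X 0 + C * (B 1 + B 0 + ε)
  xh_add_two : ∀ k, k + 2 < N → xh (k + 2) ≤ xh (k + 1) + dB (k + 2) + C * τ * ε
  X_succ : ∀ k, k + 1 < N → X (k + 1) ≤ xh (k + 1) + B (k + 1) + B k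

namespace ErrorRecursion

variable {C c₁ τ ε : ℝ} {N : ℕ} {X th e B de dB xh : ℕ → ℝ}

/-- The accumulated error. -/
def total (τ ε : ℝ) (X : ℕ → ℝ) (n : ℕ) : ℝ := ε + τ * ∑ l ∈ range n, X l

theorem total_succ (n : ℕ) : total τ ε X (n + 1) = total τ ε X n + τ * X n := by
  simp only [total, sum_range_succ]; ring

theorem total_mono (hτ : 0 ≤ τ) (hX : ∀ k, 0 ≤ X k) : Monotone (total τ ε X) :=
  monotone_nat_of_le_succ fun n => by
    rw [total_succ]; linarith [mul_nonneg hτ (hX n)]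

theorem le_total (hτ : 0 ≤ τ) (hX : ∀ k, 0 ≤ X k) (n : ℕ) : ε ≤ total τ ε X n := by
  have := total_mono (ε := ε) hτ hX (Nat.zero_le n)
  simpa [total] using this

theorem th_le_total (H : ErrorRecursion C c₁ τ ε N X th e B de dB xh) (hε : 0 ≤ ε) :
    ∀ k ≤ N, th k ≤ total τ ε X k := by
  intro k
  induction k with
  | zero => intro _; simp only [total, range_zero, sum_empty]; linarith [H.th_zero]
  | succ k ih =>
    intro hk
    rw [total_succ]
    linarith [H.th_succ k (by omega), ih (by omega)]

/-- The even and the odd indices form two chains, started from `e 0` and `e 1`, along which the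
increments are of order `τ`. The bound involves only `X l` with `l < n`, so `e n` is controlled
before `X n` is. -/
theorem e_le_total (H : ErrorRecursion C c₁ τ ε N X th e B de dB xh) {T : ℝ} (hC : 1 ≤ C)
    (hτ : 0 ≤ τ) (hε : 0 ≤ ε) (hT : N * τ ≤ T) {n : ℕ} (hn : n < N)
    (hth : ∀ k ≤ n, th k ≤ c₁) : e n ≤ (4 * C + 3 * C * T) * total τ ε X n := by
  have hC0 : 0 ≤ C := by linarith
  have mono := total_mono (ε := ε) hτ H.X_nonneg
  have hS : ε ≤ total τ ε X n := le_total hτ H.X_nonneg n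
  set S := total τ ε X n with hSdef
  have hS0 : 0 ≤ S := hε.trans hS
  have thS : ∀ k ≤ n, th k ≤ S := fun k hk =>
    (H.th_le_total hε k (by omega)).trans (mono hk)
  -- Two consecutive indices are carried because the recursion has step two; the last term collects
  -- the summands `τ X`.
  have key : ∀ k, (k ≤ n → e k ≤ 3 * C * S + 3 * C * (k * τ) * S + C * total τ ε X k) ∧
      (k + 1 ≤ n → e (k + 1) ≤ 3 * C * S + 3 * C * ((k + 1 : ℕ) * τ) * S
        + C * total τ ε X (k + 1)) := by
    intro k
    have tn : ∀ m, 0 ≤ total τ ε X m := fun m => hε.trans (le_total hτ H.X_nonneg m)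
    induction k with
    | zero =>
      refine ⟨fun _ => ?_, fun h1 => ?_⟩
      · have := H.e_zero
        have := tn 0
        push_cast
        nlinarith [mul_nonneg hC0 hS0, mul_nonneg hC0 this]
      · have a1 := H.e_zero
        have a2 := H.e_one (by omega) (hth 1 h1)
        have a3 := thS 1 h1
        have a4 : 0 ≤ 3 * C * (((0 + 1 : ℕ) : ℝ) * τ) * S := by positivity
        have a5 := mul_nonneg hC0 (tn 1)
        rw [zero_add]
        nlinarith
    | succ k ih =>
      refine ⟨ih.2, fun h2 => ?_⟩
      have a1 := ih.1 (by omega)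
      have a2 := H.e_add_two k (by omega)
      have a3 := H.de_le k (by omega) (hth _ (by omega)) (hth _ (by omega))
      have a4 := thS (k + 1) (by omega)
      have a5 := thS (k + 2) h2
      have a6 : total τ ε X k + τ * X (k + 1) ≤ total τ ε X (k + 2) := by
        rw [total_succ, total_succ]
        linarith [mul_nonneg hτ (H.X_nonneg k)]
      have a7 : C * τ * (th (k + 2) + th (k + 1) + X (k + 1) + ε) ≤
          C * τ * (3 * S) + C * (τ * X (k + 1)) := by
        have : C * τ * (th (k + 2) + th (k + 1) + ε) ≤ C * τ * (3 * S) :=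
          mul_le_mul_of_nonneg_left (by linarith) (by positivity)
        linarith
      have a8 := mul_le_mul_of_nonneg_left a6 hC0
      have a9 : 0 ≤ 3 * C * τ * S := by positivity
      push_cast at a1 ⊢
      linarith
  have h1 := (key n).1 le_rfl
  have h2 : (n : ℝ) * τ ≤ T := le_trans (mul_le_mul_of_nonneg_right (by exact_mod_cast hn.le) hτ) hT
  have h3 : 3 * C * (n * τ) * S ≤ 3 * C * T * S := by gcongr
  linarith

/-- The modified quotients grow by `dB + C τ ε` per step, and `dB` is `τ` times errors and
neighbouring `X`; summation gives the accumulated error. The true quotient differs from the modified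
one by `B`, which needs no summation. The right-hand side still contains `τ X n`, to be absorbed
later. -/
theorem X_le_total (H : ErrorRecursion C c₁ τ ε N X th e B de dB xh) {T C₂ : ℝ} (hC : 1 ≤ C)
    (hτ : 0 ≤ τ) (hε : 0 ≤ ε) (hT : N * τ ≤ T) (hC₂ : 0 ≤ C₂) {n : ℕ} (hn : n < N)
    (hth : ∀ k ≤ n + 1, th k ≤ c₁) (he : ∀ k ≤ n, e k ≤ c₁)
    (heS : ∀ k ≤ n, e k ≤ C₂ * total τ ε X (n + 1)) :
    X n ≤ (C * (C₂ + 3) * (3 + 2 * C) + 2 * C + (C * (4 * C + 6 + 2 * C₂) + C) * T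
      + 3 * (C * (4 * C + 6 + 2 * C₂))) * total τ ε X (n + 1) := by
  have hC0 : 0 ≤ C := by linarith
  have hT0 : 0 ≤ T := le_trans (by positivity) hT
  have mono := total_mono (ε := ε) hτ H.X_nonneg
  have hS : ε ≤ total τ ε X (n + 1) := le_total hτ H.X_nonneg _
  have tn : ∀ m, 0 ≤ total τ ε X m := fun m => hε.trans (le_total hτ H.X_nonneg m)
  set S := total τ ε X (n + 1) with hSdef
  have hS0 : 0 ≤ S := hε.trans hS
  have thS : ∀ k ≤ n + 1, th k ≤ S := fun k hk =>
    (H.th_le_total hε k (by omega)).trans (mono hk)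
  set C₃ := C * (C₂ + 3) with hC₃
  set C₄ := C * (4 * C + 6 + 2 * C₂) with hC₄
  have hC₃0 : 0 ≤ C₃ := by positivity
  have hC₄0 : 0 ≤ C₄ := by positivity
  have BS : ∀ k ≤ n, B k ≤ C₃ * S := by
    intro k hk
    refine (H.B_le k (by omega) (he k hk) (hth k (by omega)) (hth _ (by omega))).trans ?_
    rw [hC₃, mul_assoc]
    refine mul_le_mul_of_nonneg_left ?_ hC0
    linarith [heS k hk, thS k (by omega), thS (k + 1) (by omega)]
  have dBS : ∀ k, k + 2 ≤ n → dB (k + 2) ≤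
      C₄ * (τ * S) + C₄ * (τ * (X (k + 2) + X (k + 1) + X k)) := by
    intro k hk
    have a1 := H.dB_le k (by omega) (he k (by omega)) (he _ hk) (hth k (by omega))
      (hth _ (by omega)) (hth _ (by omega)) (hth _ (by omega))
    have a2 := H.de_le k (by omega) (hth _ (by omega)) (hth _ (by omega))
    have x0 := H.X_nonneg k
    have x1 := H.X_nonneg (k + 1)
    have x2 := H.X_nonneg (k + 2)
    have t0 := thS k (by omega)
    have t1 := thS (k + 1) (by omega)
    have t2 := thS (k + 2) (by omega)
    have t3 := thS (k + 3) (by omega)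
    have e0 := heS k (by omega)
    have e2 := heS (k + 2) hk
    have b1 : de (k + 2) ≤ τ * (3 * C * S + C * X (k + 1)) := by
      refine a2.trans ?_
      calc _ = τ * (C * (th (k + 2) + th (k + 1) + X (k + 1) + ε)) := by ring
        _ ≤ _ := by
          refine mul_le_mul_of_nonneg_left ?_ hτ
          nlinarith
    have b2 : τ * (th (k + 3) + th (k + 2) + th (k + 1) + th k + e (k + 2) + e k + ε) ≤
        τ * ((5 + 2 * C₂) * S) := mul_le_mul_of_nonneg_left (by linarith) hτ
    refine a1.trans ?_
    calc _ ≤ C * (τ * (3 * C * S + C * X (k + 1)) + τ * (X (k + 2) + X (k + 1) + X k)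
          + τ * ((5 + 2 * C₂) * S)) := by gcongr
      _ = C * τ * ((3 * C + 5 + 2 * C₂) * S + (X (k + 2) + (1 + C) * X (k + 1) + X k)) := by ring
      _ ≤ C * τ * ((4 * C + 6 + 2 * C₂) * S
          + (4 * C + 6 + 2 * C₂) * (X (k + 2) + X (k + 1) + X k)) := by
          refine mul_le_mul_of_nonneg_left (add_le_add ?_ ?_) (by positivity)
          · exact mul_le_mul_of_nonneg_right (by linarith) hS0
          · nlinarith [mul_nonneg hC0 x0, mul_nonneg hC0 x1, mul_nonneg hC0 x2,
              mul_nonneg hC₂ x0, mul_nonneg hC₂ x1, mul_nonneg hC₂ x2]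
      _ = _ := by rw [hC₄]; ring
  have X0 : X 0 ≤ (C₃ + C) * S := by
    linarith [H.X_zero, BS 0 (Nat.zero_le n), mul_le_mul_of_nonneg_left hS hC0]
  -- Three shifted totals appear since each two-step difference involves three consecutive
  -- quotients.
  have xhS : ∀ k, k + 1 ≤ n → xh (k + 1) ≤ (C₃ + C + C * (2 * C₃ + 1)) * S
      + (C₄ + C) * (k * τ) * S + C₄ * (total τ ε X (k + 2) + total τ ε X (k + 1)
        + total τ ε X k) := by
    intro k
    induction k with
    | zero =>
      intro h1
      have a1 := H.xh_one (by omega)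
      have a2 : C * (B 1 + B 0 + ε) ≤ C * ((2 * C₃ + 1) * S) :=
        mul_le_mul_of_nonneg_left (by linarith [BS 0 (by omega), BS 1 h1]) hC0
      have a3 : 0 ≤ C₄ * (total τ ε X 2 + total τ ε X 1 + total τ ε X 0) :=
        mul_nonneg hC₄0 (by linarith [tn 2, tn 1, tn 0])
      simp only [Nat.cast_zero, zero_mul, mul_zero, add_zero, zero_add]
      linarith
    | succ k ih =>
      intro h2
      have a1 := ih (by omega)
      have a2 := H.xh_add_two k (by omega)
      have a3 := dBS k h2
      have a4 : C * τ * ε ≤ C * τ * S := mul_le_mul_of_nonneg_left hS (by positivity)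
      have e1 : total τ ε X (k + 1 + 2) = total τ ε X (k + 2) + τ * X (k + 2) := total_succ _
      have e2 : total τ ε X (k + 1 + 1) = total τ ε X (k + 1) + τ * X (k + 1) := total_succ _
      have e3 : total τ ε X (k + 1) = total τ ε X k + τ * X k := total_succ _
      have a5 : C₄ * (total τ ε X (k + 1 + 2) + total τ ε X (k + 1 + 1) + total τ ε X (k + 1)) =
          C₄ * (total τ ε X (k + 2) + total τ ε X (k + 1) + total τ ε X k)
            + C₄ * (τ * (X (k + 2) + X (k + 1) + X k)) := by
        linear_combination C₄ * e1 + C₄ * e2 + C₄ * e3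
      rw [a5]
      push_cast
      linarith
  have final : X n ≤ C₃ * S + C * S + (C * (2 * C₃ + 1)) * S + (C₄ + C) * T * S + 3 * C₄ * S
      + 2 * C₃ * S := by
    rcases n with _ | m
    · have p1 : 0 ≤ (C * (2 * C₃ + 1)) * S := by positivity
      have p2 : 0 ≤ (C₄ + C) * T * S := by positivity
      have p3 : 0 ≤ 3 * C₄ * S + 2 * C₃ * S := by positivity
      linarith
    · have a1 := H.X_succ m hn
      have a2 := xhS m le_rfl
      have a3 := BS (m + 1) le_rfl
      have a4 := BS m (by omega)
      have a5 : (m : ℝ) * τ ≤ T :=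
        le_trans (mul_le_mul_of_nonneg_right (by exact_mod_cast (by omega : m ≤ N)) hτ) hT
      have a6 : (C₄ + C) * (m * τ) * S ≤ (C₄ + C) * T * S := by gcongr
      have a7 : total τ ε X (m + 2) ≤ S := le_rfl
      have a8 : total τ ε X (m + 1) ≤ S := mono (by omega)
      have a9 : total τ ε X m ≤ S := mono (by omega)
      have a10 : C₄ * (total τ ε X (m + 2) + total τ ε X (m + 1) + total τ ε X m) ≤
          C₄ * (3 * S) := mul_le_mul_of_nonneg_left (by linarith) hC₄0
      linarith
  refine final.trans (le_of_eq ?_)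
  ring

/-- If the step size and the consistency error are small, then the errors are bounded by the
consistency error. -/
theorem exists_bound {C c₁ T : ℝ} (hC : 1 ≤ C) (hT : 0 < T) (hc₁ : 0 < c₁) (hc₁' : c₁ ≤ 1) :
    ∃ τ₀ ε₀ K : ℝ, 0 < τ₀ ∧ 0 < ε₀ ∧ 0 ≤ K ∧ ∀ (N : ℕ) (τ ε : ℝ)
      (X th e B de dB xh : ℕ → ℝ), 0 ≤ τ → τ ≤ τ₀ → N * τ ≤ T → 0 ≤ ε → ε ≤ ε₀ →
      ErrorRecursion C c₁ τ ε N X th e B de dB xh →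
      (∀ k ≤ N, th k ≤ K * ε) ∧ ∀ k < N, e k ≤ K * ε := by
  have hC0 : 0 < C := by linarith
  set C₂ := 4 * C + 3 * C * T with hC₂
  have hC₂0 : 0 ≤ C₂ := by positivity
  set C₆ := C * (C₂ + 3) * (3 + 2 * C) + 2 * C + (C * (4 * C + 6 + 2 * C₂) + C) * T
      + 3 * (C * (4 * C + 6 + 2 * C₂)) with hC₆
  have hC₆0 : 0 < C₆ := by positivity
  set E := Real.exp (2 * C₆ * T) with hE
  have hE0 : 0 < E := Real.exp_pos _
  -- The first bound on `τ` permits absorbing `τ X n`, the second one step of the crude estimate;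
  -- `ε₀` keeps the Gronwall bounds of all errors below `c₁ / 4`.
  refine ⟨min (1 / (2 * C₆)) (c₁ / (12 * C)), c₁ / (4 * E * (1 + C₂)), E * (1 + C₂),
    by positivity, by positivity, by positivity, ?_⟩
  intro N τ ε X th e B de dB xh hτ hτ0 hNτ hε hε0 H
  have hτ1 : C₆ * τ ≤ 1 / 2 := by
    have := hτ0.trans (min_le_left _ _)
    rw [le_div_iff₀ (by positivity)] at this
    linarith
  have hτ2 : C * τ ≤ c₁ / 12 := by
    have := hτ0.trans (min_le_right _ _)
    rw [le_div_iff₀ (by positivity)] at this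
    linarith
  have hε1 : E * ε * (1 + C₂) ≤ c₁ / 4 := by
    rw [le_div_iff₀ (by positivity)] at hε0
    linarith
  have hEε : 0 ≤ E * ε := by positivity
  have mono := total_mono (ε := ε) hτ H.X_nonneg
  have tn : ∀ m, 0 ≤ total τ ε X m := fun m => hε.trans (le_total hτ H.X_nonneg m)
  have pow_le : ∀ n ≤ N, (1 + 2 * (C₆ * τ)) ^ n * ε ≤ E * ε := by
    intro n hn
    refine mul_le_mul_of_nonneg_right ?_ hε
    have h1 : 1 + 2 * (C₆ * τ) ≤ Real.exp (2 * (C₆ * τ)) := by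
      linarith [Real.add_one_le_exp (2 * (C₆ * τ))]
    refine (pow_le_pow_left₀ (by positivity) h1 n).trans ?_
    rw [← Real.exp_nat_mul]
    refine Real.exp_le_exp.2 ?_
    have : (n : ℝ) * τ ≤ T :=
      le_trans (mul_le_mul_of_nonneg_right (by exact_mod_cast hn) hτ) hNτ
    calc (n : ℝ) * (2 * (C₆ * τ)) = 2 * C₆ * (n * τ) := by ring
      _ ≤ _ := by gcongr
  have claim : ∀ n ≤ N, total τ ε X n ≤ (1 + 2 * (C₆ * τ)) ^ n * ε ∧ ∀ k ≤ n, th k ≤ c₁ := by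
    intro n
    induction n with
    | zero =>
      intro _
      refine ⟨by simp [total], fun k hk => ?_⟩
      rw [Nat.le_zero.1 hk]
      linarith [H.th_zero]
    | succ n ih =>
      intro hn
      obtain ⟨i1, i2⟩ := ih (by omega)
      have hZ : total τ ε X n ≤ E * ε := i1.trans (pow_le n (by omega))
      have heZ : ∀ k ≤ n, e k ≤ C₂ * total τ ε X n := fun k hk =>
        (H.e_le_total hC hτ hε hNτ (by omega) (fun m hm => i2 m (by omega))).trans
          (mul_le_mul_of_nonneg_left (mono hk) hC₂0)
      have hec : ∀ k ≤ n, e k ≤ c₁ := fun k hk => by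
        have := mul_le_mul_of_nonneg_left hZ hC₂0
        linarith [heZ k hk]
      have hthn : th n ≤ E * ε := (H.th_le_total hε n (by omega)).trans hZ
      -- The sharp estimates at the new level presuppose smallness there. The crude estimate, which
      -- presupposes nothing, supplies it from the Gronwall bound at level `n`.
      have hth1 : th (n + 1) ≤ c₁ := by
        have a1 := H.crude n (by omega)
        have a2 := hec n le_rfl
        have a3 := i2 n le_rfl
        have a4 := H.th_nonneg (n + 1)
        have a5 := H.th_nonneg n
        have a6 := H.e_nonneg n
        have a7 : 0 ≤ C₂ * (E * ε) := by positivity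
        have a8 : C * τ * (1 + e n + th n + th (n + 1)) ≤ c₁ / 12 * (3 + th (n + 1)) :=
          mul_le_mul hτ2 (by linarith) (by linarith) (by linarith)
        nlinarith
      have hth : ∀ k ≤ n + 1, th k ≤ c₁ := by
        intro k hk
        rcases Nat.lt_or_ge n k with h | h
        · rw [show k = n + 1 by omega]; exact hth1
        · exact i2 k h
      refine ⟨?_, hth⟩
      have hX := H.X_le_total hC hτ hε hNτ hC₂0 (by omega) hth hec
        (fun k hk => (heZ k hk).trans (mul_le_mul_of_nonneg_left (mono (Nat.le_succ n)) hC₂0))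
      rw [← hC₆] at hX
      -- The implicit term `C₆ τ` times the new total is absorbed.
      have hstep : total τ ε X (n + 1) ≤ (1 + 2 * (C₆ * τ)) * total τ ε X n := by
        refine le_of_le_add_mul (by positivity) hτ1 (tn n) ?_
        have := total_succ (τ := τ) (ε := ε) (X := X) n
        have := mul_le_mul_of_nonneg_left hX hτ
        linarith
      refine hstep.trans ?_
      rw [pow_succ']
      rw [mul_assoc]
      exact mul_le_mul_of_nonneg_left i1 (by positivity)
  have bound : ∀ n ≤ N, total τ ε X n ≤ E * ε := fun n hn => (claim n hn).1.trans (pow_le n hn)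
  have hC₂E : 0 ≤ C₂ * (E * ε) := by positivity
  refine ⟨fun k hk => ?_, fun k hk => ?_⟩
  · linarith [H.th_le_total hε k hk, bound k hk]
  · have := H.e_le_total hC hτ hε hNτ hk (claim k hk.le).2
    have := mul_le_mul_of_nonneg_left (bound k hk.le) hC₂0
    linarith

end ErrorRecursion

end RelaxNLS

end

noncomputable section

namespace RelaxNLS

open Set

/-! ### The error equations -/

section ErrorSystem

variable {J : ℕ}

/-- The error with respect to the corrected solution. -/
def solutionError (U η V : ℕ → Grid J) (n : ℕ) : Grid J := U n + η n - V n

/-- The difference quotient of the error. -/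
def errorQuotient (τ : ℝ) (U η V : ℕ → Grid J) (n : ℕ) : Grid J :=
  ((τ⁻¹ : ℝ) : ℂ) • (solutionError U η V (n + 1) - solutionError U η V n)

/-- The error of the potential. -/
def potentialError (φ Φ : ℕ → RealGrid J) (n : ℕ) : Grid J := toGrid (φ n) - toGrid (Φ n)

/-- The average over a time step. -/
def stepAverage (U : ℕ → Grid J) (n : ℕ) : Grid J := (1 / 2 : ℂ) • (U (n + 1) + U n)

/-- The error of the nonlinear term. -/
def productError (δ : ℝ) (φ Φ : ℕ → RealGrid J) (U V : ℕ → Grid J) (n : ℕ) : Grid J :=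
  cutoffProduct δ (φ n) (stepAverage U n) - cutoffProduct δ (Φ n) (stepAverage V n)

/-- The exact data `U`, `φ`, the correction `η`, the residuals `R`, `q` and the approximations `V`,
`Φ` satisfy the error equations of the scheme. -/
structure ErrorSystem (δ : ℝ) (g : ℝ → ℝ) (ℓ h τ M K : ℝ) (N : ℕ) (U V η R q : ℕ → Grid J)
    (φ Φ : ℕ → RealGrid J) : Prop where
  h_pos : 0 < h
  mesh : h * (J + 1) = ℓ
  τ_pos : 0 < τ
  U_vanishes : ∀ n ≤ N, VanishesAtBoundary (U n)
  V_vanishes : ∀ n ≤ N, VanishesAtBoundary (V n)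
  η_vanishes : ∀ n, VanishesAtBoundary (η n)
  R_vanishes : ∀ n < N, VanishesAtBoundary (R n)
  error_zero : solutionError U η V 0 = 0
  η_bound : ∀ n ≤ N, seminormOne h (η n) ≤ M * h ^ 2
  η_lip : ∀ n < N, seminormOne h (η (n + 1) - η n) ≤ M * h ^ 2 * τ
  U_le : ∀ n ≤ N, ∀ j, ‖U n j‖ ≤ δ
  U_regular : ∀ n m, n ≤ m → m ≤ n + 2 → m ≤ N →
    RegularPair h (2 * τ) K (fun t => U (cond t m n))
  φ_regular : ∀ n m, n ≤ m → m ≤ n + 2 → m < N →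
    RegularPair h (2 * τ) K (fun t => toGrid (φ (cond t m n)))
  φ_boundary : ∀ n < N, φ n 0 = Φ n 0
  φ_succ : ∀ n, n + 1 < N → ∀ j,
    ((φ (n + 1) j + φ n j : ℝ) : ℂ) = ((2 * g (‖U (n + 1) j‖ ^ 2) : ℝ) : ℂ) + q (n + 1) j
  Φ_succ : ∀ n, n + 1 < N → ∀ j, Φ (n + 1) j = 2 * g (‖mollifier δ (V (n + 1) j)‖ ^ 2) - Φ n j
  q_bound : ∀ n, n + 1 < N → seminormOne h (q (n + 1)) ≤ M * τ ^ 2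
  q_lip : ∀ n, n + 2 < N → seminormOne h (q (n + 2) - q (n + 1)) ≤ M * τ ^ 3
  step : ∀ n < N, ∀ i : Fin J,
    solutionError U η V (n + 1) (interior i) - solutionError U η V n (interior i) =
      Complex.I * τ * discreteLaplacian h
        ((1 / 2 : ℂ) • (solutionError U η V (n + 1) + solutionError U η V n)) i
      + Complex.I * τ * productError δ φ Φ U V n (interior i) + R n (interior i)
  R_bound : ∀ n < N, seminormOne h (R n) ≤ M * τ * (τ ^ 2 + h ^ 2)
  R_lip : ∀ n, n + 1 < N → seminormOne h (R (n + 1) - R n) ≤ M * τ ^ 2 * (τ ^ 2 + h ^ 2)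
  initial_potential : seminormOne h (potentialError φ Φ 0) ≤ M * (τ ^ 2 + h ^ 2)

theorem mollifier_eq_self {δ : ℝ} {z : ℂ} (hz : ‖z‖ ≤ δ) : mollifier δ z = z := by
  apply Complex.ext
  · rw [mollifier_re, cutoff_of_abs_le ((Complex.abs_re_le_norm z).trans hz)]
  · rw [mollifier_im, cutoff_of_abs_le ((Complex.abs_im_le_norm z).trans hz)]

theorem mollifier_zero {δ : ℝ} (hδ : 0 < δ) : mollifier δ 0 = 0 :=
  mollifier_eq_self (by simpa using hδ.le)

theorem cutoffProduct_vanishes {δ : ℝ} (hδ : 0 < δ) (Φ : RealGrid J) {V : Grid J}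
    (hV : VanishesAtBoundary V) : VanishesAtBoundary (cutoffProduct δ Φ V) := by
  constructor <;> simp [cutoffProduct, hV.1, hV.2, mollifier_zero hδ]

theorem stepAverage_vanishes {V : ℕ → Grid J} {n : ℕ} (h0 : VanishesAtBoundary (V n))
    (h1 : VanishesAtBoundary (V (n + 1))) : VanishesAtBoundary (stepAverage V n) :=
  (h1.add h0).smul _

theorem norm_mollifier_le {δ : ℝ} (hδ : 0 < δ) (z : ℂ) : ‖mollifier δ z‖ ≤ 200 * δ := by
  refine (Complex.norm_le_abs_re_add_abs_im _).trans ?_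
  rw [mollifier_re, mollifier_im]
  linarith [abs_cutoff_le hδ z.re, abs_cutoff_le hδ z.im]

theorem exists_cutoff_lipschitz {δ : ℝ} (hδ : 0 < δ) :
    ∃ M, 0 ≤ M ∧ (∀ x y, |cutoff δ x - cutoff δ y| ≤ M * |x - y|) ∧
      ∀ z w, ‖mollifier δ z - mollifier δ w‖ ≤ 2 * M * ‖z - w‖ := by
  obtain ⟨M, hM0, F₁, F₂, h1, -, -, b1, -⟩ := exists_c2LipOn_cutoff hδ
  have lip : ∀ x y, |cutoff δ x - cutoff δ y| ≤ M * |x - y| := fun x y =>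
    abs_sub_le_of_deriv_le convex_univ h1 b1 (mem_univ _) (mem_univ _)
  refine ⟨M, hM0, lip, fun z w => ?_⟩
  refine (Complex.norm_le_abs_re_add_abs_im _).trans ?_
  rw [Complex.sub_re, Complex.sub_im, mollifier_re, mollifier_re, mollifier_im, mollifier_im]
  have r := Complex.abs_re_le_norm (z - w)
  have i := Complex.abs_im_le_norm (z - w)
  rw [Complex.sub_re] at r
  rw [Complex.sub_im] at i
  linarith [lip z.re w.re, lip z.im w.im, mul_le_mul_of_nonneg_left r hM0,
    mul_le_mul_of_nonneg_left i hM0]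

/-- A bound for the nonlinear term that needs no smallness. -/
theorem exists_cutoffProduct_bound {δ : ℝ} (hδ : 0 < δ) :
    ∃ C, 0 ≤ C ∧ ∀ (J : ℕ) (h : ℝ), 0 < h → ∀ (Φ : RealGrid J) (V : Grid J),
      seminormOne h (cutoffProduct δ Φ V) ≤ C * (seminormOne h (toGrid Φ) + seminormOne h V) := by
  obtain ⟨M, hM0, lip, mlip⟩ := exists_cutoff_lipschitz hδ
  refine ⟨200 * δ * M, by positivity, fun J h hh Φ V => ?_⟩
  refine (seminormOne_le_of_gridDiff_le hh _ (w := fun j => 200 * δ * M *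
    (‖gridDiff (toGrid Φ) j‖ + ‖gridDiff V j‖)) fun j => ?_).trans ?_
  · have e : gridDiff (cutoffProduct δ Φ V) j =
        ((cutoff δ (Φ j.succ) - cutoff δ (Φ j.castSucc) : ℝ) : ℂ) * mollifier δ (V j.succ)
        + (cutoff δ (Φ j.castSucc) : ℂ) *
          (mollifier δ (V j.succ) - mollifier δ (V j.castSucc)) := by
      simp only [gridDiff, cutoffProduct]; push_cast; ring
    have e2 : ‖gridDiff (toGrid Φ) j‖ = |Φ j.succ - Φ j.castSucc| := by
      simp only [gridDiff, toGrid]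
      rw [← Complex.ofReal_sub, Complex.norm_real, Real.norm_eq_abs]
    rw [e, e2]
    refine (norm_add_le _ _).trans ?_
    rw [norm_mul, norm_mul, Complex.norm_real, Complex.norm_real, Real.norm_eq_abs,
      Real.norm_eq_abs]
    calc _ ≤ M * |Φ j.succ - Φ j.castSucc| * (200 * δ) + 100 * δ * (2 * M * ‖gridDiff V j‖) := by
          gcongr
          · exact lip _ _
          · exact norm_mollifier_le hδ _
          · exact abs_cutoff_le hδ _
          · exact mlip _ _
      _ = _ := by ring
  · rw [edgeNorm_const_mul hh (by positivity), seminormOne_eq_edgeNorm hh,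
      seminormOne_eq_edgeNorm hh]
    exact mul_le_mul_of_nonneg_left (edgeNorm_add_le hh _ _) (by positivity)

theorem seminormOne_add_two_le {h : ℝ} (hh : 0 < h) {v v₁ v₂ : Grid J} (e : v = v₁ + v₂) :
    seminormOne h v ≤ seminormOne h v₁ + seminormOne h v₂ := by
  rw [e]; exact seminormOne_add_le hh _ _

theorem RegularPair.stepAverage {h σ K : ℝ} {U₁ U₀ : Bool → Grid J} (h1 : RegularPair h σ K U₁)
    (h0 : RegularPair h σ K U₀) :
    RegularPair h σ K (fun t => (1 / 2 : ℂ) • (U₁ t + U₀ t)) := by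
  have key : ∀ {x y z : ℂ} {B : ℝ}, ‖x‖ ≤ B → ‖y‖ ≤ B → z = 1 / 2 * (x + y) → ‖z‖ ≤ B := by
    intro x y z B hx hy e
    rw [e, norm_mul, show ‖(1 / 2 : ℂ)‖ = 1 / 2 by norm_num]
    linarith [norm_add_le x y]
  constructor
  · intro t j; exact key (h1.bound t j) (h0.bound t j) (by simp)
  · intro t j; exact key (h1.x t j) (h0.x t j) (by simp [gridDiff]; ring)
  · intro j; exact key (h1.t j) (h0.t j) (by simp; ring)
  · intro j; exact key (h1.xt j) (h0.xt j) (by simp [gridDiff]; ring)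

theorem regularPair_zero {h σ K : ℝ} (hh : 0 ≤ h) (hσ : 0 ≤ σ) (hK : 0 ≤ K) :
    RegularPair h σ K (fun _ => toGrid (0 : RealGrid J)) := by
  constructor <;> intros <;> simp [toGrid, gridDiff] <;> positivity

/-! ### Estimates of differences and energy bounds in an error system -/

namespace ErrorSystem

variable {δ : ℝ} {g : ℝ → ℝ} {ℓ h τ M K : ℝ} {N : ℕ} {U V η R q : ℕ → Grid J}
  {φ Φ : ℕ → RealGrid J}

theorem error_vanishes (H : ErrorSystem δ g ℓ h τ M K N U V η R q φ Φ) {n : ℕ} (hn : n ≤ N) :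
    VanishesAtBoundary (solutionError U η V n) :=
  ((H.U_vanishes n hn).add (H.η_vanishes n)).sub (H.V_vanishes n hn)

theorem quotient_vanishes (H : ErrorSystem δ g ℓ h τ M K N U V η R q φ Φ) {n : ℕ} (hn : n < N) :
    VanishesAtBoundary (errorQuotient τ U η V n) :=
  ((H.error_vanishes (by omega)).sub (H.error_vanishes (by omega))).smul _

theorem product_vanishes (H : ErrorSystem δ g ℓ h τ M K N U V η R q φ Φ) (hδ : 0 < δ) {n : ℕ}
    (hn : n < N) : VanishesAtBoundary (productError δ φ Φ U V n) :=
  (cutoffProduct_vanishes hδ _ (stepAverage_vanishes (H.U_vanishes n hn.le)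
    (H.U_vanishes _ hn))).sub (cutoffProduct_vanishes hδ _
    (stepAverage_vanishes (H.V_vanishes n hn.le) (H.V_vanishes _ hn)))

theorem error_succ (H : ErrorSystem δ g ℓ h τ M K N U V η R q φ Φ) (n : ℕ) :
    solutionError U η V (n + 1) =
      solutionError U η V n + (τ : ℂ) • errorQuotient τ U η V n := by
  have : (τ : ℂ) ≠ 0 := by exact_mod_cast H.τ_pos.ne'
  unfold errorQuotient
  rw [smul_smul, Complex.ofReal_inv, mul_inv_cancel₀ this, one_smul]
  abel

theorem seminormOne_error_succ (H : ErrorSystem δ g ℓ h τ M K N U V η R q φ Φ) (n : ℕ) :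
    seminormOne h (solutionError U η V (n + 1)) ≤
      seminormOne h (solutionError U η V n) + τ * seminormOne h (errorQuotient τ U η V n) := by
  rw [H.error_succ n]
  refine (seminormOne_add_le H.h_pos _ _).trans ?_
  rw [seminormOne_smul H.h_pos, Complex.norm_real, Real.norm_of_nonneg H.τ_pos.le]

theorem seminormOne_sub (H : ErrorSystem δ g ℓ h τ M K N U V η R q φ Φ) (hM : 0 ≤ M) {n : ℕ}
    (hn : n ≤ N) : seminormOne h (U n - V n) ≤
      seminormOne h (solutionError U η V n) + M * (τ ^ 2 + h ^ 2) := by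
  have e : U n - V n = solutionError U η V n - η n := by unfold solutionError; abel
  rw [e]
  refine (seminormOne_sub_le H.h_pos _ _).trans ?_
  have := H.η_bound n hn
  nlinarith [mul_nonneg hM (sq_nonneg τ)]

theorem seminormOne_sub_sub (H : ErrorSystem δ g ℓ h τ M K N U V η R q φ Φ) (hM : 0 ≤ M) {n : ℕ}
    (hn : n < N) : seminormOne h (U (n + 1) - V (n + 1) - (U n - V n)) ≤
      τ * seminormOne h (errorQuotient τ U η V n) + τ * (M * (τ ^ 2 + h ^ 2)) := by
  have e : U (n + 1) - V (n + 1) - (U n - V n) =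
      (τ : ℂ) • errorQuotient τ U η V n - (η (n + 1) - η n) := by
    have := H.error_succ n
    rw [← sub_eq_iff_eq_add'] at this
    rw [← this]
    unfold solutionError; abel
  rw [e]
  refine (seminormOne_sub_le H.h_pos _ _).trans ?_
  rw [seminormOne_smul H.h_pos, Complex.norm_real, Real.norm_of_nonneg H.τ_pos.le]
  have := H.η_lip n hn
  have h0 := H.τ_pos
  nlinarith [mul_nonneg (mul_nonneg hM h0.le) (sq_nonneg τ)]

theorem stepAverage_sub (U V : ℕ → Grid J) (n : ℕ) : stepAverage U n - stepAverage V n =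
    (1 / 2 : ℂ) • (U (n + 1) - V (n + 1)) + (1 / 2 : ℂ) • (U n - V n) := by
  unfold stepAverage
  module

theorem seminormOne_half_smul {h : ℝ} (hh : 0 < h) (v : Grid J) :
    seminormOne h ((1 / 2 : ℂ) • v) = 1 / 2 * seminormOne h v := by
  rw [seminormOne_smul hh]; norm_num

theorem seminormOne_average (H : ErrorSystem δ g ℓ h τ M K N U V η R q φ Φ) (hM : 0 ≤ M) {n : ℕ}
    (hn : n < N) : seminormOne h (stepAverage U n - stepAverage V n) ≤
      1 / 2 * (seminormOne h (solutionError U η V (n + 1)) + seminormOne h (solutionError U η V n))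
        + M * (τ ^ 2 + h ^ 2) := by
  refine (seminormOne_add_two_le H.h_pos (stepAverage_sub U V n)).trans ?_
  rw [seminormOne_half_smul H.h_pos, seminormOne_half_smul H.h_pos]
  linarith [H.seminormOne_sub hM hn.le, H.seminormOne_sub hM (n := n + 1) hn]

theorem seminormOne_average_sub (H : ErrorSystem δ g ℓ h τ M K N U V η R q φ Φ) (hM : 0 ≤ M)
    {n : ℕ} (hn : n + 2 < N) :
    seminormOne h (stepAverage U (n + 2) - stepAverage V (n + 2)
      - (stepAverage U n - stepAverage V n)) ≤
      τ * (seminormOne h (errorQuotient τ U η V (n + 2))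
        + seminormOne h (errorQuotient τ U η V (n + 1))
        + seminormOne h (errorQuotient τ U η V n)) + τ * (2 * M * (τ ^ 2 + h ^ 2)) := by
  -- The averages telescope into three consecutive increments with weights `1/2`, `1`, `1/2`.
  have e : stepAverage U (n + 2) - stepAverage V (n + 2) - (stepAverage U n - stepAverage V n) =
      (1 / 2 : ℂ) • (U (n + 3) - V (n + 3) - (U (n + 2) - V (n + 2))) +
      ((U (n + 2) - V (n + 2) - (U (n + 1) - V (n + 1))) +
      (1 / 2 : ℂ) • (U (n + 1) - V (n + 1) - (U n - V n))) := by
    unfold stepAverage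
    module
  refine (seminormOne_add_two_le H.h_pos e).trans ?_
  have h1 := seminormOne_add_le H.h_pos (U (n + 2) - V (n + 2) - (U (n + 1) - V (n + 1)))
    ((1 / 2 : ℂ) • (U (n + 1) - V (n + 1) - (U n - V n)))
  rw [seminormOne_half_smul H.h_pos] at h1 ⊢
  have a0 := H.seminormOne_sub_sub hM (n := n) (by omega)
  have a1 := H.seminormOne_sub_sub hM (n := n + 1) (by omega)
  have a2 := H.seminormOne_sub_sub hM (n := n + 2) (by omega)
  have n0 := mul_nonneg H.τ_pos.le (seminormOne_nonneg (h := h) (errorQuotient τ U η V n))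
  have n2 := mul_nonneg H.τ_pos.le (seminormOne_nonneg (h := h) (errorQuotient τ U η V (n + 2)))
  simp only [show n + 2 + 1 = n + 3 from rfl, show n + 1 + 1 = n + 2 from rfl] at a1 a2
  linarith

/-- The cutoff is inactive on the exact solution because `|u| ≤ δ`. -/
theorem cutoffPotential_exact (H : ErrorSystem δ g ℓ h τ M K N U V η R q φ Φ) {n : ℕ} (hn : n ≤ N)
    (j : Fin (J + 2)) : cutoffPotential δ g (U n) j = (g (‖U n j‖ ^ 2) : ℂ) := by
  rw [cutoffPotential, mollifier_eq_self (H.U_le n hn j)]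

theorem potentialError_succ (H : ErrorSystem δ g ℓ h τ M K N U V η R q φ Φ) {n : ℕ}
    (hn : n + 1 < N) : potentialError φ Φ (n + 1) = (2 : ℂ) • (cutoffPotential δ g (U (n + 1))
      - cutoffPotential δ g (V (n + 1))) + q (n + 1) - potentialError φ Φ n := by
  ext j
  have h1 := H.φ_succ n hn j
  have h2 := H.Φ_succ n hn j
  simp only [potentialError, toGrid, Pi.sub_apply, Pi.add_apply, Pi.smul_apply, smul_eq_mul]
  rw [H.cutoffPotential_exact (by omega), cutoffPotential, h2]
  push_cast at h1 ⊢
  linear_combination h1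

/-- Subtracting consecutive relaxation relations removes the alternating sign. The right-hand side
consists of one-step time differences, which are of order `τ`, in contrast to `e (n+1) - e n`. -/
theorem potentialError_add_two_sub (H : ErrorSystem δ g ℓ h τ M K N U V η R q φ Φ) {n : ℕ}
    (hn : n + 2 < N) : potentialError φ Φ (n + 2) - potentialError φ Φ n =
      (2 : ℂ) • (cutoffPotential δ g (U (n + 2)) - cutoffPotential δ g (V (n + 2)) -
        (cutoffPotential δ g (U (n + 1)) - cutoffPotential δ g (V (n + 1))))
      + (q (n + 2) - q (n + 1)) := by
  rw [H.potentialError_succ (n := n + 1) hn, H.potentialError_succ (n := n) (by omega)]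
  module

/-- The energy estimate for one step of the error equation. -/
theorem seminormOne_error_step (H : ErrorSystem δ g ℓ h τ M K N U V η R q φ Φ) (hδ : 0 < δ) {n : ℕ}
    (hn : n < N) : seminormOne h (solutionError U η V (n + 1)) ≤
      seminormOne h (solutionError U η V n) + τ * seminormOne h (productError δ φ Φ U V n)
        + τ * (M * (τ ^ 2 + h ^ 2)) := by
  have key := energy_inequality H.h_pos (H.error_vanishes (n := n + 1) hn)
    (H.error_vanishes hn.le) (((H.product_vanishes hδ hn).smul (Complex.I * τ)).add
    (H.R_vanishes n hn)) (τ / 2) fun i => ?_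
  · refine key.trans ?_
    have := seminormOne_add_le H.h_pos ((Complex.I * (τ : ℂ)) • productError δ φ Φ U V n) (R n)
    rw [seminormOne_smul H.h_pos, norm_I_mul_ofReal H.τ_pos.le] at this
    linarith [H.R_bound n hn]
  · rw [H.step n hn i, discreteLaplacian_smul]
    simp only [Pi.add_apply, Pi.smul_apply, smul_eq_mul]
    push_cast
    ring

/-- The energy estimate for the differences of two consecutive steps. -/
theorem seminormOne_quotient_step (H : ErrorSystem δ g ℓ h τ M K N U V η R q φ Φ) (hδ : 0 < δ)
    {n : ℕ} (hn : n + 1 < N) :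
    seminormOne h (errorQuotient τ U η V (n + 1) - (Complex.I / 2) •
      (productError δ φ Φ U V (n + 1) - productError δ φ Φ U V n)) ≤
    seminormOne h (errorQuotient τ U η V n + (Complex.I / 2) •
      (productError δ φ Φ U V (n + 1) - productError δ φ Φ U V n))
      + M * τ * (τ ^ 2 + h ^ 2) := by
  have hτ := H.τ_pos
  have hτc : (τ : ℂ) ≠ 0 := by exact_mod_cast hτ.ne'
  -- The source is the one-step difference of `B`, not multiplied by `τ`; a direct energy estimate
  -- could not be summed over the steps.
  have key := energy_inequality_split H.h_pos (H.quotient_vanishes hn)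
    (H.quotient_vanishes (n := n) (by omega))
    ((H.product_vanishes hδ hn).sub (H.product_vanishes hδ (n := n) (by omega)))
    (((H.R_vanishes _ hn).sub (H.R_vanishes n (by omega))).smul ((τ⁻¹ : ℝ) : ℂ)) (τ / 2)
    fun i => ?_
  · refine key.trans ?_
    rw [seminormOne_smul H.h_pos, Complex.norm_real, Real.norm_of_nonneg (by positivity)]
    have := mul_le_mul_of_nonneg_left (H.R_lip n hn) (inv_pos.2 hτ).le
    have e : τ⁻¹ * (M * τ ^ 2 * (τ ^ 2 + h ^ 2)) = M * τ * (τ ^ 2 + h ^ 2) := by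
      field_simp
    linarith
  · have s1 := H.step (n + 1) hn i
    have s0 := H.step n (by omega) i
    rw [discreteLaplacian_smul, discreteLaplacian_add] at s1 s0
    simp only [errorQuotient, discreteLaplacian_add, discreteLaplacian_smul,
      discreteLaplacian_sub, Pi.sub_apply, Pi.smul_apply, smul_eq_mul]
    push_cast
    have e : (τ : ℂ)⁻¹ * τ = 1 := inv_mul_cancel₀ hτc
    linear_combination (τ : ℂ)⁻¹ * s1 - (τ : ℂ)⁻¹ * s0
      + Complex.I * (productError δ φ Φ U V (n + 1) (interior i)
        - productError δ φ Φ U V n (interior i)) * e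

end ErrorSystem

end ErrorSystem

end RelaxNLS

end

noncomputable section

namespace RelaxNLS

open Set

/-! ### From the error equations to the scalar recursion -/

section Recursion

/-- `C` is a constant for the estimates of `exists_nonlinear_bound`. -/
def NonlinearBound (δ : ℝ) (g : ℝ → ℝ) (ℓ K C : ℝ) : Prop :=
  ∀ (J : ℕ) (h σ : ℝ), 0 < h → h * (J + 1) = ℓ → 0 ≤ σ →
    ∀ (φ Φ : Bool → RealGrid J) (U V : Bool → Grid J),
    RegularPair h σ K (fun t => toGrid (φ t)) → RegularPair h σ K U →
    (∀ t, φ t 0 = Φ t 0) → (∀ t, U t 0 = V t 0) →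
    ∀ A D : ℝ, errorSum h (fun t => toGrid (φ t) - toGrid (Φ t)) (fun t => U t - V t) ≤ A →
    errorDiff h (fun t => toGrid (φ t) - toGrid (Φ t)) (fun t => U t - V t) ≤ D →
    (Real.sqrt ℓ + 1) * A ≤ 1 →
    (∀ t, seminormOne h (cutoffProduct δ (φ t) (U t) - cutoffProduct δ (Φ t) (V t))
      ≤ C * A) ∧
    seminormOne h (cutoffProduct δ (φ true) (U true) - cutoffProduct δ (Φ true) (V true) -
      (cutoffProduct δ (φ false) (U false) - cutoffProduct δ (Φ false) (V false)))
        ≤ C * (D + σ * A) ∧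
    (∀ t, seminormOne h (cutoffPotential δ g (U t) - cutoffPotential δ g (V t)) ≤ C * A) ∧
    seminormOne h (cutoffPotential δ g (U true) - cutoffPotential δ g (V true) -
      (cutoffPotential δ g (U false) - cutoffPotential δ g (V false))) ≤ C * (D + σ * A)

/-- `C` is a constant for the estimate of `exists_cutoffProduct_bound`. -/
def CutoffProductBound (δ C : ℝ) : Prop :=
  ∀ (J : ℕ) (h : ℝ), 0 < h → ∀ (Φ : RealGrid J) (V : Grid J),
    seminormOne h (cutoffProduct δ Φ V) ≤ C * (seminormOne h (toGrid Φ) + seminormOne h V)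

namespace ErrorSystem

variable {J : ℕ} {δ : ℝ} {g : ℝ → ℝ} {ℓ h τ M K C : ℝ} {N : ℕ} {U V η R q : ℕ → Grid J}
  {φ Φ : ℕ → RealGrid J}

/-- Data constant in the time direction are inserted into the cube estimate, so the error increment
`D` is zero. -/
theorem seminormOne_product_le (H : ErrorSystem δ g ℓ h τ M K N U V η R q φ Φ) (hM : 0 ≤ M)
    (hC : NonlinearBound δ g ℓ K C) {n : ℕ} (hn : n < N) {A : ℝ}
    (hA : 2 * seminormOne h (potentialError φ Φ n) + seminormOne h (solutionError U η V (n + 1))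
      + seminormOne h (solutionError U η V n) + 2 * (M * (τ ^ 2 + h ^ 2)) ≤ A)
    (hs : (Real.sqrt ℓ + 1) * A ≤ 1) :
    seminormOne h (productError δ φ Φ U V n) ≤ C * A := by
  have hreg : RegularPair h (2 * τ) K (fun _ => stepAverage U n) := by
    simpa only [Bool.cond_self, stepAverage] using
      (H.U_regular (n + 1) (n + 1) le_rfl (by omega) hn).stepAverage
      (H.U_regular n n le_rfl (by omega) hn.le)
  have hφ : RegularPair h (2 * τ) K (fun _ : Bool => toGrid (φ n)) := by
    simpa using H.φ_regular n n le_rfl (by omega) hn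
  refine (hC J h (2 * τ) H.h_pos H.mesh (by linarith [H.τ_pos]) (fun _ => φ n) (fun _ => Φ n)
    (fun _ => stepAverage U n) (fun _ => stepAverage V n) hφ hreg (fun _ => H.φ_boundary n hn)
    (fun _ => ?_) A 0 (le_trans ?_ hA) ?_ hs).1 true
  · rw [(stepAverage_vanishes (H.U_vanishes n hn.le) (H.U_vanishes _ hn)).1,
      (stepAverage_vanishes (H.V_vanishes n hn.le) (H.V_vanishes _ hn)).1]
  · have := H.seminormOne_average hM hn
    simp only [errorSum]
    simp only [potentialError]
    linarith
  · simp [errorDiff, seminormOne_zero]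

/-- The two faces of the cube are the levels `n` and `n + 2`, whence the time distance `2 τ`. -/
theorem seminormOne_product_sub_le (H : ErrorSystem δ g ℓ h τ M K N U V η R q φ Φ) (hM : 0 ≤ M)
    (hC : NonlinearBound δ g ℓ K C) (hC0 : 0 ≤ C) {n : ℕ} (hn : n + 2 < N) {A : ℝ}
    (hA : seminormOne h (potentialError φ Φ (n + 2)) + seminormOne h (potentialError φ Φ n)
      + 1 / 2 * (seminormOne h (solutionError U η V (n + 3))
        + seminormOne h (solutionError U η V (n + 2)) + seminormOne h (solutionError U η V (n + 1))
        + seminormOne h (solutionError U η V n)) + 2 * (M * (τ ^ 2 + h ^ 2)) ≤ A)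
    (hs : (Real.sqrt ℓ + 1) * A ≤ 1) :
    seminormOne h (productError δ φ Φ U V (n + 2) - productError δ φ Φ U V n) ≤
      C * (seminormOne h (potentialError φ Φ (n + 2) - potentialError φ Φ n) +
        τ * (seminormOne h (errorQuotient τ U η V (n + 2))
        + seminormOne h (errorQuotient τ U η V (n + 1))
        + seminormOne h (errorQuotient τ U η V n)) + τ * (2 * M * (τ ^ 2 + h ^ 2))
        + 2 * τ * A) := by
  have hreg := (H.U_regular (n + 1) (n + 3) (by omega) (by omega) hn).stepAverage
      (H.U_regular n (n + 2) (by omega) (by omega) (by omega))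
  have hreg' : RegularPair h (2 * τ) K (fun t => stepAverage U (cond t (n + 2) n)) := by
    convert hreg using 2 with t
    cases t <;> rfl
  refine (hC J h (2 * τ) H.h_pos H.mesh (by linarith [H.τ_pos]) (fun t => φ (cond t (n + 2) n))
    (fun t => Φ (cond t (n + 2) n)) (fun t => stepAverage U (cond t (n + 2) n))
    (fun t => stepAverage V (cond t (n + 2) n)) (H.φ_regular n (n + 2) (by omega) le_rfl hn) hreg'
    (fun t => H.φ_boundary _ (by cases t <;> simp only [cond] <;> omega)) (fun t => ?_) A
    _ (le_trans ?_ hA) le_rfl hs).2.1.trans ?_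
  · have h1 : cond t (n + 2) n < N := by cases t <;> simp only [cond] <;> omega
    rw [(stepAverage_vanishes (H.U_vanishes _ h1.le) (H.U_vanishes _ h1)).1,
      (stepAverage_vanishes (H.V_vanishes _ h1.le) (H.V_vanishes _ h1)).1]
  · have h1 := H.seminormOne_average hM (n := n) (by omega)
    have h2 := H.seminormOne_average hM (n := n + 2) hn
    simp only [errorSum, cond]
    simp only [potentialError]
    linarith
  · refine mul_le_mul_of_nonneg_left ?_ hC0
    have h1 := H.seminormOne_average_sub hM hn
    simp only [errorDiff, cond, potentialError]
    linarith

/-- The potentials do not enter this part of the nonlinear bound and are set to zero. -/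
theorem seminormOne_potential_le (H : ErrorSystem δ g ℓ h τ M K N U V η R q φ Φ) (hM : 0 ≤ M)
    (hK : 0 ≤ K) (hC : NonlinearBound δ g ℓ K C) {n : ℕ} (hn : n ≤ N) {A : ℝ}
    (hA : 2 * seminormOne h (solutionError U η V n) + 2 * (M * (τ ^ 2 + h ^ 2)) ≤ A)
    (hs : (Real.sqrt ℓ + 1) * A ≤ 1) :
    seminormOne h (cutoffPotential δ g (U n) - cutoffPotential δ g (V n)) ≤ C * A := by
  have hτ : 0 ≤ 2 * τ := by linarith [H.τ_pos]
  refine (hC J h (2 * τ) H.h_pos H.mesh hτ (fun _ => 0) (fun _ => 0)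
    (fun _ => U n) (fun _ => V n) (regularPair_zero H.h_pos.le hτ hK)
    (by simpa using H.U_regular n n le_rfl (by omega) hn) (fun _ => rfl)
    (fun _ => ?_) A 0 (le_trans ?_ hA) ?_ hs).2.2.1 true
  · rw [(H.U_vanishes n hn).1, (H.V_vanishes n hn).1]
  · have := H.seminormOne_sub hM hn
    simp only [errorSum, sub_self, seminormOne_zero]
    linarith
  · simp [errorDiff, seminormOne_zero]

theorem seminormOne_potential_sub_le (H : ErrorSystem δ g ℓ h τ M K N U V η R q φ Φ) (hM : 0 ≤ M)
    (hK : 0 ≤ K) (hC : NonlinearBound δ g ℓ K C) (hC0 : 0 ≤ C) {n : ℕ} (hn : n < N) {A : ℝ}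
    (hA : seminormOne h (solutionError U η V (n + 1)) + seminormOne h (solutionError U η V n)
      + 2 * (M * (τ ^ 2 + h ^ 2)) ≤ A) (hs : (Real.sqrt ℓ + 1) * A ≤ 1) :
    seminormOne h (cutoffPotential δ g (U (n + 1)) - cutoffPotential δ g (V (n + 1)) -
        (cutoffPotential δ g (U n) - cutoffPotential δ g (V n))) ≤
      C * (τ * seminormOne h (errorQuotient τ U η V n) + τ * (M * (τ ^ 2 + h ^ 2))
        + 2 * τ * A) := by
  have hτ : 0 ≤ 2 * τ := by linarith [H.τ_pos]
  refine (hC J h (2 * τ) H.h_pos H.mesh hτ (fun _ => 0) (fun _ => 0)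
    (fun t => U (cond t (n + 1) n)) (fun t => V (cond t (n + 1) n))
    (regularPair_zero H.h_pos.le hτ hK) (H.U_regular n (n + 1) (by omega) (by omega) hn)
    (fun _ => rfl) (fun t => ?_) A _ (le_trans ?_ hA) le_rfl hs).2.2.2.trans ?_
  · have h1 : cond t (n + 1) n ≤ N := by cases t <;> simp only [cond] <;> omega
    rw [(H.U_vanishes _ h1).1, (H.V_vanishes _ h1).1]
  · have h1 := H.seminormOne_sub hM hn.le
    have h2 := H.seminormOne_sub hM (n := n + 1) hn
    simp only [errorSum, cond, sub_self, seminormOne_zero]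
    linarith
  · refine mul_le_mul_of_nonneg_left ?_ hC0
    have h1 := H.seminormOne_sub_sub hM hn
    simp only [errorDiff, cond, sub_self, seminormOne_zero]
    linarith

/-- A bound for the product error that needs no smallness. -/
theorem seminormOne_product_le_crude (H : ErrorSystem δ g ℓ h τ M K N U V η R q φ Φ) (hM : 0 ≤ M)
    (hK : 0 ≤ K) (hC : CutoffProductBound δ C) (hC0 : 0 ≤ C) {n : ℕ} (hn : n < N) :
    seminormOne h (productError δ φ Φ U V n) ≤ C * (4 * (Real.sqrt ℓ * K)
      + seminormOne h (potentialError φ Φ n) + seminormOne h (solutionError U η V (n + 1))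
      + seminormOne h (solutionError U η V n) + M * (τ ^ 2 + h ^ 2)) := by
  have hφ : seminormOne h (toGrid (φ n)) ≤ Real.sqrt ℓ * K :=
    seminormOne_le_const H.h_pos H.mesh hK
      ((H.φ_regular n n le_rfl (by omega) hn).x true)
  have hU : seminormOne h (stepAverage U n) ≤ Real.sqrt ℓ * K :=
    seminormOne_le_const H.h_pos H.mesh hK
      (((H.U_regular (n + 1) (n + 1) le_rfl (by omega) hn).stepAverage
      (H.U_regular n n le_rfl (by omega) hn.le)).x true)
  have hΦ : seminormOne h (toGrid (Φ n)) ≤ seminormOne h (toGrid (φ n)) +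
      seminormOne h (potentialError φ Φ n) := by
    have := seminormOne_sub_le H.h_pos (toGrid (φ n)) (potentialError φ Φ n)
    rwa [potentialError, sub_sub_cancel] at this
  have hV : seminormOne h (stepAverage V n) ≤ seminormOne h (stepAverage U n) +
      seminormOne h (stepAverage U n - stepAverage V n) := by
    have := seminormOne_sub_le H.h_pos (stepAverage U n) (stepAverage U n - stepAverage V n)
    rwa [sub_sub_cancel] at this
  have hA := H.seminormOne_average hM hn
  refine (seminormOne_sub_le H.h_pos _ _).trans ((add_le_add (hC J h H.h_pos _ _)
    (hC J h H.h_pos _ _)).trans ?_)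
  rw [← mul_add]
  refine mul_le_mul_of_nonneg_left ?_ hC0
  have z := seminormOne_nonneg (h := h) (solutionError U η V n)
  have z' := seminormOne_nonneg (h := h) (solutionError U η V (n + 1))
  linarith

/-- An error system yields a scalar recursion. -/
theorem errorRecursion {C₀ C₁ c₁ : ℝ} (H : ErrorSystem δ g ℓ h τ M K N U V η R q φ Φ)
    (hδ : 0 < δ) (hM : 0 ≤ M) (hK : 0 ≤ K) (h₀ : NonlinearBound δ g ℓ K C₀) (hC₀ : 0 ≤ C₀)
    (h₁ : CutoffProductBound δ C₁) (hC₁ : 0 ≤ C₁) (hN : 0 < N)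
    (hc₁ : c₁ = 1 / (8 * (Real.sqrt ℓ + 1)))
    (hε : τ ^ 2 + h ^ 2 ≤ 1 / (4 * (M + 1) * (Real.sqrt ℓ + 1)))
    (hC : C = 1 + M + 10 * (C₀ * (1 + M)) + C₁ * (4 * (Real.sqrt ℓ * K) + 1 + M)) :
    ErrorRecursion C c₁ τ (τ ^ 2 + h ^ 2) N
      (fun k => seminormOne h (errorQuotient τ U η V k))
      (fun k => seminormOne h (solutionError U η V k))
      (fun k => seminormOne h (potentialError φ Φ k))
      (fun k => seminormOne h (productError δ φ Φ U V k))
      (fun k => seminormOne h (potentialError φ Φ k - potentialError φ Φ (k - 2)))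
      (fun k => seminormOne h (productError δ φ Φ U V k - productError δ φ Φ U V (k - 2)))
      (fun k => seminormOne h (errorQuotient τ U η V k - (Complex.I / 2) •
        (productError δ φ Φ U V k - productError δ φ Φ U V (k - 1)))) := by
  have hτ := H.τ_pos
  have hh := H.h_pos
  have s0 : 0 ≤ Real.sqrt ℓ := Real.sqrt_nonneg _
  set ε := τ ^ 2 + h ^ 2 with hεdef
  have hε0 : 0 ≤ ε := by positivity
  have hε' : ε * (4 * (M + 1) * (Real.sqrt ℓ + 1)) ≤ 1 := by
    rwa [le_div_iff₀ (by positivity)] at hε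
  have hε1 : ε ≤ 1 := by
    nlinarith [mul_nonneg hε0 hM, mul_nonneg hε0 s0, mul_nonneg (mul_nonneg hε0 hM) s0]
  have hτ1 : τ ≤ 1 := by nlinarith [sq_nonneg h]
  have hτε : τ ^ 2 ≤ ε := by rw [hεdef]; linarith [sq_nonneg h]
  have hMε : (Real.sqrt ℓ + 1) * (2 * (M * ε)) ≤ 1 / 2 := by
    nlinarith [mul_nonneg hε0 s0]
  have hcs : (Real.sqrt ℓ + 1) * (4 * c₁) = 1 / 2 := by rw [hc₁]; field_simp; norm_num
  -- Every error sum used below has this form: at most four errors bounded by `c₁`, and the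
  -- contribution of `η`. Each part accounts for `1/2`.
  have small : ∀ {A : ℝ}, A ≤ 4 * c₁ + 2 * (M * ε) → (Real.sqrt ℓ + 1) * A ≤ 1 := by
    intro A hA
    have := mul_le_mul_of_nonneg_left hA (by linarith : 0 ≤ Real.sqrt ℓ + 1)
    linarith
  have hc10 : 0 ≤ c₁ := by rw [hc₁]; positivity
  have hMC₀ := mul_nonneg hC₀ hM
  have hs1 : 0 ≤ C₁ * (4 * (Real.sqrt ℓ * K)) := by positivity
  have hMC₁ := mul_nonneg hC₁ hM
  -- The factor `10` is dictated by the `ε` term in the two-step difference of the potential error,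
  -- `2 C₀ (M + 4 M)`.
  have k1 : ∀ {Y : ℝ}, 0 ≤ Y → 10 * (C₀ * Y) ≤ C * Y := fun {Y} hY => by
    have : 10 * C₀ ≤ C := by rw [hC]; linarith
    nlinarith [mul_le_mul_of_nonneg_right this hY]
  have k2 : ∀ {Y : ℝ}, 0 ≤ Y → 10 * (C₀ * M * Y) + M * Y ≤ C * Y := fun {Y} hY => by
    have : 10 * (C₀ * M) + M ≤ C := by rw [hC]; linarith
    nlinarith [mul_le_mul_of_nonneg_right this hY]
  have k3 : ∀ {Y : ℝ}, 0 ≤ Y → C₁ * Y ≤ C * Y := fun {Y} hY =>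
    mul_le_mul_of_nonneg_right (by rw [hC]; linarith) hY
  have k4 : ∀ {Y : ℝ}, 0 ≤ Y → (C₁ * (4 * (Real.sqrt ℓ * K)) + C₁ * M + M) * Y ≤ C * Y :=
    fun {Y} hY => mul_le_mul_of_nonneg_right (by rw [hC]; linarith) hY
  have k5 : ∀ {Y : ℝ}, 0 ≤ Y → Y ≤ C * Y := fun {Y} hY => by
    have : 1 ≤ C := by rw [hC]; linarith
    nlinarith [mul_le_mul_of_nonneg_right this hY]
  have nn := fun v : Grid J => seminormOne_nonneg (h := h) v
  have nτ := fun v : Grid J => mul_nonneg hτ.le (nn v)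
  have nε : 0 ≤ τ * ε := mul_nonneg hτ.le hε0
  have hMC : ∀ {Y : ℝ}, 0 ≤ Y → M * Y ≤ C * Y := fun {Y} hY =>
    mul_le_mul_of_nonneg_right (by rw [hC]; linarith) hY
  constructor
  · exact fun k => nn _
  · exact fun k => nn _
  · exact fun k => nn _
  · simp [H.error_zero, seminormOne_zero]
  · exact fun k _ => H.seminormOne_error_succ k
  · exact H.initial_potential.trans (hMC hε0)
  · intro h1N h1c
    have e := H.potentialError_succ (n := 0) h1N
    simp only [zero_add] at e
    have a := H.seminormOne_potential_le hM hK h₀ (n := 1) h1N.le le_rfl (small (by linarith))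
    have b1 := seminormOne_sub_le hh ((2 : ℂ) • (cutoffPotential δ g (U 1)
      - cutoffPotential δ g (V 1)) + q 1) (potentialError φ Φ 0)
    have b2 := seminormOne_add_le hh ((2 : ℂ) • (cutoffPotential δ g (U 1)
      - cutoffPotential δ g (V 1))) (q 1)
    rw [seminormOne_smul hh, show ‖(2 : ℂ)‖ = 2 by norm_num] at b2
    have b3 := H.q_bound 0 h1N
    have b4 := mul_le_mul_of_nonneg_left hτε hM
    rw [← e] at b1
    have c1 := k1 (nn (solutionError U η V 1))
    have c2 := k2 hε0
    have c3 := mul_nonneg hC₀ (nn (solutionError U η V 1))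
    have c4 := mul_nonneg hMC₀ hε0
    simp only [zero_add] at b3
    linarith
  · intro k _
    have := seminormOne_add_le hh (potentialError φ Φ k)
      (potentialError φ Φ (k + 2) - potentialError φ Φ k)
    rwa [add_sub_cancel] at this
  · intro k hk t1 t2
    -- The two-step differences are used only at indices `k + 2`, and the modified quotients only at
    -- `k + 1`, so the truncated subtractions are genuine.
    simp only [Nat.add_sub_cancel]
    have a := H.seminormOne_potential_sub_le hM hK h₀ hC₀ (n := k + 1) (by omega) le_rfl
      (small (by linarith))
    have b := seminormOne_add_two_le hh (H.potentialError_add_two_sub hk)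
    rw [seminormOne_smul hh, show ‖(2 : ℂ)‖ = 2 by norm_num] at b
    have b3 := H.q_lip k hk
    have b4 := mul_le_mul_of_nonneg_left hτε (mul_nonneg hM hτ.le)
    have c1 := k1 (nτ (solutionError U η V (k + 1)))
    have c2 := k1 (nτ (solutionError U η V (k + 2)))
    have c3 := k1 (nτ (errorQuotient τ U η V (k + 1)))
    have c4 := k2 nε
    have d1 := mul_nonneg hC₀ (nτ (solutionError U η V (k + 1)))
    have d2 := mul_nonneg hC₀ (nτ (solutionError U η V (k + 2)))
    have d3 := mul_nonneg hC₀ (nτ (errorQuotient τ U η V (k + 1)))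
    have d4 := mul_nonneg hMC₀ nε
    simp only [show k + 1 + 1 = k + 2 from rfl] at a
    linarith
  · intro k hk
    have a := H.seminormOne_error_step hδ hk
    have b := mul_le_mul_of_nonneg_left (H.seminormOne_product_le_crude hM hK h₁ hC₁ hk) hτ.le
    have c1 := k3 (nτ (solutionError U η V (k + 1)))
    have c2 := k3 (nτ (solutionError U η V k))
    have c3 := k3 (nτ (potentialError φ Φ k))
    have c4 := k4 hτ.le
    have c5 := mul_le_mul_of_nonneg_left hε1 (mul_nonneg hM hτ.le)
    have c6 := mul_le_mul_of_nonneg_left hε1 (mul_nonneg hMC₁ hτ.le)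
    linarith
  · intro k hk t1 t2 t3
    have a := H.seminormOne_product_le hM h₀ hk le_rfl (small (by linarith))
    have c1 := k1 (nn (solutionError U η V (k + 1)))
    have c2 := k1 (nn (solutionError U η V k))
    have c3 := k1 (nn (potentialError φ Φ k))
    have c4 := k2 hε0
    have d1 := mul_nonneg hC₀ (nn (solutionError U η V (k + 1)))
    have d2 := mul_nonneg hC₀ (nn (solutionError U η V k))
    have d3 := mul_nonneg hC₀ (nn (potentialError φ Φ k))
    have d4 := mul_nonneg hMC₀ hε0
    have d5 := mul_nonneg hM hε0
    linarith
  · intro k hk t1 t2 t3 t4 t5 t6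
    simp only [Nat.add_sub_cancel]
    have a := H.seminormOne_product_sub_le hM h₀ hC₀ hk le_rfl (small (by linarith))
    have c1 := k1 (nτ (solutionError U η V (k + 3)))
    have c2 := k1 (nτ (solutionError U η V (k + 2)))
    have c3 := k1 (nτ (solutionError U η V (k + 1)))
    have c4 := k1 (nτ (solutionError U η V k))
    have c5 := k1 (nτ (potentialError φ Φ (k + 2)))
    have c6 := k1 (nτ (potentialError φ Φ k))
    have c7 := k1 (nτ (errorQuotient τ U η V (k + 2)))
    have c8 := k1 (nτ (errorQuotient τ U η V (k + 1)))
    have c9 := k1 (nτ (errorQuotient τ U η V k))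
    have c10 := k1 (nn (potentialError φ Φ (k + 2) - potentialError φ Φ k))
    have c11 := k2 nε
    have d1 := mul_nonneg hC₀ (nτ (solutionError U η V (k + 3)))
    have d2 := mul_nonneg hC₀ (nτ (solutionError U η V (k + 2)))
    have d3 := mul_nonneg hC₀ (nτ (solutionError U η V (k + 1)))
    have d4 := mul_nonneg hC₀ (nτ (solutionError U η V k))
    have d5 := mul_nonneg hC₀ (nτ (potentialError φ Φ (k + 2)))
    have d6 := mul_nonneg hC₀ (nτ (potentialError φ Φ k))
    have d7 := mul_nonneg hC₀ (nτ (errorQuotient τ U η V (k + 2)))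
    have d8 := mul_nonneg hC₀ (nτ (errorQuotient τ U η V (k + 1)))
    have d9 := mul_nonneg hC₀ (nτ (errorQuotient τ U η V k))
    have d10 := mul_nonneg hC₀ (nn (potentialError φ Φ (k + 2) - potentialError φ Φ k))
    have d11 := mul_nonneg hMC₀ nε
    have d12 := mul_nonneg hM nε
    linarith
  -- The corrected initial error is zero, so the first quotient is `τ⁻¹` times the first error, and
  -- the energy estimate provides the factor `τ`.
  · have a := H.seminormOne_error_step hδ hN
    rw [H.error_zero, seminormOne_zero] at a
    have e : seminormOne h (errorQuotient τ U η V 0) =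
        τ⁻¹ * seminormOne h (solutionError U η V 1) := by
      rw [errorQuotient, H.error_zero, sub_zero, seminormOne_smul hh, Complex.norm_real,
        Real.norm_of_nonneg (by positivity)]
    have b := mul_le_mul_of_nonneg_left a (inv_pos.2 hτ).le
    have e2 : τ⁻¹ * (0 + τ * seminormOne h (productError δ φ Φ U V 0) + τ * (M * ε)) =
        seminormOne h (productError δ φ Φ U V 0) + M * ε := by field_simp; ring
    simp only [zero_add] at b e2
    have := hMC hε0
    linarith
  · intro hk
    have a := H.seminormOne_quotient_step hδ (n := 0) hk
    have b := seminormOne_add_le hh (errorQuotient τ U η V 0) ((Complex.I / 2) •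
      (productError δ φ Φ U V 1 - productError δ φ Φ U V 0))
    rw [seminormOne_smul hh, show ‖Complex.I / 2‖ = 1 / 2 by simp] at b
    have c := seminormOne_sub_le hh (productError δ φ Φ U V 1) (productError δ φ Φ U V 0)
    have c1 := k5 (nn (productError δ φ Φ U V 1))
    have c2 := k5 (nn (productError δ φ Φ U V 0))
    have c3 := hMC hε0
    have c4 := mul_le_mul_of_nonneg_right hτ1 (mul_nonneg hM hε0)
    have d1 := nn (productError δ φ Φ U V 1)
    have d2 := nn (productError δ φ Φ U V 0)
    simp only [zero_add, Nat.sub_self] at a b c ⊢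
    linarith
  · intro k hk
    have a := H.seminormOne_quotient_step hδ (n := k + 1) hk
    -- The half source left at the old time level and the one contained in the previous modified
    -- quotient add up to a two-step difference.
    have e : errorQuotient τ U η V (k + 1) + (Complex.I / 2) •
        (productError δ φ Φ U V (k + 1 + 1) - productError δ φ Φ U V (k + 1)) =
        (errorQuotient τ U η V (k + 1) - (Complex.I / 2) •
        (productError δ φ Φ U V (k + 1) - productError δ φ Φ U V k)) + (Complex.I / 2) •
        (productError δ φ Φ U V (k + 2) - productError δ φ Φ U V k) := by
      module
    have b := seminormOne_add_two_le hh e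
    rw [seminormOne_smul hh, show ‖Complex.I / 2‖ = 1 / 2 by simp] at b
    have c := hMC nε
    have d := nn (productError δ φ Φ U V (k + 2) - productError δ φ Φ U V k)
    simp only [Nat.add_sub_cancel, show k + 2 - 1 = k + 1 from rfl,
      show k + 1 + 1 = k + 2 from rfl] at a b ⊢
    linarith
  · intro k hk
    have e : errorQuotient τ U η V (k + 1) =
        (errorQuotient τ U η V (k + 1) - (Complex.I / 2) •
        (productError δ φ Φ U V (k + 1) - productError δ φ Φ U V k)) + (Complex.I / 2) •
        (productError δ φ Φ U V (k + 1) - productError δ φ Φ U V k) := by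
      module
    have b := seminormOne_add_two_le hh e
    rw [seminormOne_smul hh, show ‖Complex.I / 2‖ = 1 / 2 by simp] at b
    have c := seminormOne_sub_le hh (productError δ φ Φ U V (k + 1)) (productError δ φ Φ U V k)
    have d1 := nn (productError δ φ Φ U V (k + 1))
    have d2 := nn (productError δ φ Φ U V k)
    simp only [Nat.add_sub_cancel]
    linarith

/-- Error bounds for small mesh widths. -/
theorem exists_bound (hδ : 0 < δ) (hg : ContDiffOn ℝ 3 g (Ici 0)) (hM : 0 ≤ M) (hK : 0 ≤ K)
    {T : ℝ} (hT : 0 < T) : ∃ τ₀ ε₀ B, 0 < τ₀ ∧ 0 < ε₀ ∧ 0 ≤ B ∧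
      ∀ (J : ℕ) (h τ : ℝ) (N : ℕ) (U V η R q : ℕ → Grid J) (φ Φ : ℕ → RealGrid J),
      0 < N → τ ≤ τ₀ → N * τ ≤ T → τ ^ 2 + h ^ 2 ≤ ε₀ →
      ErrorSystem δ g ℓ h τ M K N U V η R q φ Φ →
      (∀ n ≤ N, seminormOne h (solutionError U η V n) ≤ B * (τ ^ 2 + h ^ 2)) ∧
      ∀ n < N, seminormOne h (potentialError φ Φ n) ≤ B * (τ ^ 2 + h ^ 2) := by
  obtain ⟨C₀, hC₀, h₀⟩ := exists_nonlinear_bound (ℓ := ℓ) hδ hg hK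
  obtain ⟨C₁, hC₁, h₁⟩ := exists_cutoffProduct_bound hδ
  have s0 : 0 ≤ Real.sqrt ℓ := Real.sqrt_nonneg _
  obtain ⟨τ₀, ε₀, B, hτ₀, hε₀, hB, key⟩ := ErrorRecursion.exists_bound
    (C := 1 + M + 10 * (C₀ * (1 + M)) + C₁ * (4 * (Real.sqrt ℓ * K) + 1 + M))
    (c₁ := 1 / (8 * (Real.sqrt ℓ + 1)))
    (by
      have : 0 ≤ 10 * (C₀ * (1 + M)) + C₁ * (4 * (Real.sqrt ℓ * K) + 1 + M) := by positivity
      linarith) hT (by positivity) (by rw [div_le_one (by positivity)]; linarith)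
  refine ⟨τ₀, min ε₀ (1 / (4 * (M + 1) * (Real.sqrt ℓ + 1))), B, hτ₀,
    lt_min hε₀ (by positivity), hB, ?_⟩
  intro J h τ N U V η R q φ Φ hN hτ hNτ hε H
  exact key N τ (τ ^ 2 + h ^ 2) _ _ _ _ _ _ _ H.τ_pos.le hτ hNτ (by positivity)
    (hε.trans (min_le_left _ _)) (H.errorRecursion hδ hM hK h₀ hC₀ h₁ hC₁ hN rfl
    (hε.trans (min_le_right _ _)) rfl)

end ErrorSystem

end Recursion

end RelaxNLS

end

noncomputable section

namespace RelaxNLS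

open Set

/-! ### The scheme and the exact solution form an error system -/

section Scheme

variable {T a b : ℝ} {g : ℝ → ℝ} {f : ℝ → ℝ → ℂ} {u₀ : ℝ → ℂ} {u : ℝ → ℝ → ℂ} {δ : ℝ} {N J : ℕ}

theorem timeStep_pos (hT : 0 < T) (hN : 1 ≤ N) : 0 < timeStep T N := by
  have : (0 : ℝ) < N := by exact_mod_cast hN
  unfold timeStep
  positivity

theorem mul_timeStep (T : ℝ) (hN : 1 ≤ N) : N * timeStep T N = T := by
  have : (N : ℝ) ≠ 0 := by exact_mod_cast (by omega : N ≠ 0)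
  unfold timeStep
  field_simp

theorem timeNode_zero (T : ℝ) (N : ℕ) : timeNode T N 0 = 0 := by simp [timeNode]

theorem timeNode_succ (T : ℝ) (N n : ℕ) :
    timeNode T N (n + 1) = timeNode T N n + timeStep T N := by
  simp only [timeNode]; push_cast; ring

theorem timeNode_mem (hT : 0 < T) (hN : 1 ≤ N) {n : ℕ} (hn : n ≤ N) :
    timeNode T N n ∈ Icc 0 T := by
  have h1 := (timeStep_pos hT hN).le
  have h2 : (n : ℝ) ≤ N := by exact_mod_cast hn
  refine ⟨by unfold timeNode; positivity, ?_⟩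
  have := mul_le_mul_of_nonneg_right h2 h1
  rwa [mul_timeStep T hN] at this

theorem midNode_zero (T : ℝ) (N : ℕ) : midNode T N 0 = timeStep T N / 2 := by
  simp [midNode, timeNode]

theorem midNode_mem (hT : 0 < T) (hN : 1 ≤ N) {n : ℕ} (hn : n < N) : midNode T N n ∈ Icc 0 T := by
  have h1 := timeNode_mem hT hN hn.le
  have h2 := timeNode_mem hT hN (n := n + 1) hn
  have h3 := timeStep_pos hT hN
  rw [timeNode_succ] at h2
  unfold midNode
  exact ⟨by linarith [h1.1], by linarith [h2.2]⟩

theorem abs_timeNode_sub_le (hT : 0 < T) (hN : 1 ≤ N) {n m : ℕ} (h1 : n ≤ m) (h2 : m ≤ n + 2) :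
    |timeNode T N m - timeNode T N n| ≤ 2 * timeStep T N := by
  have h0 := timeStep_pos hT hN
  have c1 : (n : ℝ) ≤ m := by exact_mod_cast h1
  have c2 : (m : ℝ) ≤ n + 2 := by exact_mod_cast h2
  have e : timeNode T N m - timeNode T N n = (m - n) * timeStep T N := by unfold timeNode; ring
  rw [e, abs_of_nonneg (mul_nonneg (by linarith) h0.le)]
  exact mul_le_mul_of_nonneg_right (by linarith) h0.le

theorem RegularOn.regularPair {K : ℝ} {F : ℝ → ℝ → ℂ} (hF : RegularOn T a b K F) (hab : a < b)
    {t : Bool → ℝ} {σ : ℝ} (ht : ∀ i, t i ∈ Icc 0 T) (hσ : |t true - t false| ≤ σ) :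
    RegularPair (meshWidth a b J) σ K (fun i => restrict a b J (F (t i))) where
  bound i j := hF.bound _ (ht i) _ (spaceNode_mem hab j)
  x i j := norm_gridDiff_restrict_le hab (hF.lip_x _ (ht i)) j
  t j := (hF.lip_t _ (ht true) _ (ht false) _ (spaceNode_mem hab j)).trans
    (mul_le_mul_of_nonneg_left hσ hF.nonneg)
  xt j := norm_gridDiff_restrict_le (z := fun x => F (t true) x - F (t false) x) hab
    (fun x hx y hy => (hF.mixed _ (ht true) _ (ht false) x hx y hy).trans
      (mul_le_mul_of_nonneg_right (mul_le_mul_of_nonneg_left hσ hF.nonneg) (abs_nonneg _))) j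

/-- Product rule combined with the Sobolev inequality. The half step is linear in the approximation,
so this replaces the nonlinear bound and requires no smallness. -/
theorem seminormOne_mul_le {h ℓ K : ℝ} (hh : 0 < h) (hℓ : h * (J + 1) = ℓ) (hK : 0 ≤ K)
    {p v : Grid J} (hp : ∀ j, ‖p j‖ ≤ K) (hp' : ∀ j, ‖gridDiff p j‖ ≤ h * K) (hv : v 0 = 0) :
    seminormOne h (p * v) ≤ K * (1 + ℓ) * seminormOne h v := by
  have hℓ0 : 0 ≤ ℓ := by rw [← hℓ]; positivity
  have hS := seminormOne_nonneg (h := h) v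
  refine (seminormOne_le_of_gridDiff_le hh _ (w := fun j => K * ‖gridDiff v j‖ +
    h * (K * (Real.sqrt ℓ * seminormOne h v))) fun j => ?_).trans ?_
  · have e : gridDiff (p * v) j = p j.succ * gridDiff v j + gridDiff p j * v j.castSucc := by
      simp only [gridDiff, Pi.mul_apply]; ring
    rw [e]
    refine (norm_add_le _ _).trans ?_
    rw [norm_mul, norm_mul]
    have h1 := hp j.succ
    have h2 := hp' j
    have h3 := norm_le_seminormOne hh hℓ hv j.castSucc
    calc _ ≤ K * ‖gridDiff v j‖ + h * K * (Real.sqrt ℓ * seminormOne h v) := by gcongr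
      _ = _ := by ring
  · refine (edgeNorm_add_le hh _ _).trans ?_
    rw [edgeNorm_const_mul hh hK, edgeNorm_const hh hℓ (by positivity),
      ← seminormOne_eq_edgeNorm hh]
    have := Real.mul_self_sqrt hℓ0
    have e : Real.sqrt ℓ * (K * (Real.sqrt ℓ * seminormOne h v)) =
      K * (Real.sqrt ℓ * Real.sqrt ℓ) * seminormOne h v := by ring
    rw [e, this]
    exact le_of_eq (by ring)

variable {Vhalf : Grid J} {V : ℕ → Grid J} {Φ : ℕ → RealGrid J} {M K C₀ : ℝ} {η : ℝ → Grid J}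
  {R : ℝ → ℝ → Grid J} {R₀ : ℝ → Grid J}

/-- The potential as a complex-valued function. -/
def complexPotential (g : ℝ → ℝ) (u : ℝ → ℝ → ℂ) (t x : ℝ) : ℂ := (potential g u t x : ℂ)

theorem Setting.smooth_complexPotential (H : Setting T a b g f u₀ u δ) :
    SmoothOn T a b 5 (complexPotential g u) :=
  Complex.ofRealCLM.contDiff.comp_contDiffOn H.smooth_potential

theorem Setting.vanishesAtBoundary_u (H : Setting T a b g f u₀ u δ) {t : ℝ} (ht : t ∈ Icc 0 T) :
    VanishesAtBoundary (restrict a b J (u t)) :=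
  vanishesAtBoundary_restrict (H.hsol.boundary t ht).1 (H.hsol.boundary t ht).2

/-- Both functions have discrete Laplacian `u₀''`, so uniqueness applies: the initial value of the
scheme is precisely the corrected exact one. -/
theorem Setting.corrected_zero (H : Setting T a b g f u₀ u δ)
    (hc : IsCorrection T a b g f u J M η R R₀)
    (S : IsModifiedScheme T a b g f u₀ δ N J Vhalf V Φ) : corrected a b u η 0 - V 0 = 0 := by
  have h0 : (0 : ℝ) ∈ Icc 0 T := ⟨le_rfl, H.hT.le⟩
  refine eq_zero_of_discreteLaplacian_eq_zero (meshWidth_pos H.hab J)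
    (((H.vanishesAtBoundary_u h0).add (hc.vanishes 0)).sub S.initial.1) fun i => ?_
  rw [discreteLaplacian_sub, hc.laplacian, S.initial.2, dx_dx_eq_iteratedDerivWithin,
    iteratedDerivWithin_congr (f := fun y => u 0 y) (g := u₀) (fun x hx => H.hsol.initial x hx)
    (spaceNode_mem H.hab _), sub_self]

/-- The error of the half step. -/
theorem Setting.seminormOne_half_le (H : Setting T a b g f u₀ u δ) (hM : 0 ≤ M)
    (hc : IsCorrection T a b g f u J M η R R₀) (hN : 1 ≤ N)
    (S : IsModifiedScheme T a b g f u₀ δ N J Vhalf V Φ)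
    (hK : RegularOn T a b K (complexPotential g u)) (hτ1 : timeStep T N ≤ 1)
    (hτK : timeStep T N * (K * (1 + (b - a))) ≤ 1) :
    seminormOne (meshWidth a b J) (restrict a b J (u (midNode T N 0)) - Vhalf) ≤
      5 * M * (timeStep T N ^ 2 + meshWidth a b J ^ 2) := by
  have hh := meshWidth_pos H.hab J
  have hτ := timeStep_pos H.hT hN
  have m0 : (0 : ℝ) ∈ Icc 0 T := ⟨le_rfl, H.hT.le⟩
  have mh := midNode_mem H.hT hN (n := 0) (by omega)
  have hmesh := meshWidth_mul a b J
  have hs := midNode_zero T N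
  have ht0 := timeNode_zero T N
  have hhalf := S.half_step
  rw [ht0, hs] at hhalf
  rw [hs] at mh ⊢
  have hinit : ∀ x ∈ Icc a b, u 0 x = u₀ x := H.hsol.initial
  have hz := H.corrected_zero hc S
  set τ := timeStep T N
  set h := meshWidth a b J
  set s := τ / 2 with hsdef
  have hs0 : 0 < s := by positivity
  set θ : Grid J := corrected a b u η s - Vhalf with hθ
  set ζh : Grid J := restrict a b J (u s) - Vhalf with hζh
  set ζ0 : Grid J := restrict a b J (u 0) - V 0 with hζ0
  have e1 : ζh = θ - η s := by rw [hζh, hθ, corrected]; abel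
  have e0 : ζ0 = -η 0 := by
    have : restrict a b J (u 0) = V 0 - η 0 := by
      rw [corrected, sub_eq_zero] at hz; rw [← hz]; abel
    rw [hζ0, this]; abel
  have vh : VanishesAtBoundary ζh := (H.vanishesAtBoundary_u mh).sub S.boundary_half
  have v0 : VanishesAtBoundary ζ0 := (H.vanishesAtBoundary_u m0).sub S.initial.1
  have vθ : VanishesAtBoundary θ :=
    ((H.vanishesAtBoundary_u mh).add (hc.vanishes s)).sub S.boundary_half
  set w : Grid J := (1 / 2 : ℂ) • (ζh + ζ0) with hw
  have vw : VanishesAtBoundary w := (vh.add v0).smul _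
  set p : Grid J := restrict a b J (complexPotential g u 0) * w with hp
  have vp : VanishesAtBoundary p := by constructor <;> simp [hp, vw.1, vw.2]
  have b1 : seminormOne h p ≤ K * (1 + (b - a)) * seminormOne h w :=
    seminormOne_mul_le hh hmesh hK.nonneg (fun j => hK.bound 0 m0 _ (spaceNode_mem H.hab j))
      (norm_gridDiff_restrict_le H.hab (hK.lip_x 0 m0)) vw.1
  -- The old level is zero because the corrected initial error vanishes.
  have key := energy_inequality hh vθ vanishesAtBoundary_zero
    ((vp.smul (Complex.I * (s : ℂ))).add (hc.start_vanishes s hs0.le mh.2)) (s / 2) fun i => ?_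
  · rw [seminormOne_zero, zero_add] at key
    have b2 := seminormOne_add_le hh ((Complex.I * (s : ℂ)) • p) (R₀ s)
    rw [seminormOne_smul hh, norm_I_mul_ofReal hs0.le] at b2
    have b3 := hc.start_bound s hs0.le mh.2
    have b4 : seminormOne h w ≤ 1 / 2 * (seminormOne h ζh + seminormOne h ζ0) := by
      rw [hw, ErrorSystem.seminormOne_half_smul hh]
      exact mul_le_mul_of_nonneg_left (seminormOne_add_le hh _ _) (by norm_num)
    have b5 : seminormOne h ζh ≤ seminormOne h θ + M * h ^ 2 := by
      rw [e1]; exact (seminormOne_sub_le hh _ _).trans (by linarith [hc.bound s mh])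
    have b6 : seminormOne h ζ0 ≤ M * h ^ 2 := by
      rw [e0, seminormOne_neg hh]; exact hc.bound 0 m0
    have nθ := seminormOne_nonneg (h := h) θ
    have nw := seminormOne_nonneg (h := h) w
    -- The restriction on `τ` enters here; the error of the new level contained in `w` is thereby
    -- absorbed.
    have b7 : s * seminormOne h p ≤ 1 / 2 * seminormOne h w := by
      have := mul_le_mul_of_nonneg_left b1 hs0.le
      have h2 := mul_le_mul_of_nonneg_right hτK nw
      have e : s * (K * (1 + (b - a)) * seminormOne h w) =
        1 / 2 * (τ * (K * (1 + (b - a))) * seminormOne h w) := by rw [hsdef]; ring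
      linarith
    have b8 : M * s * (s + h ^ 2) ≤ M * (τ ^ 2 + h ^ 2) := by
      have h1 : s * (s + h ^ 2) ≤ τ ^ 2 + h ^ 2 := by
        rw [hsdef]
        nlinarith [mul_le_mul_of_nonneg_right hτ1 (sq_nonneg h)]
      have := mul_le_mul_of_nonneg_left h1 hM
      linarith
    have n1 : 0 ≤ M * h ^ 2 := by positivity
    have n2 : 0 ≤ M * τ ^ 2 := by positivity
    linarith
  · have s1 := hc.start_eq s hs0.le mh.2 i
    have s2 := hhalf i
    have hx := spaceNode_mem H.hab (interior i)
    rw [← hinit _ hx] at s2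
    have e3 : (fun j => (Vhalf j + V 0 j) / 2) = (1 / 2 : ℂ) • (Vhalf + V 0) := by
      ext j; simp; ring
    have e4 : discreteLaplacian h (corrected a b u η 0) i = discreteLaplacian h (V 0) i := by
      rw [sub_eq_zero.1 hz]
    have e5 : corrected a b u η 0 (interior i) = V 0 (interior i) := by rw [sub_eq_zero.1 hz]
    rw [e3] at s2
    rw [discreteLaplacian_smul, discreteLaplacian_add] at s1 s2
    rw [add_zero, hθ, discreteLaplacian_sub]
    simp only [hp, hw, hζh, hζ0, Pi.add_apply, Pi.sub_apply, Pi.smul_apply, Pi.mul_apply,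
      Pi.zero_apply, smul_eq_mul, restrict, complexPotential, potential] at s1 s2 ⊢
    push_cast at s1 s2 ⊢
    linear_combination s1 - s2 + e5
      + Complex.I * s * (1 / 2) * e4

end Scheme

end RelaxNLS

end

noncomputable section

namespace RelaxNLS

open Set

/-! ### The error system of the scheme and convergence on fine meshes -/

section Scheme

variable {T a b : ℝ} {g : ℝ → ℝ} {f : ℝ → ℝ → ℂ} {u₀ : ℝ → ℂ} {u : ℝ → ℝ → ℂ} {δ : ℝ} {N J : ℕ}
  {Vhalf : Grid J} {V : ℕ → Grid J} {Φ : ℕ → RealGrid J} {M K C₀ : ℝ} {η : ℝ → Grid J}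
  {R : ℝ → ℝ → Grid J} {R₀ : ℝ → Grid J}

/-- The exact potential at the intermediate time nodes. -/
def exactPotential (T a b : ℝ) (g : ℝ → ℝ) (u : ℝ → ℝ → ℂ) (N J n : ℕ) : RealGrid J :=
  fun j => potential g u (midNode T N n) (spaceNode a b J j)

/-- At the end point both potentials equal `g 0`, which the relaxation `Φ ↦ 2 g 0 - Φ` preserves.
The potential error thus vanishes there, as the Sobolev inequality requires. -/
theorem Setting.exactPotential_boundary (H : Setting T a b g f u₀ u δ) (hN : 1 ≤ N)
    (S : IsModifiedScheme T a b g f u₀ δ N J Vhalf V Φ) {n : ℕ} (hn : n < N) :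
    exactPotential T a b g u N J n 0 = Φ n 0 := by
  have h1 : exactPotential T a b g u N J n 0 = g 0 := by
    simp only [exactPotential, potential, spaceNode_zero,
      (H.hsol.boundary _ (midNode_mem H.hT hN hn)).1]
    simp
  rw [h1]
  clear h1
  induction n with
  | zero => rw [S.phi_zero, S.boundary_half.1, mollifier_zero H.hδ]; simp
  | succ n ih =>
    rw [S.phi_succ n hn, (S.boundary _ hn.le).1, mollifier_zero H.hδ, ← ih (by omega)]
    simp; ring

/-- The two initial potentials are the same function of `u` and of `Vhalf`, so the second order of
the half step is inherited. -/
theorem Setting.seminormOne_initial_potential_le (H : Setting T a b g f u₀ u δ) (hM : 0 ≤ M)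
    (hc : IsCorrection T a b g f u J M η R R₀) (hN : 1 ≤ N)
    (S : IsModifiedScheme T a b g f u₀ δ N J Vhalf V Φ) (hu : RegularOn T a b K u)
    (hK : RegularOn T a b K (complexPotential g u)) (hτ1 : timeStep T N ≤ 1)
    (hτK : timeStep T N * (K * (1 + (b - a))) ≤ 1) (hC : NonlinearBound δ g (b - a) K C₀)
    (hε : (Real.sqrt (b - a) + 1) * (10 * M * (timeStep T N ^ 2 + meshWidth a b J ^ 2)) ≤ 1) :
    seminormOne (meshWidth a b J) (potentialError (exactPotential T a b g u N J) Φ 0) ≤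
      C₀ * (10 * M * (timeStep T N ^ 2 + meshWidth a b J ^ 2)) := by
  have hh := meshWidth_pos H.hab J
  have mh := midNode_mem H.hT hN (n := 0) (by omega)
  have e : potentialError (exactPotential T a b g u N J) Φ 0 =
      cutoffPotential δ g (restrict a b J (u (midNode T N 0))) - cutoffPotential δ g Vhalf := by
    ext j
    simp only [potentialError, toGrid, exactPotential, Pi.sub_apply, cutoffPotential, S.phi_zero,
      restrict, potential]
    rw [mollifier_eq_self (H.hδu _ mh _ (spaceNode_mem H.hab j))]
  rw [e]
  have := H.seminormOne_half_le hM hc hN S hK hτ1 hτK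
  refine (hC J _ 0 hh (meshWidth_mul a b J) le_rfl (fun _ => 0) (fun _ => 0)
    (fun _ => restrict a b J (u (midNode T N 0))) (fun _ => Vhalf)
    (regularPair_zero hh.le le_rfl hK.nonneg)
    (hu.regularPair (t := fun _ => midNode T N 0) H.hab (fun _ => mh) (by simp)) (fun _ => rfl)
    (fun _ => ?_) _ 0 ?_ ?_ hε).2.2.1 true
  · rw [S.boundary_half.1, (H.vanishesAtBoundary_u mh).1]
  · simp only [errorSum, sub_self, seminormOne_zero]
    linarith
  · simp [errorDiff, seminormOne_zero]

theorem Setting.errorSystem (H : Setting T a b g f u₀ u δ) (hM : 0 ≤ M)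
    (hc : IsCorrection T a b g f u J M η R R₀) (hN : 1 ≤ N)
    (S : IsModifiedScheme T a b g f u₀ δ N J Vhalf V Φ) (hu : RegularOn T a b K u)
    (hK : RegularOn T a b K (complexPotential g u)) (hτ1 : timeStep T N ≤ 1)
    (hτK : timeStep T N * (K * (1 + (b - a))) ≤ 1) (hC : NonlinearBound δ g (b - a) K C₀)
    (hε : (Real.sqrt (b - a) + 1) * (10 * M * (timeStep T N ^ 2 + meshWidth a b J ^ 2)) ≤ 1)
    {A M' : ℝ} (hA0 : 0 ≤ A)
    (hA : ∀ r t, 0 ≤ r → 0 ≤ t - r → t + r ≤ T → ∀ x ∈ Icc a b, ∀ y ∈ Icc a b,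
      ‖secondDiff (complexPotential g u) r t x‖ ≤ A * r ^ 2 ∧
      ‖secondDiff (complexPotential g u) r t x - secondDiff (complexPotential g u) r t y‖ ≤
        A * r ^ 2 * |x - y| ∧
      ∀ σ, 0 ≤ σ → σ + t + r ≤ T →
        ‖secondDiff (complexPotential g u) r (σ + t) x
          - secondDiff (complexPotential g u) r t x‖ ≤ A * r ^ 2 * σ ∧
        ‖secondDiff (complexPotential g u) r (σ + t) x
          - secondDiff (complexPotential g u) r (σ + t) y -
          (secondDiff (complexPotential g u) r t x - secondDiff (complexPotential g u) r t y)‖ ≤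
            A * r ^ 2 * σ * |x - y|)
    (h1 : M ≤ M') (h2 : Real.sqrt (b - a) * A ≤ M') (h3 : C₀ * (10 * M) ≤ M') :
    ErrorSystem δ g (b - a) (meshWidth a b J) (timeStep T N) M' K N
      (fun n => restrict a b J (u (timeNode T N n))) V (fun n => η (timeNode T N n))
      (fun n => R (timeStep T N) (timeNode T N n))
      (fun n => restrict a b J (secondDiff (complexPotential g u) (timeStep T N / 2)
        (timeNode T N n))) (exactPotential T a b g u N J) Φ := by
  have hh := meshWidth_pos H.hab J
  have hτ := timeStep_pos H.hT hN
  have s0 := Real.sqrt_nonneg (b - a)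
  have mem : ∀ {n}, n ≤ N → timeNode T N n ∈ Icc 0 T := fun hn => timeNode_mem H.hT hN hn
  have mem' : ∀ {n}, n < N → timeNode T N n + timeStep T N ≤ T := fun {n} hn => by
    rw [← timeNode_succ]; exact (mem (n := n + 1) hn).2
  have e2 : Real.sqrt (b - a) * (A * (timeStep T N / 2) ^ 2) ≤ M' * timeStep T N ^ 2 := by
    have := mul_le_mul_of_nonneg_right h2 (sq_nonneg (timeStep T N))
    have : 0 ≤ Real.sqrt (b - a) * A * timeStep T N ^ 2 := by positivity
    nlinarith
  have hq1 : ∀ {n}, n + 1 < N → 0 ≤ timeNode T N (n + 1) - timeStep T N / 2 := fun {n} hn => by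
    rw [timeNode_succ]; linarith [(mem (n := n) (by omega)).1]
  have hq2 : ∀ {n}, n + 1 < N → timeNode T N (n + 1) + timeStep T N / 2 ≤ T := fun {n} hn => by
    linarith [mem' hn]
  constructor
  · exact hh
  · exact meshWidth_mul a b J
  · exact hτ
  · exact fun n hn => H.vanishesAtBoundary_u (mem hn)
  · exact S.boundary
  · exact fun n => hc.vanishes _
  · exact fun n hn => hc.step_vanishes _ _ hτ.le (mem hn.le).1 (mem' hn)
  · have := H.corrected_zero hc S
    simpa only [solutionError, timeNode_zero, corrected] using this
  · exact fun n hn => (hc.bound _ (mem hn)).trans (by gcongr)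
  · intro n hn
    have := hc.lip _ (mem (n := n + 1) hn) _ (mem hn.le)
    rw [timeNode_succ, add_sub_cancel_left, abs_of_pos hτ, ← timeNode_succ] at this
    exact this.trans (by gcongr)
  · exact fun n hn j => H.hδu _ (mem hn) _ (spaceNode_mem H.hab j)
  · intro n m h1 h2 hm
    exact hu.regularPair (t := fun t => timeNode T N (cond t m n)) H.hab
      (fun t => mem (by cases t <;> simp only [cond] <;> omega)) (abs_timeNode_sub_le H.hT hN h1 h2)
  · intro n m h1 h2 hm
    refine hK.regularPair (t := fun t => midNode T N (cond t m n)) H.hab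
      (fun t => midNode_mem H.hT hN (by cases t <;> simp only [cond] <;> omega)) ?_
    have := abs_timeNode_sub_le H.hT hN h1 h2
    simpa [midNode] using this
  · exact fun n hn => H.exactPotential_boundary hN S hn
  -- The residual of the relaxation is the second difference of the exact potential with step `τ /
  -- 2`, centred at an integer time node.
  · intro n hn j
    simp only [exactPotential, restrict, secondDiff, complexPotential, midNode, timeNode_succ]
    rw [show timeNode T N n + timeStep T N - timeStep T N / 2 =
      timeNode T N n + timeStep T N / 2 by ring]
    simp only [potential, Complex.real_smul]
    push_cast
    ring
  · exact S.phi_succ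
  · intro n hn
    refine (seminormOne_restrict_le H.hab (c := A * (timeStep T N / 2) ^ 2) (by positivity)
      fun x hx y hy => ?_).trans e2
    exact (hA _ _ (by linarith) (hq1 hn) (hq2 hn) x hx y hy).2.1
  · intro n hn
    have := seminormOne_restrict_le H.hab (J := J) (c := A * (timeStep T N / 2) ^ 2 * timeStep T N)
      (z := fun x => secondDiff (complexPotential g u) (timeStep T N / 2) (timeNode T N (n + 2)) x
        - secondDiff (complexPotential g u) (timeStep T N / 2) (timeNode T N (n + 1)) x)
      (by positivity) fun x hx y hy => by
        refine le_trans (le_of_eq (congrArg norm ?_)) (((hA _ (timeNode T N (n + 1))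
          (by linarith) (hq1 (by omega)) (hq2 (by omega)) x hx y hy).2.2 (timeStep T N) hτ.le
          ?_).2)
        · rw [timeNode_succ T N (n + 1), add_comm (timeStep T N)]; ring
        · have := hq2 (n := n + 1) hn
          rw [timeNode_succ T N (n + 1)] at this
          linarith
    refine le_trans this ?_
    have := mul_le_mul_of_nonneg_right e2 hτ.le
    calc _ = Real.sqrt (b - a) * (A * (timeStep T N / 2) ^ 2) * timeStep T N := by ring
      _ ≤ _ := this
      _ = _ := by ring
  · intro n hn i
    have m1 := mem hn.le
    have m2 := mem (n := n + 1) hn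
    have mm := midNode_mem H.hT hN hn
    have hx := spaceNode_mem H.hab (interior i)
    have t1 := hc.step_eq _ _ hτ.le m1.1 (mem' hn) i
    have t2 := S.step n hn i
    rw [← timeNode_succ] at t1
    have e3 : (fun j => (V (n + 1) j + V n j) / 2) = (1 / 2 : ℂ) • (V (n + 1) + V n) := by
      ext j; simp; ring
    rw [e3] at t2
    -- By the choice of `δ` neither cutoff acts on exact data, averages included, so the exact
    -- solution satisfies the modified scheme as well as the original one.
    have e4 : cutoff δ (exactPotential T a b g u N J n (interior i)) =
        potential g u (midNode T N n) (spaceNode a b J (interior i)) :=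
      cutoff_of_abs_le (H.hδg _ mm _ hx)
    have e5 : mollifier δ (stepAverage (fun n => restrict a b J (u (timeNode T N n))) n
        (interior i)) = (u (timeNode T N (n + 1)) (spaceNode a b J (interior i)) +
          u (timeNode T N n) (spaceNode a b J (interior i))) / 2 := by
      rw [mollifier_eq_self]
      · simp [stepAverage, restrict]; ring
      · simp only [stepAverage, restrict, Pi.smul_apply, Pi.add_apply, smul_eq_mul]
        rw [norm_mul, show ‖(1 / 2 : ℂ)‖ = 1 / 2 by norm_num]
        linarith [norm_add_le (u (timeNode T N (n + 1)) (spaceNode a b J (interior i)))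
          (u (timeNode T N n) (spaceNode a b J (interior i))), H.hδu _ m1 _ hx, H.hδu _ m2 _ hx]
    have e6 : (V (n + 1) (interior i) + V n (interior i)) / 2 = stepAverage V n (interior i) := by
      simp [stepAverage]; ring
    rw [e6] at t2
    simp only [productError, Pi.sub_apply, cutoffProduct]
    rw [e4, e5]
    simp only [discreteLaplacian_smul, discreteLaplacian_add] at t1 t2 ⊢
    simp only [solutionError, discreteLaplacian_sub, Pi.sub_apply]
    simp only [corrected, midNode, discreteLaplacian_add, Pi.add_apply] at t1 ⊢
    linear_combination t1 - t2
  · intro n hn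
    refine (hc.step_bound _ _ hτ.le (mem hn.le).1 (mem' hn)).trans (by gcongr)
  · intro n hn
    have := hc.step_lip _ (timeNode T N n) hτ.le (mem (n := n) (by omega)).1 (by
      have := mem' hn
      rw [timeNode_succ] at this
      linarith)
    rw [add_comm (timeStep T N), ← timeNode_succ] at this
    exact this.trans (by gcongr)
  · have := H.seminormOne_initial_potential_le hM hc hN S hu hK hτ1 hτK hC hε
    refine this.trans ?_
    rw [← mul_assoc]
    gcongr

theorem Setting.exists_regular (H : Setting T a b g f u₀ u δ) :
    ∃ K, RegularOn T a b K u ∧ RegularOn T a b K (complexPotential g u) := by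
  obtain ⟨K₁, h1⟩ := (H.smooth_u.of_le (m := 2) (by norm_num)).exists_regularOn H.hT H.hab
  obtain ⟨K₂, h2⟩ := (H.smooth_complexPotential.of_le (m := 2) (by norm_num)).exists_regularOn
    H.hT H.hab
  exact ⟨max K₁ K₂, h1.mono (le_max_left _ _), h2.mono (le_max_right _ _)⟩

/-- The half step is of second order, uniformly in the mesh width. -/
theorem Setting.exists_half_bound (H : Setting T a b g f u₀ u δ) :
    ∃ τ₀ B, 0 < τ₀ ∧ 0 ≤ B ∧ ∀ N J : ℕ, 1 ≤ N → timeStep T N ≤ τ₀ →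
      ∀ (Vhalf : Grid J) (V : ℕ → Grid J) (Φ : ℕ → RealGrid J),
      IsModifiedScheme T a b g f u₀ δ N J Vhalf V Φ →
      seminormOne (meshWidth a b J) (restrict a b J (u (midNode T N 0)) - Vhalf) ≤
        B * (timeStep T N ^ 2 + meshWidth a b J ^ 2) := by
  obtain ⟨K, -, hK⟩ := H.exists_regular
  obtain ⟨M, hM, hc⟩ := H.exists_isCorrection
  have hℓ : 0 < b - a := by linarith [H.hab]
  have hK0 := hK.nonneg
  refine ⟨1 / (K * (1 + (b - a)) + 1), 5 * M, by positivity, by positivity, ?_⟩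
  intro N J hN hτ Vhalf V Φ S
  obtain ⟨η, R, R₀, hc⟩ := hc J
  have hτ0 := timeStep_pos H.hT hN
  rw [le_div_iff₀ (by positivity)] at hτ
  have h1 : 0 ≤ timeStep T N * (K * (1 + (b - a))) := by positivity
  exact H.seminormOne_half_le hM hc hN S hK (by linarith) (by linarith)

/-- Second order convergence for small mesh widths. -/
theorem Setting.exists_fine_bound (H : Setting T a b g f u₀ u δ) :
    ∃ τ₀ h₀ B, 0 < τ₀ ∧ 0 < h₀ ∧ 0 ≤ B ∧ ∀ N J : ℕ, 1 ≤ N → timeStep T N ≤ τ₀ →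
      meshWidth a b J ≤ h₀ → ∀ (Vhalf : Grid J) (V : ℕ → Grid J) (Φ : ℕ → RealGrid J),
      IsModifiedScheme T a b g f u₀ δ N J Vhalf V Φ →
      (∀ n ≤ N, seminormOne (meshWidth a b J) (restrict a b J (u (timeNode T N n)) - V n) ≤
        B * (timeStep T N ^ 2 + meshWidth a b J ^ 2)) ∧
      ∀ n < N, seminormOne (meshWidth a b J)
        (potentialError (exactPotential T a b g u N J) Φ n) ≤
          B * (timeStep T N ^ 2 + meshWidth a b J ^ 2) := by
  obtain ⟨K, hu, hK⟩ := H.exists_regular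
  obtain ⟨M, hM, hc⟩ := H.exists_isCorrection
  obtain ⟨A, hA0, hA⟩ :=
    (H.smooth_complexPotential.of_le (m := 4) (by norm_num)).exists_secondDiff_le H.hT H.hab
  have hg : ContDiffOn ℝ 3 g (Ici 0) := H.hg.of_le (by norm_num)
  have hK0 := hK.nonneg
  obtain ⟨C₀, hC₀, hC⟩ := exists_nonlinear_bound (ℓ := b - a) H.hδ hg hK0
  have hℓ : 0 < b - a := by linarith [H.hab]
  have s0 := Real.sqrt_nonneg (b - a)
  set M' := M + Real.sqrt (b - a) * A + C₀ * (10 * M) with hM'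
  have p1 : 0 ≤ Real.sqrt (b - a) * A := by positivity
  have p2 : 0 ≤ C₀ * (10 * M) := by positivity
  obtain ⟨τ₁, ε₁, B, hτ₁, hε₁, hB, key⟩ := ErrorSystem.exists_bound (ℓ := b - a) (M := M') (K := K)
    H.hδ hg (by positivity) hK0 H.hT
  set ε₀ := min ε₁ (1 / ((Real.sqrt (b - a) + 1) * (10 * M) + 1)) with hε₀
  have hε₀pos : 0 < ε₀ := lt_min hε₁ (by positivity)
  -- If `τ` and `h` are both at most `r`, then `τ² + h² ≤ ε₀`; the conditions on `τ` and on `h`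
  -- remain separate.
  set r := Real.sqrt (ε₀ / 2) with hr
  have hr0 : 0 < r := Real.sqrt_pos.2 (by positivity)
  have hr2 : r ^ 2 = ε₀ / 2 := Real.sq_sqrt (by positivity)
  refine ⟨min r (min τ₁ (1 / (K * (1 + (b - a)) + 1))), r, B + M, by positivity, hr0,
    by positivity, ?_⟩
  intro N J hN hτ hh Vhalf V Φ S
  obtain ⟨η, R, R₀, hc⟩ := hc J
  have hτ0 := timeStep_pos H.hT hN
  have hh0 := meshWidth_pos H.hab J
  have hτr := hτ.trans (min_le_left _ _)
  have hτ' := hτ.trans (min_le_right _ _)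
  have hτK := hτ'.trans (min_le_right _ _)
  rw [le_div_iff₀ (by positivity)] at hτK
  have q1 : 0 ≤ timeStep T N * (K * (1 + (b - a))) := by positivity
  have hε : timeStep T N ^ 2 + meshWidth a b J ^ 2 ≤ ε₀ := by
    have h1 := pow_le_pow_left₀ hτ0.le hτr 2
    have h2 := pow_le_pow_left₀ hh0.le hh 2
    linarith
  have hε' : (Real.sqrt (b - a) + 1) * (10 * M * (timeStep T N ^ 2 + meshWidth a b J ^ 2)) ≤ 1 := by
    have h1 := hε.trans (min_le_right _ _)
    rw [le_div_iff₀ (by positivity)] at h1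
    have h2 : 0 ≤ timeStep T N ^ 2 + meshWidth a b J ^ 2 := by positivity
    linarith
  have E := H.errorSystem hM hc hN S hu hK (by linarith) (by linarith) hC hε' hA0 hA
    (M' := M') (by linarith) (by linarith) (by linarith)
  obtain ⟨k1, k2⟩ := key J _ _ N _ _ _ _ _ _ _ (by omega) (hτ'.trans (min_le_left _ _))
    (mul_timeStep T hN).le (hε.trans (min_le_left _ _)) E
  have hε0 : 0 ≤ timeStep T N ^ 2 + meshWidth a b J ^ 2 := by positivity
  refine ⟨fun n hn => ?_, fun n hn => (k2 n hn).trans ?_⟩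
  · have e : restrict a b J (u (timeNode T N n)) - V n =
        solutionError (fun n => restrict a b J (u (timeNode T N n))) (fun n => η (timeNode T N n))
          V n - η (timeNode T N n) := by
      unfold solutionError; abel
    rw [e]
    refine (seminormOne_sub_le hh0 _ _).trans ?_
    have h1 := k1 n hn
    have h2 := hc.bound _ (timeNode_mem H.hT hN hn)
    have h3 : 0 ≤ M * timeStep T N ^ 2 := by positivity
    linarith
  · exact mul_le_mul_of_nonneg_right (by linarith) hε0

end Scheme

end RelaxNLS

end

noncomputable section

namespace RelaxNLS

open Set

/-! ### Boundedness of the scheme for coarse meshes -/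

section Coarse

variable {T a b : ℝ} {g : ℝ → ℝ} {f : ℝ → ℝ → ℂ} {u₀ : ℝ → ℂ} {u : ℝ → ℝ → ℂ} {δ : ℝ} {N J : ℕ}
  {Vhalf : Grid J} {V : ℕ → Grid J} {Φ : ℕ → RealGrid J}

/-- The cut-off nonlinearity is bounded and Lipschitz continuous. -/
theorem exists_cutoffPotential_lipschitz (hδ : 0 < δ) (hg : ContDiffOn ℝ 3 g (Ici 0)) :
    ∃ L, 0 ≤ L ∧ (∀ z, |g (‖mollifier δ z‖ ^ 2)| ≤ L) ∧
      ∀ z w, |g (‖mollifier δ z‖ ^ 2) - g (‖mollifier δ w‖ ^ 2)| ≤ L * ‖z - w‖ := by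
  obtain ⟨M, hM, -, hlip⟩ := exists_cutoff_lipschitz hδ
  obtain ⟨A, hA, F₁, F₂, h1, -, b0, b1, -⟩ := exists_c2LipOn_of_contDiffOn hg ((200 * δ) ^ 2)
  have mem : ∀ z, ‖mollifier δ z‖ ^ 2 ∈ Icc 0 ((200 * δ) ^ 2) := fun z =>
    ⟨sq_nonneg _, pow_le_pow_left₀ (norm_nonneg _) (norm_mollifier_le hδ z) 2⟩
  have p : 0 ≤ A * (400 * δ * (2 * M)) := by positivity
  refine ⟨A + A * (400 * δ * (2 * M)), by positivity, fun z => ?_, fun z w => ?_⟩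
  · exact (b0 _ (mem z)).trans (by linarith)
  · refine (abs_sub_le_of_deriv_le (convex_Icc _ _) h1 b1 (mem z) (mem w)).trans ?_
    have e : ‖mollifier δ z‖ ^ 2 - ‖mollifier δ w‖ ^ 2 =
      (‖mollifier δ z‖ + ‖mollifier δ w‖) * (‖mollifier δ z‖ - ‖mollifier δ w‖) := by ring
    have h2 : |‖mollifier δ z‖ ^ 2 - ‖mollifier δ w‖ ^ 2| ≤ 400 * δ * (2 * M * ‖z - w‖) := by
      rw [e, abs_mul, abs_of_nonneg (by positivity)]
      have b1 := norm_mollifier_le hδ z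
      have b2 := norm_mollifier_le hδ w
      gcongr
      · linarith
      · exact (abs_norm_sub_norm_le _ _).trans (hlip z w)
    calc _ ≤ A * (400 * δ * (2 * M * ‖z - w‖)) := mul_le_mul_of_nonneg_left h2 hA
      _ = A * (400 * δ * (2 * M)) * ‖z - w‖ := by ring
      _ ≤ _ := mul_le_mul_of_nonneg_right (by linarith) (norm_nonneg _)

/-- An inverse inequality; its constant is harmless because `h` is bounded below. -/
theorem seminormOne_le_of_norm_le {h h₀ ℓ c : ℝ} (hh₀ : 0 < h₀) (hh : h₀ ≤ h)
    (hℓ : h * (J + 1) = ℓ) {v : Grid J} (hc : 0 ≤ c) (hv : ∀ j, ‖v j‖ ≤ c) :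
    seminormOne h v ≤ Real.sqrt ℓ * (2 * c / h₀) := by
  refine seminormOne_le_const (hh₀.trans_le hh) hℓ (by positivity) fun j => ?_
  have h1 : ‖gridDiff v j‖ ≤ 2 * c := by
    refine (norm_sub_le _ _).trans ?_
    linarith [hv j.succ, hv j.castSucc]
  have h2 : 2 * c = h₀ * (2 * c / h₀) := by field_simp
  rw [h2] at h1
  exact h1.trans (mul_le_mul_of_nonneg_right hh (by positivity))

/-- For coarse meshes all approximations are bounded. -/
theorem Setting.exists_coarse_bound (H : Setting T a b g f u₀ u δ) {h₀ : ℝ} (hh₀ : 0 < h₀) :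
    ∃ B, 0 ≤ B ∧ ∀ N J : ℕ, 1 ≤ N → h₀ ≤ meshWidth a b J →
      ∀ (Vhalf : Grid J) (V : ℕ → Grid J) (Φ : ℕ → RealGrid J),
      IsModifiedScheme T a b g f u₀ δ N J Vhalf V Φ →
      (∀ n ≤ N, seminormOne (meshWidth a b J) (restrict a b J (u (timeNode T N n)) - V n) ≤ B) ∧
      ∀ n < N, seminormOne (meshWidth a b J)
        (potentialError (exactPotential T a b g u N J) Φ n) ≤ B := by
  obtain ⟨L, hL, hL1, hL2⟩ := exists_cutoffPotential_lipschitz H.hδ (H.hg.of_le (by norm_num))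
  obtain ⟨F, hF, hFb⟩ := H.exists_source_bound
  obtain ⟨A, hA, hAb⟩ := ((H.smooth_u.partial_x H.hT H.hab).partial_x H.hT H.hab).exists_bound
  have hδ := H.hδ
  have hT := H.hT
  have hab := H.hab
  have hℓ : 0 < b - a := by linarith
  set s := Real.sqrt (b - a) with hs
  have s0 : 0 ≤ s := Real.sqrt_nonneg _
  -- The constants bound in turn the forcing, the seminorm of `V`, the time increments of `V`
  -- divided by `τ`, and the values of `Φ`.
  set c₁ := 100 * δ * (200 * δ) + F with hc₁
  have hc₁0 : 0 ≤ c₁ := by positivity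
  set c₂ := (b - a) * s * A + T * (s * (2 * c₁ / h₀)) with hc₂
  have hc₂0 : 0 ≤ c₂ := by positivity
  set c₃ := 4 * (s * c₂) / h₀ ^ 2 + c₁ with hc₃
  have hc₃0 : 0 ≤ c₃ := by positivity
  set c₄ := 3 * L + T * (2 * (L * c₃)) with hc₄
  have hc₄0 : 0 ≤ c₄ := by positivity
  have p1 : 0 ≤ s * (2 * (δ + s * c₂) / h₀) := by positivity
  have p2 : 0 ≤ s * (2 * (δ + c₄) / h₀) := by positivity
  refine ⟨s * (2 * (δ + s * c₂) / h₀) + s * (2 * (δ + c₄) / h₀), by positivity, ?_⟩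
  intro N J hN hh Vhalf V Φ S
  have hh0 := meshWidth_pos hab J
  have hmesh := meshWidth_mul a b J
  have hτ := timeStep_pos hT hN
  have hNτ := mul_timeStep T hN
  have mem : ∀ {n}, n ≤ N → timeNode T N n ∈ Icc 0 T := fun hn => timeNode_mem hT hN hn
  have hinit : ∀ x ∈ Icc a b, u 0 x = u₀ x := H.hsol.initial
  have hstep := S.step
  set τ := timeStep T N with hτdef
  set h := meshWidth a b J with hhdef
  -- Thanks to the cutoffs the nonlinear term is a bounded source, whatever the approximations are.
  have hforce : ∀ n < N, ∀ i : Fin J, ‖Complex.I * (τ : ℂ) * ((cutoff δ (Φ n (interior i)) : ℂ) *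
      mollifier δ ((V (n + 1) (interior i) + V n (interior i)) / 2)) + (τ : ℂ) *
      ((f (timeNode T N (n + 1)) (spaceNode a b J (interior i))
        + f (timeNode T N n) (spaceNode a b J (interior i))) / 2)‖ ≤ τ * c₁ := by
    intro n hn i
    have hx := spaceNode_mem hab (interior i)
    refine (norm_add_le _ _).trans ?_
    rw [norm_mul, norm_I_mul_ofReal hτ.le, norm_mul, norm_mul (τ : ℂ), norm_div,
      Complex.norm_real, Complex.norm_real, Real.norm_of_nonneg hτ.le, Real.norm_eq_abs,
      ← mul_add, RCLike.norm_ofNat]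
    refine mul_le_mul_of_nonneg_left (add_le_add ?_ ?_) hτ.le
    · exact mul_le_mul (abs_cutoff_le hδ _) (norm_mollifier_le hδ _) (norm_nonneg _) (by positivity)
    · have f1 := hFb _ (mem (n := n + 1) hn) _ hx
      have f2 := hFb _ (mem hn.le) _ hx
      have := norm_add_le (f (timeNode T N (n + 1)) (spaceNode a b J (interior i)))
        (f (timeNode T N n) (spaceNode a b J (interior i)))
      linarith
  have avg : ∀ n, (fun j => (V (n + 1) j + V n j) / 2) = (1 / 2 : ℂ) • (V (n + 1) + V n) := by
    intro n; ext j; simp; ring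
  have hV : ∀ n ≤ N, seminormOne h (V n) ≤ c₂ := by
    have key : ∀ n ≤ N, seminormOne h (V n) ≤ (b - a) * s * A + n * τ * (s * (2 * c₁ / h₀)) := by
      intro n
      induction n with
      | zero =>
        intro _
        have := seminormOne_le_of_discreteLaplacian_le hh0 hmesh S.initial.1 hA fun i => ?_
        · simpa using this
        · rw [S.initial.2, ← iteratedDerivWithin_congr (f := fun y => u 0 y) (g := u₀) hinit
            (spaceNode_mem H.hab _), ← dx_dx_eq_iteratedDerivWithin]
          exact hAb 0 ⟨le_rfl, hT.le⟩ _ (spaceNode_mem hab _)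
      | succ n ih =>
        intro hn
        set ρ : Grid J := extendZero fun i => Complex.I * (τ : ℂ) *
          ((cutoff δ (Φ n (interior i)) : ℂ) *
          mollifier δ ((V (n + 1) (interior i) + V n (interior i)) / 2)) + (τ : ℂ) *
          ((f (timeNode T N (n + 1)) (spaceNode a b J (interior i))
          + f (timeNode T N n) (spaceNode a b J (interior i))) / 2) with hρ
        have vρ : VanishesAtBoundary ρ := extendZero_vanishes _
        have bρ : ∀ j, ‖ρ j‖ ≤ τ * c₁ := by
          intro j
          rcases eq_boundary_or_interior j with rfl | rfl | ⟨i, rfl⟩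
          · rw [vρ.1, norm_zero]; positivity
          · rw [vρ.2, norm_zero]; positivity
          · rw [hρ, extendZero_interior]; exact hforce n hn i
        have e := energy_inequality hh0 (S.boundary _ hn) (S.boundary n (by omega)) vρ (τ / 2)
          fun i => by
            rw [hstep n hn i, avg, discreteLaplacian_smul, hρ, extendZero_interior]
            push_cast
            ring
        have b2 := seminormOne_le_of_norm_le hh₀ hh hmesh (by positivity) bρ
        have b3 := ih (by omega)
        have e2 : s * (2 * (τ * c₁) / h₀) = τ * (s * (2 * c₁ / h₀)) := by ring
        rw [← hs, e2] at b2
        push_cast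
        linarith
    intro n hn
    refine (key n hn).trans ?_
    have h1 : (n : ℝ) * τ ≤ T := (mem hn).2
    have h2 : 0 ≤ s * (2 * c₁ / h₀) := by positivity
    have := mul_le_mul_of_nonneg_right h1 h2
    linarith
  have hVsup : ∀ n ≤ N, ∀ j, ‖V n j‖ ≤ s * c₂ := fun n hn j =>
    (norm_le_seminormOne hh0 hmesh (S.boundary n hn).1 j).trans
      (mul_le_mul_of_nonneg_left (hV n hn) s0)
  -- On a coarse mesh the discrete Laplacian is a bounded operator, so one step changes `V` by a
  -- multiple of `τ` only.
  have hVlip : ∀ n < N, ∀ j, ‖V (n + 1) j - V n j‖ ≤ τ * c₃ := by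
    intro n hn j
    have z1 := S.boundary n hn.le
    have z2 := S.boundary (n + 1) hn
    rcases eq_boundary_or_interior j with rfl | rfl | ⟨i, rfl⟩
    · rw [z1.1, z2.1, sub_zero, norm_zero]; positivity
    · rw [z1.2, z2.2, sub_zero, norm_zero]; positivity
    · have hv : ∀ j, ‖(V (n + 1) j + V n j) / 2‖ ≤ s * c₂ := by
        intro j
        rw [norm_div, RCLike.norm_ofNat]
        linarith [norm_add_le (V (n + 1) j) (V n j), hVsup n hn.le j, hVsup (n + 1) hn j]
      have hlap : ‖discreteLaplacian h (fun j => (V (n + 1) j + V n j) / 2) i‖ ≤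
          4 * (s * c₂) / h₀ ^ 2 := by
        unfold discreteLaplacian
        rw [norm_div, norm_pow, Complex.norm_real, Real.norm_of_nonneg hh0.le]
        refine div_le_div₀ (by positivity) ?_ (by positivity) (pow_le_pow_left₀ hh₀.le hh 2)
        refine (norm_add_le _ _).trans ((add_le_add_left (norm_sub_le _ _) _).trans ?_)
        rw [norm_mul, RCLike.norm_ofNat]
        linarith [hv i.castSucc.castSucc, hv i.succ.castSucc, hv i.succ.succ]
      rw [hstep n hn i, add_assoc]
      refine (norm_add_le _ _).trans ?_
      rw [norm_mul, norm_I_mul_ofReal hτ.le, hc₃, mul_add]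
      exact add_le_add (mul_le_mul_of_nonneg_left hlap hτ.le) (hforce n hn i)
  have hΦ : ∀ n < N, ∀ j, |Φ n j| ≤ c₄ := by
    -- A direct use of the relaxation would let the bound grow with the number of steps. Its
    -- two-step increments are twice the increments of `g(|γ_δ(V)|²)` and hence of order `τ`; `3 L`
    -- bounds the first two values.
    have key : ∀ n j, (n < N → |Φ n j| ≤ 3 * L + n * τ * (2 * (L * c₃))) ∧
        (n + 1 < N → |Φ (n + 1) j| ≤ 3 * L + (n + 1 : ℕ) * τ * (2 * (L * c₃))) := by
      intro n j
      induction n with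
      | zero =>
        have h0 : |Φ 0 j| ≤ L := by rw [S.phi_zero]; exact hL1 _
        refine ⟨fun _ => by simp; linarith, fun h1 => ?_⟩
        have e := S.phi_succ 0 h1 j
        have h2 := hL1 (V (0 + 1) j)
        have h3 : 0 ≤ ((0 + 1 : ℕ) : ℝ) * τ * (2 * (L * c₃)) := by positivity
        rw [e]
        rw [abs_le] at h0 h2 ⊢
        constructor <;> linarith
      | succ n ih =>
        refine ⟨ih.2, fun h1 => ?_⟩
        have e1 := S.phi_succ (n + 1) h1 j
        have e0 := S.phi_succ n (by omega) j
        have h2 := (hL2 (V (n + 1 + 1) j) (V (n + 1) j)).trans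
          (mul_le_mul_of_nonneg_left (hVlip (n + 1) (by omega) j) hL)
        have h3 := ih.1 (by omega)
        have h4 : 0 ≤ τ * (L * c₃) := by positivity
        push_cast
        rw [abs_le] at h2 h3 ⊢
        constructor <;> linarith
    intro n hn j
    refine ((key n j).1 hn).trans ?_
    have h1 : (n : ℝ) * τ ≤ T := (mem hn.le).2
    have h2 : 0 ≤ 2 * (L * c₃) := by positivity
    have := mul_le_mul_of_nonneg_right h1 h2
    linarith
  constructor
  · intro n hn
    have := seminormOne_le_of_norm_le hh₀ hh hmesh (v := restrict a b J (u (timeNode T N n)) - V n)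
      (c := δ + s * c₂) (by positivity) fun j => (norm_sub_le _ _).trans
        (add_le_add (H.hδu _ (mem hn) _ (spaceNode_mem hab j)) (hVsup n hn j))
    linarith
  · intro n hn
    have := seminormOne_le_of_norm_le hh₀ hh hmesh
      (v := potentialError (exactPotential T a b g u N J) Φ n)
      (c := δ + c₄) (by positivity) fun j => (norm_sub_le _ _).trans (add_le_add (by
        simp only [toGrid, Complex.norm_real]
        exact H.hδg _ (midNode_mem hT hN hn) _ (spaceNode_mem hab j)) (by
        simp only [toGrid, Complex.norm_real]
        exact hΦ n hn j))
    linarith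

end Coarse

end RelaxNLS

end

/-! ### Combination of fine and coarse meshes -/

theorem mainTheorem3 (T a b : ℝ) (hT : 0 < T) (hab : a < b)
    (g : ℝ → ℝ) (f : ℝ → ℝ → ℂ) (u₀ : ℝ → ℂ) (u : ℝ → ℝ → ℂ)
    (hg : ContDiffOn ℝ 5 g (Set.Ici 0))
    (hu : ContDiffOn ℝ 6 (fun p : ℝ × ℝ => u p.1 p.2) (Set.Icc 0 T ×ˢ Set.Icc a b))
    (hsol : RelaxNLS.IsSolution T a b g f u₀ u)
    (δ : ℝ) (hδ : 0 < δ)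
    (hδu : ∀ t ∈ Set.Icc 0 T, ∀ x ∈ Set.Icc a b, ‖u t x‖ ≤ δ)
    (hδg : ∀ t ∈ Set.Icc 0 T, ∀ x ∈ Set.Icc a b, |g (‖u t x‖ ^ 2)| ≤ δ) :
    ∃ CA CB CC : ℝ, 0 < CA ∧ 0 < CB ∧ 0 < CC ∧
      ∀ N J : ℕ, 1 ≤ N → 1 ≤ J → RelaxNLS.timeStep T N * CA ≤ 1 / 2 →
      ∀ (Vhalf : RelaxNLS.Grid J) (V : ℕ → RelaxNLS.Grid J) (Φ : ℕ → RelaxNLS.RealGrid J),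
      RelaxNLS.IsModifiedScheme T a b g f u₀ δ N J Vhalf V Φ →
        (∀ m ≤ N,
          RelaxNLS.normOne (RelaxNLS.meshWidth a b J)
              (RelaxNLS.restrict a b J (u (RelaxNLS.midNode T N 0)) - Vhalf)
            + RelaxNLS.normOne (RelaxNLS.meshWidth a b J)
              (RelaxNLS.restrict a b J (u (RelaxNLS.timeNode T N m)) - V m)
            ≤ CB * (RelaxNLS.timeStep T N ^ 2 + RelaxNLS.meshWidth a b J ^ 2)) ∧
        (∀ m < N,
          RelaxNLS.normOne (RelaxNLS.meshWidth a b J)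
              (fun j =>
                ((g (‖u (RelaxNLS.midNode T N m) (RelaxNLS.spaceNode a b J j)‖ ^ 2) - Φ m j : ℝ) : ℂ))
            ≤ CC * (RelaxNLS.timeStep T N ^ 2 + RelaxNLS.meshWidth a b J ^ 2)) := by
  have H : RelaxNLS.Setting T a b g f u₀ u δ := ⟨hT, hab, hg, hu, hsol, hδ, hδu, hδg⟩
  obtain ⟨τ₁, B₁, hτ₁, hB₁, half⟩ := H.exists_half_bound
  obtain ⟨τ₂, h₀, B₂, hτ₂, hh₀, hB₂, fine⟩ := H.exists_fine_bound
  obtain ⟨B₃, hB₃, coarse⟩ := H.exists_coarse_bound hh₀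
  have hℓ : 0 < b - a := by linarith
  set τ₀ := min τ₁ τ₂ with hτ₀
  have hτ₀pos : 0 < τ₀ := lt_min hτ₁ hτ₂
  set D := B₂ + B₃ / h₀ ^ 2 with hD
  have hD0 : 0 ≤ D := by positivity
  -- With this `CA` the step condition reads `τ ≤ τ₀`. The factor `2 (b - a) + 1` passes from the
  -- seminorm to the norm, and the added `1` only secures positivity.
  refine ⟨1 / (2 * τ₀), (2 * (b - a) + 1) * (B₁ + D) + 1, (2 * (b - a) + 1) * D + 1,
    by positivity, by positivity, by positivity, ?_⟩
  intro N J hN _ hτ Vhalf V Φ S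
  have hτ' : RelaxNLS.timeStep T N ≤ τ₀ := by
    rw [mul_one_div, div_le_div_iff₀ (by positivity) (by norm_num)] at hτ
    linarith
  have hh := RelaxNLS.meshWidth_pos hab J
  have hmesh := RelaxNLS.meshWidth_mul a b J
  set ε := RelaxNLS.timeStep T N ^ 2 + RelaxNLS.meshWidth a b J ^ 2 with hε
  have hε0 : 0 ≤ ε := by positivity
  have key : (∀ n ≤ N, RelaxNLS.seminormOne (RelaxNLS.meshWidth a b J)
      (RelaxNLS.restrict a b J (u (RelaxNLS.timeNode T N n)) - V n) ≤ D * ε) ∧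
      ∀ n < N, RelaxNLS.seminormOne (RelaxNLS.meshWidth a b J)
        (RelaxNLS.potentialError (RelaxNLS.exactPotential T a b g u N J) Φ n) ≤ D * ε := by
    rcases le_total (RelaxNLS.meshWidth a b J) h₀ with hle | hle
    · obtain ⟨k1, k2⟩ := fine N J hN (hτ'.trans (min_le_right _ _)) hle Vhalf V Φ S
      have : B₂ * ε ≤ D * ε := mul_le_mul_of_nonneg_right
        (by rw [hD]; linarith [show 0 ≤ B₃ / h₀ ^ 2 by positivity]) hε0
      exact ⟨fun n hn => (k1 n hn).trans this, fun n hn => (k2 n hn).trans this⟩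
    · obtain ⟨k1, k2⟩ := coarse N J hN hle Vhalf V Φ S
      -- On a coarse mesh `ε ≥ h₀²`, so boundedness already is the claimed estimate.
      have : B₃ ≤ D * ε := by
        have h1 : h₀ ^ 2 ≤ ε := by
          have := pow_le_pow_left₀ hh₀.le hle 2
          rw [hε]; linarith [sq_nonneg (RelaxNLS.timeStep T N)]
        calc B₃ = B₃ / h₀ ^ 2 * h₀ ^ 2 := by field_simp
          _ ≤ B₃ / h₀ ^ 2 * ε := mul_le_mul_of_nonneg_left h1 (by positivity)
          _ ≤ D * ε := mul_le_mul_of_nonneg_right (by rw [hD]; linarith) hε0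
      exact ⟨fun n hn => (k1 n hn).trans this, fun n hn => (k2 n hn).trans this⟩
  have mh := RelaxNLS.midNode_mem hT hN (n := 0) (by omega)
  have hnorm : ∀ {v : RelaxNLS.Grid J} {c : ℝ}, v 0 = 0 →
      RelaxNLS.seminormOne (RelaxNLS.meshWidth a b J) v ≤ c →
      RelaxNLS.normOne (RelaxNLS.meshWidth a b J) v ≤ (2 * (b - a) + 1) * c := fun hv hc =>
    (RelaxNLS.normOne_le_seminormOne hh hmesh hv).trans
      (mul_le_mul_of_nonneg_left hc (by positivity))
  constructor
  · intro m hm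
    have h1 := hnorm (((H.vanishesAtBoundary_u mh).sub S.boundary_half).1)
      (half N J hN (hτ'.trans (min_le_left _ _)) Vhalf V Φ S)
    have h2 := hnorm (((H.vanishesAtBoundary_u (RelaxNLS.timeNode_mem hT hN hm)).sub
      (S.boundary m hm)).1) (key.1 m hm)
    rw [← hε] at h1
    linarith
  · intro m hm
    have e : (fun j => ((g (‖u (RelaxNLS.midNode T N m) (RelaxNLS.spaceNode a b J j)‖ ^ 2)
        - Φ m j : ℝ) : ℂ)) =
        RelaxNLS.potentialError (RelaxNLS.exactPotential T a b g u N J) Φ m := by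
      ext j
      simp [RelaxNLS.potentialError, RelaxNLS.toGrid, RelaxNLS.exactPotential,
        RelaxNLS.potential]
    rw [e]
    have h1 := hnorm (by
      simp [RelaxNLS.potentialError, RelaxNLS.toGrid, H.exactPotential_boundary hN S hm])
      (key.2 m hm)
    linarith
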